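/- Let $n\ge 2$ and let $M$ be a smooth $n$-dimensional manifold diffeomorphic to the Euclidean sphere $S^n$. Let $(g,\nabla)$ be a statistical structure on $M$, that is, $g$ is a smooth Riemannian metric and $\nabla$ a smooth torsion-free affine connection on $M$ such that the cubic form $(\nabla g)(X,Y,Z)=(\nabla_X g)(Y,Z)$ is symmetric in all its arguments. Let $R(X,Y)Z=\nabla_X\nabla_YZ-\nabla_Y\nabla_XZ-\nabla_{[X,Y]}Z$ be the curvature tensor of $\nabla$, $\mathrm{Ric}(Y,Z)=\operatorname{tr}\{X\mapsto R(X,Y)Z\}$ its Ricci tensor, and let $\overline\nabla$ be the dual connection of $\nabla$ relative to $g$, defined by $X\,g(Y,Z)=g(\nabla_XY,Z)+g(Y,\overline\nabla_XZ)$, with curvature tensor $\overline R$. The structure is called conjugate symmetric if $R=\overline R$. The connection $\nabla$ is called projectively flat if every point of $M$ has an open neighbourhood $U$ with a smooth one-form $\varphi$ on $U$ such that the connection $\nabla'_XY=\nabla_XY+\varphi(X)Y+\varphi(Y)X$ on $U$ is flat. A connection is called complete if for every $p\in M$ and $v\in T_pM$ there is a geodesic $\gamma:\mathbb R\to M$ of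 the connection, defined on the whole real line, with $\gamma(0)=p$ and $\dot\gamma(0)=v$. 1. If $\mathrm{Ric}$ is symmetric and non-degenerate at every point and $\nabla$ is projectively flat, then $\nabla$ is complete. 2. If $(g,\nabla)$ is conjugate symmetric and $\nabla$ is projectively flat, then both $\nabla$ and $\overline\nabla$ are complete. -/

import Mathlib

open scoped Manifold ContDiff Topology Bundle

noncomputable section

namespace StatGeom

variable {E : Type*} [NormedAddCommGroup E] [NormedSpace ℝ E] [FiniteDimensional ℝ E]
  {H : Type*} [TopologicalSpace H] {I : ModelWithCorners ℝ E H}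
  {M : Type*} [TopologicalSpace M] [ChartedSpace H M] [IsManifold I ∞ M]

/-- Affine connections on `M`: covariant derivatives on the tangent bundle. The value of
`∇_X Y` at `x` is written `cov Y x (X x)`. -/
abbrev AffineConnection (I : ModelWithCorners ℝ E H) (M : Type*) [TopologicalSpace M]
    [ChartedSpace H M] [IsManifold I ∞ M] : Type _ :=
  CovariantDerivative I E (fun x : M ↦ TangentSpace I x)

/-! ### Curvature and Ricci tensor -/

/-- `∇_X ∇_Y Z - ∇_Y ∇_X Z - ∇_{[X, Y]} Z` for vector fields `X`, `Y`, `Z`. -/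
def curvatureField (cov : AffineConnection I M) (X Y Z : Π x : M, TangentSpace I x) (x : M) :
    TangentSpace I x :=
  cov (fun y ↦ cov Z y (Y y)) x (X x) - cov (fun y ↦ cov Z y (X y)) x (Y x)
    - cov Z x (VectorField.mlieBracket I X Y x)

/-- The curvature tensor `R(u, v) w` at `x`, computed on the extensions of `u`, `v`, `w` to
vector fields that are constant (hence smooth) in the preferred chart around `x`. -/
def curvature (cov : AffineConnection I M) (x : M) (u v w : TangentSpace I x) :
    TangentSpace I x :=
  curvatureField cov (FiberBundle.extend E u) (FiberBundle.extend E v) (FiberBundle.extend E w) x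

/-- If `∇` is smooth then `∇ Z` is differentiable at `x`, for `Z` the local constant extension
of a tangent vector at `x`. -/
theorem mdifferentiableAt_cov_extend [T2Space M] (cov : AffineConnection I M)
    [hcov : CovariantDerivative.ContMDiffCovariantDerivative cov ∞]
    {x : M} (w : TangentSpace I x) :
    MDifferentiableAt I (I.prod 𝓘(ℝ, E →L[ℝ] E))
      (fun y ↦ Bundle.TotalSpace.mk' (E →L[ℝ] E)
        (E := fun y : M ↦ TangentSpace I y →L[ℝ] TangentSpace I y) y
        (cov (FiberBundle.extend E w) y)) x := by
  obtain ⟨s, hs, hsw⟩ := FiberBundle.exists_contMDiffOn_extend (k := ∞) I E w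
  obtain ⟨u, hus, hu, hxu⟩ := mem_nhds_iff.1 hs
  obtain ⟨f, -, hf⟩ := (SmoothBumpFunction.nhds_basis_tsupport (I := I) x).mem_iff.1
    (hu.mem_nhds hxu)
  have h1 : ContMDiff I (I.prod 𝓘(ℝ, E)) ∞
      (fun y ↦ Bundle.TotalSpace.mk' E (E := fun y : M ↦ TangentSpace I y) y
        (((f : M → ℝ) • FiberBundle.extend E w : Π y : M, TangentSpace I y) y)) :=
    ContMDiffOn.smul_section_of_tsupport (f.contMDiff.contMDiffOn) hu hf (hsw.mono hus)
  have h2 := (hcov.contMDiff.contMDiff (σ := ((f : M → ℝ) • FiberBundle.extend E w))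
    (by simpa using h1.contMDiffOn))
  have h3 := (h2.contMDiffAt (by simp)).mdifferentiableAt (x := x) (by simp)
  refine h3.congr_of_eventuallyEq ?_
  have hev : ∀ᶠ y in 𝓝 x, ∀ᶠ z in 𝓝 y, f z = 1 := f.eventuallyEq_one.eventually_nhds
  filter_upwards [hev, hu.mem_nhds hxu] with y hy hyu
  congr 1
  refine cov.isCovariantDerivativeOnUniv.congr_of_eventuallyEq
    ((hsw.mono hus).contMDiffAt (hu.mem_nhds hyu) |>.mdifferentiableAt (by simp))
    (h1.contMDiffAt.mdifferentiableAt (by simp)) Filter.univ_mem ?_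
  filter_upwards [hy] with z hz
  simp [hz]

/-- For a smooth connection, `X ↦ R(X, v) w` is tensorial. -/
theorem tensorialAt_curvatureField [T2Space M] (cov : AffineConnection I M)
    [CovariantDerivative.ContMDiffCovariantDerivative cov ∞] (x : M) (v w : TangentSpace I x) :
    TensorialAt I E (fun X : Π x : M, TangentSpace I x ↦
      curvatureField cov X (FiberBundle.extend E v) (FiberBundle.extend E w) x) x where
  smul {f X} hf hX := by
    have hZ := (mdifferentiableAt_cov_extend cov w).clm_bundle_apply
      (E₁ := fun y : M ↦ TangentSpace I y) (E₂ := fun y : M ↦ TangentSpace I y) hX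
    have h := cov.isCovariantDerivativeOnUniv.leibniz hZ hf
    have e : (fun y ↦ cov (FiberBundle.extend E w) y ((f • X) y)) =
        f • fun y ↦ cov (FiberBundle.extend E w) y (X y) := by
      ext y; simp
    simp only [curvatureField, e]
    rw [h, VectorField.mlieBracket_smul_left hf hX]
    simp
    module
  add {X X'} hX hX' := by
    have hZ := (mdifferentiableAt_cov_extend cov w).clm_bundle_apply
      (E₁ := fun y : M ↦ TangentSpace I y) (E₂ := fun y : M ↦ TangentSpace I y) hX
    have hZ' := (mdifferentiableAt_cov_extend cov w).clm_bundle_apply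
      (E₁ := fun y : M ↦ TangentSpace I y) (E₂ := fun y : M ↦ TangentSpace I y) hX'
    have h := cov.isCovariantDerivativeOnUniv.add hZ hZ'
    have e : (fun y ↦ cov (FiberBundle.extend E w) y ((X + X') y)) =
        (fun y ↦ cov (FiberBundle.extend E w) y (X y)) +
          fun y ↦ cov (FiberBundle.extend E w) y (X' y) := by
      ext y; simp
    simp only [curvatureField, e]
    rw [h, VectorField.mlieBracket_add_left hX hX']
    simp
    abel

/-- The endomorphism `u ↦ R(u, v) w` of the tangent space at `x`. -/
def curvatureEnd [T2Space M] (cov : AffineConnection I M)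
    [CovariantDerivative.ContMDiffCovariantDerivative cov ∞] (x : M) (v w : TangentSpace I x) :
    TangentSpace I x →L[ℝ] TangentSpace I x :=
  TensorialAt.mkHom _ x (tensorialAt_curvatureField cov x v w)

theorem curvatureEnd_apply [T2Space M] (cov : AffineConnection I M)
    [CovariantDerivative.ContMDiffCovariantDerivative cov ∞] (x : M) (u v w : TangentSpace I x) :
    curvatureEnd cov x v w u = curvature cov x u v w := rfl

/-- The Ricci tensor `Ric(v, w) = tr (u ↦ R(u, v) w)`. -/
def ricci [T2Space M] (cov : AffineConnection I M)
    [CovariantDerivative.ContMDiffCovariantDerivative cov ∞] (x : M) (v w : TangentSpace I x) : ℝ :=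
  LinearMap.trace ℝ (TangentSpace I x) (curvatureEnd cov x v w).toLinearMap

/-- The Ricci tensor is symmetric. -/
def RicciSymmetric [T2Space M] (cov : AffineConnection I M)
    [CovariantDerivative.ContMDiffCovariantDerivative cov ∞] : Prop :=
  ∀ (x : M) (v w : TangentSpace I x), ricci cov x v w = ricci cov x w v

/-- The (symmetric) Ricci tensor is non-degenerate at every point. -/
def RicciNondegenerate [T2Space M] (cov : AffineConnection I M)
    [CovariantDerivative.ContMDiffCovariantDerivative cov ∞] : Prop :=
  ∀ (x : M) (v : TangentSpace I x), (∀ w : TangentSpace I x, ricci cov x v w = 0) → v = 0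

/-! ### Projective flatness -/

/-- The bilinear map `(w, v) ↦ φ(v) w + φ(w) v`. -/
def projectiveTerm {x : M} (φ : TangentSpace I x →L[ℝ] ℝ) :
    TangentSpace I x →L[ℝ] TangentSpace I x →L[ℝ] TangentSpace I x :=
  have : FiniteDimensional ℝ (TangentSpace I x) := inferInstanceAs (FiniteDimensional ℝ E)
  have : T2Space (TangentSpace I x) := inferInstanceAs (T2Space E)
  have h : IsBilinearMap ℝ (fun w v : TangentSpace I x ↦ φ v • w + φ w • v) :=
    { add_left := fun w w' v ↦ by simp only [map_add]; module
      smul_left := fun c w v ↦ by simp only [map_smul, smul_eq_mul]; module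
      add_right := fun w v v' ↦ by simp only [map_add]; module
      smul_right := fun c w v ↦ by simp only [map_smul, smul_eq_mul]; module }
  h.toContinuousBilinearMap

/-- The connection `∇'_X Y = ∇_X Y + φ(X) Y + φ(Y) X`, for a one-form `φ`. It has the same
torsion as `∇`. -/
def projectiveChange (cov : AffineConnection I M) (φ : Π x : M, TangentSpace I x →L[ℝ] ℝ) :
    AffineConnection I M :=
  cov.addOneForm fun x ↦ projectiveTerm (φ x)

theorem projectiveChange_apply (cov : AffineConnection I M)
    (φ : Π x : M, TangentSpace I x →L[ℝ] ℝ) (Y : Π x : M, TangentSpace I x) (x : M)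
    (v : TangentSpace I x) :
    projectiveChange cov φ Y x v = cov Y x v + (φ x v • Y x + φ x (Y x) • v) := rfl

/-- A (torsion-free) connection is projectively flat if around every point it is projectively
equivalent to a flat connection. -/
def ProjectivelyFlat (cov : AffineConnection I M) : Prop :=
  ∀ p : M, ∃ U : Set M, IsOpen U ∧ p ∈ U ∧ ∃ φ : Π x : M, TangentSpace I x →L[ℝ] ℝ,
    ContMDiffOn I (I.prod 𝓘(ℝ, E →L[ℝ] ℝ)) ∞
      (fun x ↦ Bundle.TotalSpace.mk' (E →L[ℝ] ℝ)
        (E := fun x : M ↦ TangentSpace I x →L[ℝ] Bundle.Trivial M ℝ x) x (φ x)) U ∧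
    ∀ x ∈ U, ∀ u v w : TangentSpace I x, curvature (projectiveChange cov φ) x u v w = 0

/-! ### Geodesics and completeness -/

/-- The velocity vector of a curve. -/
def velocity (I : ModelWithCorners ℝ E H) (γ : ℝ → M) (t : ℝ) : TangentSpace I (γ t) :=
  mfderiv 𝓘(ℝ, ℝ) I γ t (1 : ℝ)

/-- The covariant derivative at time `t` of a vector field `V = ∑ Vⁱ ∂ᵢ` along a curve `γ`, namely
`∑ (dVⁱ/dt) ∂ᵢ + ∑ Vⁱ ∇_{γ'} ∂ᵢ`, in the preferred chart around `γ t`. -/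
def covAlong (cov : AffineConnection I M) (γ : ℝ → M) (V : Π t : ℝ, TangentSpace I (γ t)) (t : ℝ) :
    TangentSpace I (γ t) :=
  (trivializationAt E (fun x : M ↦ TangentSpace I x) (γ t)).symm (γ t)
      (deriv (fun s ↦ (trivializationAt E (fun x : M ↦ TangentSpace I x) (γ t) ⟨γ s, V s⟩).2) t)
    + cov (FiberBundle.extend E (V t)) (γ t) (velocity I γ t)

/-- Geodesics, in their affine parameter, defined on the whole real line:
`∇_{γ'} γ' = 0`. -/
structure IsGeodesic (cov : AffineConnection I M) (γ : ℝ → M) : Prop where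
  contMDiff : ContMDiff 𝓘(ℝ, ℝ) I ∞ γ
  covAlong_velocity (t : ℝ) : covAlong cov γ (velocity I γ) t = 0

/-- A connection is complete if every initial velocity is that of a geodesic defined on the whole
real line. -/
def GeodesicallyComplete (cov : AffineConnection I M) : Prop :=
  ∀ v : TangentBundle I M, ∃ γ : ℝ → M, IsGeodesic cov γ ∧
    (⟨γ 0, velocity I γ 0⟩ : TangentBundle I M) = v

/-! ### Statistical structures -/

section Statistical

variable [Bundle.RiemannianBundle (fun x : M ↦ TangentSpace I x)]
  [IsContMDiffRiemannianBundle I ∞ E (fun x : M ↦ TangentSpace I x)]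

/-- The cubic form `(∇ g)(u, v, w) = (∇_u g)(v, w)` at `x`, `g` being the Riemannian metric. -/
def cubicForm (cov : AffineConnection I M) (x : M) (u v w : TangentSpace I x) : ℝ :=
  cov.derivMetricTensor x v w u

/-- `(g, ∇)` is a statistical structure, `g` being the Riemannian metric: `∇` is torsion-free and
`∇ g` is symmetric in all arguments. -/
structure IsStatistical (cov : AffineConnection I M) : Prop where
  torsion_eq_zero : cov.torsion = 0
  symm_left (x : M) (u v w : TangentSpace I x) : cubicForm cov x u v w = cubicForm cov x v u w
  symm_right (x : M) (u v w : TangentSpace I x) : cubicForm cov x u v w = cubicForm cov x u w v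

/-- The linear form `w ↦ (∇_v g)(z, w)`. -/
def nablaMetric (cov : AffineConnection I M) (x : M) (z v : TangentSpace I x) :
    TangentSpace I x →ₗ[ℝ] ℝ where
  toFun w := cov.derivMetricTensor x z w v
  map_add' w w' := by simp
  map_smul' c w := by simp

theorem nablaMetric_add_left (cov : AffineConnection I M) (x : M) (z z' v : TangentSpace I x) :
    nablaMetric cov x (z + z') v = nablaMetric cov x z v + nablaMetric cov x z' v := by
  ext w
  exact congrArg (fun T ↦ T w v) ((cov.derivMetricTensor x).map_add z z')

theorem nablaMetric_smul_left (cov : AffineConnection I M) (x : M) (c : ℝ)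
    (z v : TangentSpace I x) : nablaMetric cov x (c • z) v = c • nablaMetric cov x z v := by
  ext w
  exact congrArg (fun T ↦ T w v) ((cov.derivMetricTensor x).map_smul c z)

theorem nablaMetric_add_right (cov : AffineConnection I M) (x : M) (z v v' : TangentSpace I x) :
    nablaMetric cov x z (v + v') = nablaMetric cov x z v + nablaMetric cov x z v' := by
  ext w
  exact (cov.derivMetricTensor x z w).map_add v v'

theorem nablaMetric_smul_right (cov : AffineConnection I M) (x : M) (c : ℝ)
    (z v : TangentSpace I x) : nablaMetric cov x z (c • v) = c • nablaMetric cov x z v := by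
  ext w
  exact (cov.derivMetricTensor x z w).map_smul c v

/-- The bilinear map `(z, v) ↦ a`, where `a` is the vector with `g(w, a) = (∇_v g)(w, z)` for
all `w`. -/
def dualTerm (cov : AffineConnection I M) (x : M) :
    TangentSpace I x →L[ℝ] TangentSpace I x →L[ℝ] TangentSpace I x :=
  have : FiniteDimensional ℝ (TangentSpace I x) := inferInstanceAs (FiniteDimensional ℝ E)
  have : CompleteSpace (TangentSpace I x) := FiniteDimensional.complete ℝ _
  have h : IsBilinearMap ℝ (fun z v : TangentSpace I x ↦
      (InnerProductSpace.toDual ℝ (TangentSpace I x)).symm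
        (LinearMap.toContinuousLinearMap (nablaMetric cov x z v))) :=
    { add_left := fun z z' v ↦ by rw [nablaMetric_add_left, map_add, map_add]
      smul_left := fun c z v ↦ by
        rw [nablaMetric_smul_left, map_smul, LinearIsometryEquiv.map_smulₛₗ, conj_trivial]
      add_right := fun z v v' ↦ by rw [nablaMetric_add_right, map_add, map_add]
      smul_right := fun c z v ↦ by
        rw [nablaMetric_smul_right, map_smul, LinearIsometryEquiv.map_smulₛₗ, conj_trivial] }
  h.toContinuousBilinearMap

theorem inner_dualTerm (cov : AffineConnection I M) (x : M) (z v w : TangentSpace I x) :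
    inner ℝ (dualTerm cov x z v) w = cov.derivMetricTensor x z w v := by
  have : FiniteDimensional ℝ (TangentSpace I x) := inferInstanceAs (FiniteDimensional ℝ E)
  have : CompleteSpace (TangentSpace I x) := FiniteDimensional.complete ℝ _
  exact InnerProductSpace.toDual_symm_apply (𝕜 := ℝ) (E := TangentSpace I x) (x := w)
    (y := LinearMap.toContinuousLinearMap (nablaMetric cov x z v))

/-- The dual connection of `∇` relative to the metric `g`. See `dual_spec` for the formula that
characterizes it. -/
def dual (cov : AffineConnection I M) : AffineConnection I M :=
  cov.addOneForm (dualTerm cov)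

/-- `X g(Y, Z) = g(∇_X Y, Z) + g(Y, ∇̄_X Z)` for the dual connection `∇̄` of `∇`. -/
theorem dual_spec (cov : AffineConnection I M) {x : M} (v : TangentSpace I x)
    {Y Z : Π x : M, TangentSpace I x} (hY : MDiffAt (T% Y) x) (hZ : MDiffAt (T% Z) x) :
    mvfderiv I (fun y ↦ inner ℝ (Y y) (Z y)) x v =
      inner ℝ (cov Y x v) (Z x) + inner ℝ (Y x) (dual cov Z x v) := by
  have h1 := inner_dualTerm cov x (Z x) v (Y x)
  have h2 := CovariantDerivative.derivMetricTensor_apply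
    (V := fun x : M ↦ TangentSpace I x) cov x hZ hY (X := FiberBundle.extend E v)
  simp only [FiberBundle.extend_apply_self] at h2
  have h3 : dual cov Z x v = cov Z x v + dualTerm cov x (Z x) v := rfl
  rw [h3, inner_add_right, real_inner_comm (dualTerm cov x (Z x) v), h1, h2,
    real_inner_comm (cov Y x v), real_inner_comm (cov Z x v)]
  simp only [real_inner_comm]
  ring

/-- `(g, ∇)` is conjugate symmetric: `∇` and its dual connection have the same curvature tensor. -/
def ConjugateSymmetric (cov : AffineConnection I M) : Prop :=
  ∀ (x : M) (u v w : TangentSpace I x), curvature cov x u v w = curvature (dual cov) x u v w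

end Statistical

end StatGeom

/-!
A torsion-free projectively flat connection with symmetric Ricci tensor satisfies the structure
equations of a hypersurface of `E × ℝ` that is transversal to its position vector, with second
fundamental form `(n - 1)⁻¹ Ric`. These equations are a flat linear total differential equation for
the moving frame, so they can be solved on a cell; on a union of two cells with connected
intersection the two solutions are matched by a linear map. Hence there is a global map
`f : M → E × ℝ` of this kind, and the geodesics of the connection are the curves `γ` for which
`(f ∘ γ)''` is a multiple of `f ∘ γ`, that is, planar motions under a central force, up to the
choice of the affine parameter. By Kepler's second law the affine parameter is the one of constant
areal velocity. In each plane through the origin, motion with areal velocity one is part of the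
flow of a smooth vector field on `M`, and on a compact manifold such a flow is complete.

If the structure is conjugate symmetric, the curvature endomorphisms `R(X, Y)` are skew for `g`.
Their traces vanish, so the Ricci tensor is symmetric by the Bianchi identity; moreover
`R(X, Y)Z = h(Y, Z)X - h(X, Z)Y` being skew makes `h` a multiple of `g`, so that the Codazzi
equation for `h` holds for the dual connection too.
-/

noncomputable section

namespace StatGeom

/-! ### Linear total differential equations -/

section TotalDifferential

open Set Metric

section LinearODE

theorem exists_hasDerivWithinAt_Icc_append {G : Type*} [NormedAddCommGroup G] [NormedSpace ℝ G]
    {v : ℝ → G → G} {y z : ℝ → G} {a b c : ℝ} (hab : a ≤ b) (hbc : b ≤ c) (hyz : z b = y b)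
    (hy : ∀ t ∈ Icc a b, HasDerivWithinAt y (v t (y t)) (Icc a b) t)
    (hz : ∀ t ∈ Icc b c, HasDerivWithinAt z (v t (z t)) (Icc b c) t) :
    ∃ w : ℝ → G, w a = y a ∧ ∀ t ∈ Icc a c, HasDerivWithinAt w (v t (w t)) (Icc a c) t := by
  let w : ℝ → G := fun t ↦ if t ≤ b then y t else z t
  have wl : EqOn w y (Icc a b) := fun t ht ↦ if_pos ht.2
  have wr : EqOn w z (Icc b c) := fun t ht ↦ by
    rcases ht.1.eq_or_lt with rfl | h
    · simp [w, hyz]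
    · exact if_neg h.not_ge
  have left {t : ℝ} (ht : t ∈ Icc a b) : HasDerivWithinAt w (v t (w t)) (Icc a b) t := by
    rw [wl ht]; exact (hy t ht).congr wl (wl ht)
  have right {t : ℝ} (ht : t ∈ Icc b c) : HasDerivWithinAt w (v t (w t)) (Icc b c) t := by
    rw [wr ht]; exact (hz t ht).congr wr (wr ht)
  refine ⟨w, wl ⟨le_rfl, hab⟩, fun t ht ↦ ?_⟩
  rw [← Icc_union_Icc_eq_Icc hab hbc]
  rcases lt_trichotomy t b with h | rfl | h
  · refine (left ⟨ht.1, h.le⟩).union (HasFDerivWithinAt.of_notMem_closure ?_)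
    rw [closure_Icc]; exact fun h' ↦ h.not_ge h'.1
  · exact (left ⟨ht.1, le_rfl⟩).union (right ⟨le_rfl, ht.2⟩)
  · refine HasDerivWithinAt.union (HasFDerivWithinAt.of_notMem_closure ?_) (right ⟨h.le, ht.2⟩)
    rw [closure_Icc]; exact fun h' ↦ h.not_ge h'.2

variable {A : Type*} [NormedRing A] [NormedAlgebra ℝ A] {b : ℝ → A}

theorem exists_hasDerivWithinAt_mul_of_norm_le [CompleteSpace A] {s τ K : ℝ}
    (hb : ContinuousOn b (Icc s (s + τ))) (hτ : 0 ≤ τ) (hK : 0 ≤ K) (hKτ : K * τ ≤ 1 / 2)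
    (hbK : ∀ t ∈ Icc s (s + τ), ‖b t‖ ≤ K) (y₀ : A) :
    ∃ y : ℝ → A, y s = y₀ ∧
      ∀ t ∈ Icc s (s + τ), HasDerivWithinAt y (y t * b t) (Icc s (s + τ)) t := by
  have hs : s ∈ Icc s (s + τ) := ⟨le_rfl, by linarith⟩
  have picardLindelof : IsPicardLindelof (fun t y ↦ y * b t) (⟨s, hs⟩ : Icc s (s + τ)) y₀
      (‖y₀‖₊ + 1) 0 ((2 * ‖y₀‖₊ + 1) * ⟨K, hK⟩) ⟨K, hK⟩ := by
    refine ⟨fun t ht ↦ ?_, fun x _ ↦ continuousOn_const.mul hb, fun t ht x hx ↦ ?_, ?_⟩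
    · refine LipschitzOnWith.of_dist_le_mul fun x _ y _ ↦ ?_
      rw [dist_eq_norm, dist_eq_norm, ← sub_mul, mul_comm]
      exact (norm_mul_le _ _).trans (mul_le_mul_of_nonneg_left (hbK t ht) (norm_nonneg _))
    · have hx' : ‖x‖ ≤ 2 * ‖y₀‖ + 1 := by
        have hxy₀ : ‖x - y₀‖ ≤ ‖y₀‖ + 1 := by simpa [dist_eq_norm] using hx
        linarith [norm_le_norm_add_norm_sub y₀ x, norm_sub_rev y₀ x]
      exact (norm_mul_le _ _).trans
        (mul_le_mul hx' (hbK t ht) (norm_nonneg _) ((norm_nonneg x).trans hx'))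
    · have hmax : max (s + τ - s) (s - s) = τ := by simp [hτ]
      simp only [hmax]
      change (2 * ‖y₀‖ + 1) * K * τ ≤ ‖y₀‖ + 1 - 0
      nlinarith [norm_nonneg y₀]
  exact picardLindelof.exists_eq_forall_mem_Icc_hasDerivWithinAt₀

theorem exists_hasDerivWithinAt_mul [CompleteSpace A] (hb : ContinuousOn b (Icc 0 1)) (y₀ : A) :
    ∃ y : ℝ → A, y 0 = y₀ ∧
      ∀ t ∈ Icc (0 : ℝ) 1, HasDerivWithinAt y (y t * b t) (Icc 0 1) t := by
  obtain ⟨K, hK⟩ := isCompact_Icc.exists_bound_of_continuousOn hb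
  have hK0 : 0 ≤ K := (norm_nonneg _).trans (hK 0 (by simp))
  obtain ⟨N, hN⟩ := exists_nat_gt (2 * K)
  have hN0 : (0 : ℝ) < N := by linarith
  have extend : ∀ k : ℕ, k ≤ N → ∃ y : ℝ → A, y 0 = y₀ ∧ ∀ t ∈ Icc (0 : ℝ) (k * (1 / N)),
      HasDerivWithinAt y (y t * b t) (Icc 0 (k * (1 / N))) t := by
    intro k
    induction k with
    | zero =>
      intro _
      refine ⟨fun _ ↦ y₀, rfl, fun t _ ↦ ?_⟩
      simp only [Nat.cast_zero, zero_mul, Icc_self]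
      exact hasDerivWithinAt_iff_hasFDerivWithinAt.2
        (HasFDerivWithinAt.of_subsingleton subsingleton_singleton)
    | succ k ih =>
      intro hk
      obtain ⟨y, hy0, hy⟩ := ih (by lia)
      have hsucc : ((k + 1 : ℕ) : ℝ) * (1 / N) = k * (1 / N) + 1 / N := by push_cast; ring
      have hle : (k : ℝ) * (1 / N) + 1 / N ≤ 1 := by
        rw [← hsucc, mul_one_div, div_le_one hN0]; exact_mod_cast hk
      have hsub : Icc ((k : ℝ) * (1 / N)) (k * (1 / N) + 1 / N) ⊆ Icc 0 1 :=
        Icc_subset_Icc (by positivity) hle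
      obtain ⟨z, hz0, hz⟩ := exists_hasDerivWithinAt_mul_of_norm_le (hb.mono hsub) (by positivity)
        hK0 (by rw [mul_one_div, div_le_iff₀ hN0]; linarith) (fun t ht ↦ hK t (hsub ht))
        (y (k * (1 / N)))
      rw [hsucc, ← hy0]
      exact exists_hasDerivWithinAt_Icc_append (v := fun t y ↦ y * b t) (by positivity)
        (by simp) hz0 hy hz
  have := extend N le_rfl
  rwa [mul_one_div_cancel hN0.ne'] at this

end LinearODE

section Taylor

variable {E G : Type*} [NormedAddCommGroup E] [NormedSpace ℝ E] [NormedAddCommGroup G]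
  [NormedSpace ℝ G] {B : E → G} {s : Set E} {C : ℝ}

/-- A common bound `C` on `s` for the value and the first two derivatives of `B`. -/
structure IsTwoJetBoundOn (B : E → G) (s : Set E) (C : ℝ) : Prop where
  norm_le {z : E} : z ∈ s → ‖B z‖ ≤ C
  norm_fderiv_le {z : E} : z ∈ s → ‖fderiv ℝ B z‖ ≤ C
  norm_fderiv_fderiv_le {z : E} : z ∈ s → ‖fderiv ℝ (fderiv ℝ B) z‖ ≤ C

theorem exists_isTwoJetBoundOn_of_isCompact (hs : IsCompact s) (hB : ContDiff ℝ 2 B) :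
    ∃ C : ℝ, 0 < C ∧ IsTwoJetBoundOn B s C := by
  have hB' : ContDiff ℝ 1 (fderiv ℝ B) := hB.fderiv_right (by norm_num)
  obtain ⟨C₀, h₀⟩ := hs.exists_bound_of_continuousOn hB.continuous.continuousOn
  obtain ⟨C₁, h₁⟩ := hs.exists_bound_of_continuousOn hB'.continuous.continuousOn
  obtain ⟨C₂, h₂⟩ := hs.exists_bound_of_continuousOn
    (hB'.continuous_fderiv (by norm_num)).continuousOn
  exact ⟨max 1 (max C₀ (max C₁ C₂)), by positivity,
    fun hz ↦ (h₀ _ hz).trans (by simp), fun hz ↦ (h₁ _ hz).trans (by simp),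
    fun hz ↦ (h₂ _ hz).trans (by simp)⟩

namespace IsTwoJetBoundOn

theorem norm_sub_le (hC : IsTwoJetBoundOn B s C) (hB : ContDiff ℝ 2 B) (hs : Convex ℝ s)
    {z a : E} (hz : z ∈ s) (hza : z + a ∈ s) : ‖B (z + a) - B z‖ ≤ C * ‖a‖ := by
  simpa using hs.norm_image_sub_le_of_norm_fderiv_le
    (fun v _ ↦ hB.differentiable two_ne_zero v) (fun _ ↦ hC.norm_fderiv_le) hz hza

theorem norm_sub_sub_fderiv_le (hC : IsTwoJetBoundOn B s C) (hB : ContDiff ℝ 2 B)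
    (hs : Convex ℝ s) {z a : E} (hz : z ∈ s) (hza : z + a ∈ s) :
    ‖B (z + a) - B z - fderiv ℝ B z a‖ ≤ C * ‖a‖ * ‖a‖ := by
  have hB' : ContDiff ℝ 1 (fderiv ℝ B) := hB.fderiv_right (by norm_num)
  have hC0 : 0 ≤ C := (norm_nonneg _).trans (hC.norm_le hz)
  have hfderiv : ∀ w ∈ s ∩ closedBall z ‖a‖, ‖fderiv ℝ B w - fderiv ℝ B z‖ ≤ C * ‖a‖ := by
    intro w hw
    refine (hs.norm_image_sub_le_of_norm_fderiv_le (fun v _ ↦ hB'.differentiable one_ne_zero v)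
      (fun _ ↦ hC.norm_fderiv_fderiv_le) hz hw.1).trans ?_
    gcongr
    simpa [dist_eq_norm] using hw.2
  simpa using (hs.inter (convex_closedBall z ‖a‖)).norm_image_sub_le_of_norm_fderiv_le'
    (fun w _ ↦ hB.differentiable two_ne_zero w) hfderiv ⟨hz, by simp⟩ ⟨hza, by simp⟩

end IsTwoJetBoundOn

end Taylor

variable {E : Type*} [NormedAddCommGroup E] [NormedSpace ℝ E]
  {A : Type*} [NormedRing A] [NormedAlgebra ℝ A] {B : E → E →L[ℝ] A}

/-- `L` has the (left) Darboux derivative `B'` at `x`: its derivative there is `a ↦ L x * B' a`. For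
invertible `L x` this says that `L⁻¹ dL` takes the value `B'`. -/
def HasDarbouxDerivAt (L : E → A) (B' : E →L[ℝ] A) (x : E) : Prop :=
  HasFDerivAt L ((ContinuousLinearMap.mul ℝ A (L x)).comp B') x

/-- The Maurer–Cartan equation `dB + B ∧ B = 0`, the integrability condition of `dL = L B`. -/
def IsMaurerCartan (B : E → E →L[ℝ] A) : Prop :=
  ∀ x a b, fderiv ℝ B x a b + B x a * B x b = fderiv ℝ B x b a + B x b * B x a

section FirstOrder

variable {C R : ℝ} {x a : E} {t : ℝ}

theorem norm_smul_le_norm_of_mem_Icc {G : Type*} [SeminormedAddCommGroup G] [NormedSpace ℝ G]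
    (ht : t ∈ Icc (0 : ℝ) 1) (u : G) : ‖t • u‖ ≤ ‖u‖ := by
  rw [norm_smul, Real.norm_of_nonneg ht.1]
  exact mul_le_of_le_one_left (norm_nonneg u) ht.2

theorem IsMaurerCartan.defect_eq (hB : IsMaurerCartan B) (x a : E) (t : ℝ) :
    B (t • x) x * (1 + t • B (t • x) a) + (B (t • x) a + t • fderiv ℝ B (t • x) x a)
        - (1 + t • B (t • x) a) * B (t • (x + a)) (x + a)
      = -(t • fderiv ℝ B (t • x) a a)
        - (B (t • (x + a)) - B (t • x) - fderiv ℝ B (t • x) (t • a)) (x + a)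
        - t • (B (t • x) a * B (t • x) a)
        - t • (B (t • x) a * (B (t • (x + a)) - B (t • x)) (x + a)) := by
  rw [eq_sub_of_add_eq (hB (t • x) x a)]
  generalize B (t • (x + a)) = B₁
  generalize fderiv ℝ B (t • x) = B'
  simp only [sub_apply, map_add, map_smul, smul_apply, mul_add, mul_sub, add_mul,
    smul_add, smul_sub, mul_smul_comm, smul_mul_assoc, mul_one, one_mul]
  abel

/-- Along the ray `t ↦ t • x`, the product of the solution `y` of `y' = y B` with `1 + t • B a` is
a candidate for the solution along the ray through `x + a`; this bounds by how much it fails. -/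
theorem IsMaurerCartan.norm_defect_le (hflat : IsMaurerCartan B) (hB : ContDiff ℝ 2 B)
    (hC : IsTwoJetBoundOn B (closedBall 0 R) C) (hx : ‖x‖ ≤ R) (hxa : ‖x + a‖ ≤ R)
    (ht : t ∈ Icc (0 : ℝ) 1) :
    ‖B (t • x) x * (1 + t • B (t • x) a) + (B (t • x) a + t • fderiv ℝ B (t • x) x a)
        - (1 + t • B (t • x) a) * B (t • (x + a)) (x + a)‖
      ≤ (C + C * R + C * C + C * (C * R)) * ‖a‖ ^ 2 := by
  have hball {z : E} (hz : ‖z‖ ≤ R) : t • z ∈ closedBall (0 : E) R :=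
    mem_closedBall_zero_iff.2 ((norm_smul_le_norm_of_mem_Icc ht z).trans hz)
  have hC0 : 0 ≤ C := (norm_nonneg _).trans (hC.norm_le (hball hx))
  have hsmul : t • (x + a) = t • x + t • a := smul_add t x a
  have norm_ta : ‖t • a‖ ≤ ‖a‖ := norm_smul_le_norm_of_mem_Icc ht a
  have bound_B : ‖B (t • x) a‖ ≤ C * ‖a‖ :=
    (B (t • x)).le_of_opNorm_le (hC.norm_le (hball hx)) a
  have bound_B' : ‖fderiv ℝ B (t • x) a a‖ ≤ C * ‖a‖ * ‖a‖ :=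
    ((fderiv ℝ B (t • x)).le_opNorm₂ a a).trans
      (by gcongr; exact hC.norm_fderiv_le (hball hx))
  have bound_ΔB : ‖B (t • (x + a)) - B (t • x)‖ ≤ C * ‖a‖ := by
    have hxa' := hball hxa
    rw [hsmul] at hxa' ⊢
    exact (hC.norm_sub_le hB (convex_closedBall 0 R) (hball hx) hxa').trans (by gcongr)
  have bound_taylor : ‖B (t • (x + a)) - B (t • x) - fderiv ℝ B (t • x) (t • a)‖
      ≤ C * ‖a‖ * ‖a‖ := by
    have hxa' := hball hxa
    rw [hsmul] at hxa' ⊢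
    exact (hC.norm_sub_sub_fderiv_le hB (convex_closedBall 0 R) (hball hx) hxa').trans (by gcongr)
  rw [hflat.defect_eq]
  calc
    _ ≤ ‖fderiv ℝ B (t • x) a a‖
        + ‖B (t • (x + a)) - B (t • x) - fderiv ℝ B (t • x) (t • a)‖ * ‖x + a‖
        + ‖B (t • x) a‖ * ‖B (t • x) a‖
        + ‖B (t • x) a‖ * (‖B (t • (x + a)) - B (t • x)‖ * ‖x + a‖) := by
      refine norm_sub_le_of_le (norm_sub_le_of_le (norm_sub_le_of_le ?_ ?_) ?_) ?_
      · rw [norm_neg]; exact norm_smul_le_norm_of_mem_Icc ht _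
      · exact ContinuousLinearMap.le_opNorm _ _
      · exact (norm_smul_le_norm_of_mem_Icc ht _).trans (norm_mul_le _ _)
      · exact (norm_smul_le_norm_of_mem_Icc ht _).trans ((norm_mul_le _ _).trans
          (by gcongr; exact ContinuousLinearMap.le_opNorm _ _))
    _ ≤ C * ‖a‖ * ‖a‖ + C * ‖a‖ * ‖a‖ * R + C * ‖a‖ * (C * ‖a‖) + C * ‖a‖ * (C * ‖a‖ * R) := by
      gcongr
    _ = _ := by ring

theorem hasDerivWithinAt_mul_one_add_smul (hB : Differentiable ℝ B) {y : ℝ → A} {s : Set ℝ}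
    (hy : HasDerivWithinAt y (y t * B (t • x) x) s t) :
    HasDerivWithinAt (fun t ↦ y t * (1 + t • B (t • x) a))
      (y t * (B (t • x) x * (1 + t • B (t • x) a)
        + (B (t • x) a + t • fderiv ℝ B (t • x) x a))) s t := by
  have hray : HasDerivAt (fun t : ℝ ↦ t • x) x t := by
    simpa using (hasDerivAt_id t).smul_const x
  have hBa : HasDerivWithinAt (fun t : ℝ ↦ B (t • x) a) (fderiv ℝ B (t • x) x a) s t := by
    have hBray := (hB (t • x)).hasFDerivAt.comp_hasDerivAt t hray
    simpa using (hBray.clm_apply (hasDerivAt_const t a)).hasDerivWithinAt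
  refine (hy.fun_mul (((hasDerivWithinAt_id t s).fun_smul hBa).const_add 1)).congr_deriv ?_
  simp only [id_eq, one_smul, mul_add, mul_assoc, add_comm]

theorem norm_sub_le_of_norm_hasDerivWithinAt_sub_mul_le {y z z' b : ℝ → A} {K ε : ℝ} (hK : 0 < K)
    (hbK : ∀ t ∈ Icc (0 : ℝ) 1, ‖b t‖ ≤ K) (h₀ : y 0 = z 0)
    (hy : ∀ t ∈ Icc (0 : ℝ) 1, HasDerivWithinAt y (y t * b t) (Icc 0 1) t)
    (hz : ∀ t ∈ Icc (0 : ℝ) 1, HasDerivWithinAt z (z' t) (Icc 0 1) t)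
    (hε : ∀ t ∈ Icc (0 : ℝ) 1, ‖z' t - z t * b t‖ ≤ ε) :
    ‖y 1 - z 1‖ ≤ ε / K * (Real.exp K - 1) := by
  have right {f : ℝ → A} {f' : A} {t : ℝ} (ht : t ∈ Ico (0 : ℝ) 1)
      (h : HasDerivWithinAt f f' (Icc 0 1) t) : HasDerivWithinAt f f' (Ici t) t :=
    h.mono_of_mem_nhdsWithin (Icc_mem_nhdsGE_of_mem ht)
  have lipschitz : ∀ t ∈ Ico (0 : ℝ) 1, LipschitzOnWith ⟨K, hK.le⟩ (· * b t) univ := by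
    refine fun t ht ↦ LipschitzOnWith.of_dist_le_mul fun u _ w _ ↦ ?_
    rw [dist_eq_norm, dist_eq_norm, ← sub_mul, mul_comm]
    exact (norm_mul_le _ _).trans
      (mul_le_mul_of_nonneg_left (hbK t (Ico_subset_Icc_self ht)) (norm_nonneg _))
  have gronwall := dist_le_of_approx_trajectories_ODE_of_mem (εf := 0) (εg := ε) (δ := 0) lipschitz
    (fun t ht ↦ (hy t ht).continuousWithinAt) (fun t ht ↦ right ht (hy t (Ico_subset_Icc_self ht)))
    (fun t _ ↦ by simp) (fun _ _ ↦ mem_univ _) (fun t ht ↦ (hz t ht).continuousWithinAt)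
    (fun t ht ↦ right ht (hz t (Ico_subset_Icc_self ht)))
    (fun t ht ↦ by rw [dist_eq_norm]; exact hε t (Ico_subset_Icc_self ht))
    (fun _ _ ↦ mem_univ _) (by simp [h₀]) 1 (by simp)
  rw [dist_eq_norm, gronwallBound_of_K_ne_0 (by exact hK.ne')] at gronwall
  simp only [zero_add, zero_mul, sub_zero, mul_one] at gronwall
  exact gronwall

theorem IsMaurerCartan.exists_norm_sub_sub_mul_le [ProperSpace E] (hflat : IsMaurerCartan B)
    (hB : ContDiff ℝ 2 B) {y : E → ℝ → A} (hy0 : ∀ x, y x 0 = 1)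
    (hy : ∀ x, ∀ t ∈ Icc (0 : ℝ) 1, HasDerivWithinAt (y x) (y x t * B (t • x) x) (Icc 0 1) t)
    (x : E) : ∃ D : ℝ, ∀ a : E, ‖a‖ ≤ 1 →
      ‖y (x + a) 1 - y x 1 - y x 1 * B x a‖ ≤ D * ‖a‖ ^ 2 := by
  set R : ℝ := ‖x‖ + 1
  obtain ⟨C, hC0, hC⟩ := exists_isTwoJetBoundOn_of_isCompact (isCompact_closedBall (0 : E) R) hB
  obtain ⟨Cy, hCy⟩ := (isCompact_Icc (a := (0 : ℝ)) (b := 1)).exists_bound_of_continuousOn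
    (f := y x) fun t ht ↦ (hy x t ht).continuousWithinAt
  refine ⟨Cy * (C + C * R + C * C + C * (C * R)) / (C * R) * (Real.exp (C * R) - 1),
    fun a ha ↦ ?_⟩
  have hx : ‖x‖ ≤ R := by simp [R]
  have hxa : ‖x + a‖ ≤ R := (norm_add_le _ _).trans (add_le_add_right ha _)
  have norm_B_le : ∀ t ∈ Icc (0 : ℝ) 1, ‖B (t • (x + a)) (x + a)‖ ≤ C * R := by
    intro t ht
    have hmem : t • (x + a) ∈ closedBall (0 : E) R :=
      mem_closedBall_zero_iff.2 ((norm_smul_le_norm_of_mem_Icc ht _).trans hxa)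
    exact ((B _).le_of_opNorm_le (hC.norm_le hmem) _).trans (by gcongr)
  have gronwall := norm_sub_le_of_norm_hasDerivWithinAt_sub_mul_le (y := y (x + a)) (by positivity)
    norm_B_le (by simp [hy0]) (hy (x + a)) (fun t ht ↦ hasDerivWithinAt_mul_one_add_smul
      (x := x) (a := a) (hB.differentiable two_ne_zero) (hy x t ht))
    (ε := Cy * ((C + C * R + C * C + C * (C * R)) * ‖a‖ ^ 2)) fun t ht ↦ by
      rw [mul_assoc, ← mul_sub]
      exact (norm_mul_le _ _).trans (mul_le_mul (hCy t ht)
        (hflat.norm_defect_le hB hC hx hxa ht) (norm_nonneg _)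
        ((norm_nonneg _).trans (hCy t ht)))
  simp only [one_smul, mul_add, mul_one, ← sub_sub] at gronwall
  exact gronwall.trans_eq (by ring)

end FirstOrder

namespace HasDarbouxDerivAt

variable {L : E → A} {B' : E →L[ℝ] A} {x : E}

theorem hasFDerivAt (h : HasDarbouxDerivAt L B' x) :
    HasFDerivAt L ((ContinuousLinearMap.mul ℝ A (L x)).comp B') x := h

theorem const_mul (h : HasDarbouxDerivAt L B' x) (c : A) :
    HasDarbouxDerivAt (fun z ↦ c * L z) B' x := by
  refine ((ContinuousLinearMap.mul ℝ A c).hasFDerivAt.comp x h.hasFDerivAt).congr_fderiv ?_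
  ext a
  simp [mul_assoc]

theorem contDiff {B : E → E →L[ℝ] A} (h : ∀ x, HasDarbouxDerivAt L (B x) x)
    (hB : ContDiff ℝ ∞ B) : ContDiff ℝ ∞ L := by
  refine contDiff_infty.2 fun n ↦ ?_
  induction n with
  | zero => exact contDiff_zero.2 (continuous_iff_continuousAt.2 fun x ↦ (h x).continuousAt)
  | succ n ih =>
    rw [Nat.cast_add, Nat.cast_one, contDiff_succ_iff_fderiv,
      show fderiv ℝ L = _ from funext fun x ↦ (h x).hasFDerivAt.fderiv]
    exact ⟨fun x ↦ (h x).differentiableAt, by simp,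
      ((ContinuousLinearMap.mul ℝ A).contDiff.comp ih).clm_comp
        (hB.of_le (by exact_mod_cast le_top))⟩

end HasDarbouxDerivAt

theorem IsMaurerCartan.exists_hasDarbouxDerivAt [CompleteSpace A] [ProperSpace E]
    (hflat : IsMaurerCartan B) (hB : ContDiff ℝ 2 B) (x₀ : E) :
    ∃ L : E → A, L x₀ = 1 ∧ ∀ x, HasDarbouxDerivAt L (B x) x := by
  wlog hx₀ : x₀ = 0 generalizing B x₀
  · obtain ⟨L, hL0, hL⟩ := this (B := fun z ↦ B (x₀ + z))
      (fun x a b ↦ by simpa only [fderiv_comp_add_left] using hflat (x₀ + x) a b)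
      (hB.comp (contDiff_const.add contDiff_id)) 0 rfl
    refine ⟨fun x ↦ L (x - x₀), by simpa using hL0, fun x ↦ ?_⟩
    have := (hL (x - x₀)).hasFDerivAt.comp x ((hasFDerivAt_id x).sub_const x₀)
    rwa [add_sub_cancel] at this
  subst hx₀
  have hray (x : E) : Continuous fun t : ℝ ↦ B (t • x) x :=
    (hB.continuous.comp (continuous_id.smul continuous_const)).clm_apply continuous_const
  choose y hy0 hy using fun x ↦ exists_hasDerivWithinAt_mul (hray x).continuousOn 1
  refine ⟨fun x ↦ y x 1, ?_, fun x ↦ ?_⟩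
  · have hconst := constant_of_has_deriv_right_zero (f := y 0) (a := 0) (b := 1)
      (fun t ht ↦ (hy 0 t ht).continuousWithinAt) (fun t ht ↦ by
        simpa using (hy 0 t (Ico_subset_Icc_self ht)).mono_of_mem_nhdsWithin
          (Icc_mem_nhdsGE_of_mem ht)) 1 (by simp)
    simpa [hy0] using hconst
  · obtain ⟨D, hD⟩ := hflat.exists_norm_sub_sub_mul_le hB hy0 hy x
    refine hasFDerivAt_iff_isLittleO_nhds_zero.2 (Asymptotics.IsBigO.trans_isLittleO
      (g := fun a : E ↦ ‖a‖ ^ 2) (Asymptotics.IsBigO.of_bound D ?_)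
      (Asymptotics.isLittleO_norm_pow_id one_lt_two))
    filter_upwards [closedBall_mem_nhds (0 : E) one_pos] with a ha
    simpa using hD a (by simpa using ha)

section Uniqueness

variable {G : Type*} [NormedAddCommGroup G] [NormedSpace ℝ G] {N : E → G} {N' : E → E →L[ℝ] G}
  {s : Set E} {x : E}

theorem eqOn_zero_of_norm_fderiv_le_mul (hs : Convex ℝ s) {K : ℝ}
    (hN : ∀ x ∈ s, HasFDerivAt N (N' x) x) (hle : ∀ x ∈ s, ‖N' x‖ ≤ K * ‖N x‖)
    (hx : x ∈ s) (hNx : N x = 0) : EqOn N 0 s := by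
  intro z hz
  have hseg {t : ℝ} (ht : t ∈ Icc (0 : ℝ) 1) : x + t • (z - x) ∈ s :=
    hs.add_smul_sub_mem hx hz ht
  have hderiv {t : ℝ} (ht : t ∈ Icc (0 : ℝ) 1) : HasDerivAt (fun t : ℝ ↦ N (x + t • (z - x)))
      (N' (x + t • (z - x)) (z - x)) t := by
    have hline : HasDerivAt (fun t : ℝ ↦ x + t • (z - x)) (z - x) t := by
      simpa using ((hasDerivAt_id t).smul_const (z - x)).const_add x
    exact (hN _ (hseg ht)).comp_hasDerivAt t hline
  simpa using eq_zero_of_abs_deriv_le_mul_abs_self_of_eq_zero_right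
    (f := fun t : ℝ ↦ N (x + t • (z - x))) (K := K * ‖z - x‖) (a := 0) (b := 1)
    (fun t ht ↦ (hderiv ht).continuousAt.continuousWithinAt)
    (fun t ht ↦ (hderiv (Ico_subset_Icc_self ht)).hasDerivWithinAt) (by simpa using hNx)
    (fun t ht ↦ by
      rw [mul_right_comm]
      exact (N' _).le_of_opNorm_le (hle _ (hseg (Ico_subset_Icc_self ht))) _) 1 (by simp)

theorem eqOn_zero_of_norm_fderiv_le_continuousOn_mul {k : E → ℝ} (hs : IsOpen s)
    (hs' : IsPreconnected s) (hN : ∀ x ∈ s, HasFDerivAt N (N' x) x) (hk : ContinuousOn k s)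
    (hle : ∀ x ∈ s, ‖N' x‖ ≤ k x * ‖N x‖) (hx : x ∈ s) (hNx : N x = 0) : EqOn N 0 s := by
  have hloc : ∀ x ∈ s, N x = 0 → ∀ᶠ z in 𝓝 x, N z = 0 := by
    intro x hx hNx
    have hnear : ∀ᶠ z in 𝓝 x, k z < k x + 1 ∧ z ∈ s :=
      ((hk.continuousAt (hs.mem_nhds hx)).eventually (gt_mem_nhds (lt_add_one _))).and
        (hs.mem_nhds hx)
    obtain ⟨r, hr, hball⟩ := eventually_nhds_iff_ball.1 hnear
    filter_upwards [ball_mem_nhds x hr] with z hz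
    refine eqOn_zero_of_norm_fderiv_le_mul (K := k x + 1) (convex_ball x r)
      (fun z hz ↦ hN z (hball z hz).2)
      (fun z hz ↦ (hle z (hball z hz).2).trans ?_) (mem_ball_self hr) hNx hz
    exact mul_le_mul_of_nonneg_right (hball z hz).1.le (norm_nonneg _)
  have hsub : s ⊆ {x | ∀ᶠ z in 𝓝 x, N z = 0} := by
    refine hs'.subset_of_closure_inter_subset isOpen_setOfPred_eventually_nhds
      ⟨x, hx, hloc x hx hNx⟩ fun z ⟨hz, hzs⟩ ↦ hloc z hzs ?_
    by_contra hne
    obtain ⟨w, hw, hw'⟩ := mem_closure_iff_nhds.1 hz _ ((hN z hzs).continuousAt.eventually_ne hne)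
    exact hw hw'.self_of_nhds
  exact fun z hz ↦ (hsub hz).self_of_nhds

theorem HasDarbouxDerivAt.eqOn (hs : IsOpen s) (hs' : IsPreconnected s) (hB : ContinuousOn B s)
    {L₁ L₂ : E → A} (h₁ : ∀ x ∈ s, HasDarbouxDerivAt L₁ (B x) x)
    (h₂ : ∀ x ∈ s, HasDarbouxDerivAt L₂ (B x) x) (hx : x ∈ s) (heq : L₁ x = L₂ x) :
    EqOn L₁ L₂ s := by
  have hsub : ∀ x ∈ s, HasDarbouxDerivAt (fun x ↦ L₁ x - L₂ x) (B x) x := fun x hx ↦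
    ((h₁ x hx).hasFDerivAt.fun_sub (h₂ x hx)).congr_fderiv (by ext a; simp)
  have hle (x : E) : ‖(ContinuousLinearMap.mul ℝ A (L₁ x - L₂ x)).comp (B x)‖
      ≤ ‖B x‖ * ‖L₁ x - L₂ x‖ := by
    refine (ContinuousLinearMap.opNorm_comp_le _ _).trans ?_
    rw [mul_comm]
    gcongr
    exact ContinuousLinearMap.opNorm_mul_apply_le ℝ A _
  exact fun z hz ↦ sub_eq_zero.1 (eqOn_zero_of_norm_fderiv_le_continuousOn_mul hs hs' hsub hB.norm
    (fun x _ ↦ hle x) hx (sub_eq_zero.2 heq) hz)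

end Uniqueness

theorem IsMaurerCartan.isUnit [CompleteSpace A] [ProperSpace E] (hflat : IsMaurerCartan B)
    (hB : ContDiff ℝ 2 B) {L : E → A} {x₀ : E} (h₀ : L x₀ = 1)
    (hL : ∀ x, HasDarbouxDerivAt L (B x) x) (x : E) : IsUnit (L x) := by
  obtain ⟨P, hPx, hP⟩ := hflat.exists_hasDarbouxDerivAt hB x
  have mul_right_inv : L x₀ = L x * P x₀ :=
    HasDarbouxDerivAt.eqOn isOpen_univ isPreconnected_univ hB.continuous.continuousOn
      (fun z _ ↦ hL z) (fun z _ ↦ (hP z).const_mul (L x)) (mem_univ x) (by simp [hPx]) (mem_univ x₀)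
  have mul_left_inv : P x = P x₀ * L x :=
    HasDarbouxDerivAt.eqOn isOpen_univ isPreconnected_univ hB.continuous.continuousOn
      (fun z _ ↦ hP z) (fun z _ ↦ (hL z).const_mul (P x₀)) (mem_univ x₀) (by simp [h₀]) (mem_univ x)
  rw [h₀] at mul_right_inv
  rw [hPx] at mul_left_inv
  exact ⟨⟨L x, P x₀, mul_right_inv.symm, mul_left_inv.symm⟩, rfl⟩

end TotalDifferential

/-! ### Connections in a chart -/

section Chart

open Set Filter VectorField

variable {E : Type*} [NormedAddCommGroup E] [NormedSpace ℝ E]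
  {M : Type*} [TopologicalSpace M] [ChartedSpace E M] {e : OpenPartialHomeomorph M E} {q : M}

/-- The derivative of the chart `e` at `q`: it takes a tangent vector to its components. -/
def chartDeriv (e : OpenPartialHomeomorph M E) (q : M) : TangentSpace 𝓘(ℝ, E) q →L[ℝ] E :=
  mfderiv 𝓘(ℝ, E) 𝓘(ℝ, E) e q

/-- The inverse of the derivative of a chart: it takes components to a tangent vector (and is `0`
where the derivative is not invertible). -/
def chartInv (e : OpenPartialHomeomorph M E) (q : M) : E →L[ℝ] TangentSpace 𝓘(ℝ, E) q :=
  (mfderiv 𝓘(ℝ, E) 𝓘(ℝ, E) e q).inverse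

/-- The vector field with components `η` in the chart `e`. -/
def chartField (e : OpenPartialHomeomorph M E) (η : E → E) (q : M) : TangentSpace 𝓘(ℝ, E) q :=
  chartInv e q (η (e q))

/-- The components of a vector field in the chart `e`, as a function on the target of `e`. -/
def chartRep (e : OpenPartialHomeomorph M E) (Y : Π q : M, TangentSpace 𝓘(ℝ, E) q) (x : E) : E :=
  chartDeriv e (e.symm x) (Y (e.symm x))

theorem chartField_eq_mpullback (e : OpenPartialHomeomorph M E) (η : E → E) :
    chartField e η = mpullback 𝓘(ℝ, E) 𝓘(ℝ, E) e η := rfl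

theorem chartRep_apply (hq : q ∈ e.source) (Y : Π q : M, TangentSpace 𝓘(ℝ, E) q) :
    chartRep e Y (e q) = chartDeriv e q (Y q) := by
  have h : ∀ q', q' = q → chartDeriv e q' (Y q') = chartDeriv e q (Y q) := by
    rintro _ rfl
    rfl
  exact h _ (e.left_inv hq)

theorem two_le_infty : (2 : WithTop ℕ∞) ≤ ∞ :=
  WithTop.coe_le_coe.2 (le_top : (2 : ℕ∞) ≤ ⊤)

theorem mdifferentiableAt_section_vectorSpace {η : Π x : E, TangentSpace 𝓘(ℝ, E) x} {x : E}
    (hη : DifferentiableAt ℝ (F := E) η x) : MDiffAt (T% η) x := by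
  refine (mdifferentiableAt_section _ _).2 ?_
  have htriv : (fun b ↦ (trivializationAt E (TangentSpace 𝓘(ℝ, E)) x (T% η b)).2) = η := by
    ext b
    exact congrArg Prod.snd (trivializationAt_model_space_apply (I := 𝓘(ℝ, E)) (T% η b) x)
  rw [htriv]
  exact hη.mdifferentiableAt

theorem mdifferentiable_of_mem_maximalAtlas
    (he : e ∈ IsManifold.maximalAtlas 𝓘(ℝ, E) ∞ M) : e.MDifferentiable 𝓘(ℝ, E) 𝓘(ℝ, E) :=
  ⟨(contMDiffOn_of_mem_maximalAtlas he).mdifferentiableOn (by simp),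
    (contMDiffOn_symm_of_mem_maximalAtlas he).mdifferentiableOn (by simp)⟩

theorem isInvertible_mfderiv_of_mem_maximalAtlas
    (he : e ∈ IsManifold.maximalAtlas 𝓘(ℝ, E) ∞ M) (hq : q ∈ e.source) :
    (mfderiv 𝓘(ℝ, E) 𝓘(ℝ, E) e q).IsInvertible :=
  ⟨(mdifferentiable_of_mem_maximalAtlas he).mfderiv hq, rfl⟩

theorem chartDeriv_chartInv (he : e ∈ IsManifold.maximalAtlas 𝓘(ℝ, E) ∞ M) (hq : q ∈ e.source)
    (a : E) : chartDeriv e q (chartInv e q a) = a :=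
  (isInvertible_mfderiv_of_mem_maximalAtlas he hq).self_apply_inverse a

theorem chartInv_chartDeriv (he : e ∈ IsManifold.maximalAtlas 𝓘(ℝ, E) ∞ M) (hq : q ∈ e.source)
    (v : TangentSpace 𝓘(ℝ, E) q) : chartInv e q (chartDeriv e q v) = v :=
  (isInvertible_mfderiv_of_mem_maximalAtlas he hq).inverse_apply_self v

theorem chartDeriv_injective (he : e ∈ IsManifold.maximalAtlas 𝓘(ℝ, E) ∞ M) (hq : q ∈ e.source) :
    Function.Injective (chartDeriv e q) :=
  Function.LeftInverse.injective (chartInv_chartDeriv he hq)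

theorem chartDeriv_chartField (he : e ∈ IsManifold.maximalAtlas 𝓘(ℝ, E) ∞ M) (hq : q ∈ e.source)
    (η : E → E) : chartDeriv e q (chartField e η q) = η (e q) :=
  chartDeriv_chartInv he hq _

theorem chartField_chartRep (he : e ∈ IsManifold.maximalAtlas 𝓘(ℝ, E) ∞ M) (hq : q ∈ e.source)
    (Y : Π q : M, TangentSpace 𝓘(ℝ, E) q) : chartField e (chartRep e Y) q = Y q := by
  rw [chartField, chartRep_apply hq, chartInv_chartDeriv he hq]

theorem eventuallyEq_chartField_chartRep (he : e ∈ IsManifold.maximalAtlas 𝓘(ℝ, E) ∞ M)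
    (hq : q ∈ e.source) (Y : Π q : M, TangentSpace 𝓘(ℝ, E) q) :
    Y =ᶠ[𝓝 q] chartField e (chartRep e Y) := by
  filter_upwards [e.open_source.mem_nhds hq] with p hp
  exact (chartField_chartRep he hp Y).symm

theorem mvfderiv_comp_chart (he : e ∈ IsManifold.maximalAtlas 𝓘(ℝ, E) ∞ M) (hq : q ∈ e.source)
    {G : Type*} [NormedAddCommGroup G] [NormedSpace ℝ G] {F : E → G}
    (hF : DifferentiableAt ℝ F (e q)) (v : TangentSpace 𝓘(ℝ, E) q) :
    mvfderiv 𝓘(ℝ, E) (fun p ↦ F (e p)) q v = fderiv ℝ F (e q) (chartDeriv e q v) := by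
  have h := mfderiv_comp q hF.mdifferentiableAt
    ((mdifferentiable_of_mem_maximalAtlas he).mdifferentiableAt hq)
  rw [mfderiv_eq_fderiv] at h
  exact congrArg (fun T ↦ T v) h

theorem chartField_eq_sum [FiniteDimensional ℝ E] (e : OpenPartialHomeomorph M E) (η : E → E) :
    chartField e η = fun p ↦ ∑ i, ((fun p ↦ (Module.finBasis ℝ E).coord i (η (e p))) •
      chartField e fun _ ↦ Module.finBasis ℝ E i) p := by
  ext p
  have hη : η (e p) = ∑ i, (Module.finBasis ℝ E).coord i (η (e p)) • Module.finBasis ℝ E i :=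
    ((Module.finBasis ℝ E).sum_repr _).symm
  rw [chartField, hη, map_sum]
  simp only [map_smul]
  rfl

variable [IsManifold 𝓘(ℝ, E) ∞ M] [CompleteSpace E]

theorem contMDiffAt_chartField (he : e ∈ IsManifold.maximalAtlas 𝓘(ℝ, E) ∞ M)
    (hq : q ∈ e.source) {η : E → E} (hη : ContDiffAt ℝ ∞ η (e q)) :
    CMDiffAt ∞ (T% (chartField e η)) q := by
  rw [chartField_eq_mpullback]
  exact ContMDiffAt.mpullback_vectorField_preimage (n := ∞)
    (contMDiffAt_vectorSpace_iff_contDiffAt.2 hη) (contMDiffAt_of_mem_maximalAtlas he hq)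
    (isInvertible_mfderiv_of_mem_maximalAtlas he hq) (by simp)

theorem mdifferentiableAt_chartField (he : e ∈ IsManifold.maximalAtlas 𝓘(ℝ, E) ∞ M)
    (hq : q ∈ e.source) {η : E → E} (hη : DifferentiableAt ℝ η (e q)) :
    MDiffAt (T% (chartField e η)) q := by
  rw [chartField_eq_mpullback]
  exact MDifferentiableAt.mpullback_vectorField (n := ∞)
    (mdifferentiableAt_section_vectorSpace hη) (contMDiffAt_of_mem_maximalAtlas he hq)
    (isInvertible_mfderiv_of_mem_maximalAtlas he hq) two_le_infty

theorem contDiffAt_chartRep (he : e ∈ IsManifold.maximalAtlas 𝓘(ℝ, E) ∞ M) (hq : q ∈ e.source)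
    {Y : Π q : M, TangentSpace 𝓘(ℝ, E) q} (hY : CMDiffAt ∞ (T% Y) q) :
    ContDiffAt ℝ ∞ (chartRep e Y) (e q) := by
  have hsymm := (mdifferentiable_of_mem_maximalAtlas he).symm
  have hpull : ContDiffAt ℝ ∞ (mpullback 𝓘(ℝ, E) 𝓘(ℝ, E) e.symm Y) (e q) := by
    refine contMDiffAt_vectorSpace_iff_contDiffAt.1
      (ContMDiffAt.mpullback_vectorField_preimage (n := ∞) ?_
        (contMDiffAt_symm_of_mem_maximalAtlas he (e.map_source hq))
        ⟨hsymm.mfderiv (e.map_source hq), rfl⟩ (by simp))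
    rwa [e.left_inv hq]
  refine hpull.congr_of_eventuallyEq ?_
  filter_upwards [e.open_target.mem_nhds (e.map_source hq)] with x hx
  exact (congrArg (fun T ↦ T (Y (e.symm x)))
    (ContinuousLinearMap.inverse_equiv (hsymm.mfderiv hx))).symm

theorem mlieBracket_chartField (he : e ∈ IsManifold.maximalAtlas 𝓘(ℝ, E) ∞ M)
    (hq : q ∈ e.source) {ξ η : E → E} (hξ : DifferentiableAt ℝ ξ (e q))
    (hη : DifferentiableAt ℝ η (e q)) :
    chartDeriv e q (mlieBracket 𝓘(ℝ, E) (chartField e ξ) (chartField e η) q) =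
      fderiv ℝ η (e q) (ξ (e q)) - fderiv ℝ ξ (e q) (η (e q)) := by
  have two_le : minSmoothness ℝ 2 ≤ ∞ := by
    rw [minSmoothness_of_isRCLikeNormedField]
    exact two_le_infty
  have : IsManifold 𝓘(ℝ, E) (minSmoothness ℝ 2) M := IsManifold.of_le (n := ∞) two_le
  have hpull := mpullback_mlieBracket (I := 𝓘(ℝ, E)) (I' := 𝓘(ℝ, E)) (f := e) (V := ξ) (W := η)
    (x₀ := q) (n := ∞) (mdifferentiableAt_section_vectorSpace hξ)
    (mdifferentiableAt_section_vectorSpace hη) (contMDiffAt_of_mem_maximalAtlas he hq) two_le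
  have hflat : mlieBracket 𝓘(ℝ, E) (M := E) ξ η = lieBracket ℝ ξ η :=
    (mlieBracketWithin_univ (I := 𝓘(ℝ, E)) (M := E) (V := ξ) (W := η)).symm.trans
      (mlieBracketWithin_eq_lieBracketWithin.trans lieBracketWithin_univ)
  exact (congrArg (chartDeriv e q) hpull.symm).trans
    ((chartDeriv_chartInv he hq _).trans (congrFun hflat (e q)))

end Chart

section ChartConnection

open Set Filter VectorField

variable {E : Type*} [NormedAddCommGroup E] [NormedSpace ℝ E]
  {M : Type*} [TopologicalSpace M] [ChartedSpace E M] [IsManifold 𝓘(ℝ, E) ∞ M]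
  {e : OpenPartialHomeomorph M E} {q : M}

theorem contMDiffAt_extend (u : TangentSpace 𝓘(ℝ, E) q) :
    CMDiffAt ∞ (T% (FiberBundle.extend E u)) q := by
  obtain ⟨s, hs, h⟩ := FiberBundle.exists_contMDiffOn_extend (k := ∞) 𝓘(ℝ, E) E u
  exact h.contMDiffAt hs

theorem cov_sum (cov : AffineConnection 𝓘(ℝ, E) M) {ι : Type*} (s : Finset ι)
    {σ : ι → Π q : M, TangentSpace 𝓘(ℝ, E) q} (hσ : ∀ i ∈ s, MDiffAt (T% (σ i)) q) :
    cov (fun p ↦ ∑ i ∈ s, σ i p) q = ∑ i ∈ s, cov (σ i) q := by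
  classical
  induction s using Finset.induction_on with
  | empty => exact cov.isCovariantDerivativeOnUniv.zero (x := q)
  | insert i s hi ih =>
    have hins : (fun p ↦ ∑ j ∈ insert i s, σ j p) = σ i + fun p ↦ ∑ j ∈ s, σ j p := by
      ext p; simp [Finset.sum_insert hi]
    have hs : MDiffAt (T% (fun p ↦ ∑ j ∈ s, σ j p)) q :=
      MDifferentiableAt.sum_section fun j hj ↦ hσ j (Finset.mem_insert_of_mem hj)
    rw [hins, cov.isCovariantDerivativeOnUniv.add (hσ i (Finset.mem_insert_self i s)) hs,
      ih fun j hj ↦ hσ j (Finset.mem_insert_of_mem hj), Finset.sum_insert hi]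

/-- The curvature tensor in terms of Christoffel symbols `Γ`, at `x` and in components; `Γ x c a`
is the derivative of the coordinate field `c` in the direction `a`. -/
def riem (Γ : E → E →L[ℝ] E →L[ℝ] E) (x a b c : E) : E :=
  fderiv ℝ Γ x a c b - fderiv ℝ Γ x b c a + Γ x (Γ x c b) a - Γ x (Γ x c a) b

variable [FiniteDimensional ℝ E]

/-- The Christoffel symbols of a connection in the chart `e`: `christoffel cov e x c a` has the
components at `x` of the derivative in the direction `a` of the coordinate field `c`. It is
written with a basis to be bilinear by construction. -/
def christoffel (cov : AffineConnection 𝓘(ℝ, E) M) (e : OpenPartialHomeomorph M E) (x : E) :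
    E →L[ℝ] E →L[ℝ] E :=
  ∑ i, (LinearMap.toContinuousLinearMap ((Module.finBasis ℝ E).coord i)).smulRight
    ((chartDeriv e (e.symm x)).comp ((cov (chartField e fun _ ↦ Module.finBasis ℝ E i)
      (e.symm x)).comp (chartInv e (e.symm x))))

theorem christoffel_apply_chart (cov : AffineConnection 𝓘(ℝ, E) M) (hq : q ∈ e.source)
    (c a : E) : christoffel cov e (e q) c a = ∑ i, (Module.finBasis ℝ E).coord i c •
      chartDeriv e q (cov (chartField e fun _ ↦ Module.finBasis ℝ E i) q (chartInv e q a)) := by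
  have hcongr : ∀ q', q' = q → ∑ i, (Module.finBasis ℝ E).coord i c • chartDeriv e q'
      (cov (chartField e fun _ ↦ Module.finBasis ℝ E i) q' (chartInv e q' a)) =
      ∑ i, (Module.finBasis ℝ E).coord i c • chartDeriv e q
      (cov (chartField e fun _ ↦ Module.finBasis ℝ E i) q (chartInv e q a)) := by
    rintro _ rfl; rfl
  rw [← hcongr _ (e.left_inv hq), christoffel]
  simp only [sum_apply, ContinuousLinearMap.smulRight_apply, smul_apply]
  rfl

theorem chartDeriv_cov_chartField (he : e ∈ IsManifold.maximalAtlas 𝓘(ℝ, E) ∞ M)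
    (cov : AffineConnection 𝓘(ℝ, E) M) (hq : q ∈ e.source) {η : E → E}
    (hη : DifferentiableAt ℝ η (e q)) (v : TangentSpace 𝓘(ℝ, E) q) :
    chartDeriv e q (cov (chartField e η) q v) = fderiv ℝ η (e q) (chartDeriv e q v) +
      christoffel cov e (e q) (η (e q)) (chartDeriv e q v) := by
  set b := Module.finBasis ℝ E
  let c (i : Fin (Module.finrank ℝ E)) : E →L[ℝ] ℝ := LinearMap.toContinuousLinearMap (b.coord i)
  have diff_coord (i) : DifferentiableAt ℝ (fun x ↦ c i (η x)) (e q) :=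
    (c i).differentiableAt.comp _ hη
  have mdiff_coord (i) : MDiffAt (fun p ↦ c i (η (e p))) q :=
    MDifferentiableAt.comp (g := fun x ↦ c i (η x)) q (diff_coord i).mdifferentiableAt
      ((mdifferentiable_of_mem_maximalAtlas he).mdifferentiableAt hq)
  have mdiff_frame (i) : MDiffAt (T% (chartField e fun _ ↦ b i)) q :=
    mdifferentiableAt_chartField he hq (differentiableAt_const _)
  rw [chartField_eq_sum]
  change chartDeriv e q (cov (fun p ↦ ∑ i, ((fun p ↦ c i (η (e p))) •
    chartField e fun _ ↦ b i) p) q v) = _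
  rw [cov_sum cov _ fun i _ ↦ (mdiff_coord i).smul_section (mdiff_frame i)]
  simp only [fun i ↦ cov.isCovariantDerivativeOnUniv.leibniz (mdiff_frame i) (mdiff_coord i),
    sum_apply, map_sum, add_apply, smul_apply, ContinuousLinearMap.smulRight_apply, map_add,
    map_smul, Finset.sum_add_distrib]
  rw [add_comm]
  congr 1
  · rw [← b.sum_repr (fderiv ℝ η (e q) (chartDeriv e q v))]
    refine Finset.sum_congr rfl fun i _ ↦ ?_
    rw [chartDeriv_chartField he hq, mvfderiv_comp_chart he hq (diff_coord i)]
    exact congrArg (fun T : E →L[ℝ] ℝ ↦ T (chartDeriv e q v) • b i)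
      ((c i).hasFDerivAt.comp (e q) hη.hasFDerivAt).fderiv
  · rw [christoffel_apply_chart cov hq]
    simp only [chartInv_chartDeriv he hq]
    rfl

theorem chartDeriv_cov (he : e ∈ IsManifold.maximalAtlas 𝓘(ℝ, E) ∞ M)
    (cov : AffineConnection 𝓘(ℝ, E) M) (hq : q ∈ e.source)
    {Y : Π q : M, TangentSpace 𝓘(ℝ, E) q} (hY : DifferentiableAt ℝ (chartRep e Y) (e q))
    (v : TangentSpace 𝓘(ℝ, E) q) :
    chartDeriv e q (cov Y q v) = fderiv ℝ (chartRep e Y) (e q) (chartDeriv e q v) +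
      christoffel cov e (e q) (chartDeriv e q (Y q)) (chartDeriv e q v) := by
  have hY_eq := eventuallyEq_chartField_chartRep he hq Y
  have hm := mdifferentiableAt_chartField he hq hY
  have hm' : MDiffAt (T% Y) q :=
    hm.congr_of_eventuallyEq (hY_eq.mono fun p hp ↦ by simp only [hp])
  rw [cov.isCovariantDerivativeOnUniv.congr_of_eventuallyEq hm' hm univ_mem hY_eq,
    chartDeriv_cov_chartField he cov hq hY, chartRep_apply hq]

theorem hasFDerivAt_chartRep_cov (he : e ∈ IsManifold.maximalAtlas 𝓘(ℝ, E) ∞ M)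
    (cov : AffineConnection 𝓘(ℝ, E) M) (hq : q ∈ e.source)
    (hΓ : DifferentiableAt ℝ (christoffel cov e) (e q)) {Z W : Π q : M, TangentSpace 𝓘(ℝ, E) q}
    (hZ : ContDiffAt ℝ 2 (chartRep e Z) (e q)) (hW : DifferentiableAt ℝ (chartRep e W) (e q)) :
    HasFDerivAt (chartRep e fun p ↦ cov Z p (W p))
      (((fderiv ℝ (chartRep e Z) (e q)).comp (fderiv ℝ (chartRep e W) (e q)) +
        (fderiv ℝ (fderiv ℝ (chartRep e Z)) (e q)).flip (chartRep e W (e q))) +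
      (((christoffel cov e (e q)) (chartRep e Z (e q))).comp (fderiv ℝ (chartRep e W) (e q)) +
        ((christoffel cov e (e q)).comp (fderiv ℝ (chartRep e Z) (e q)) +
          (fderiv ℝ (christoffel cov e) (e q)).flip (chartRep e Z (e q))).flip
            (chartRep e W (e q)))) (e q) := by
  have hZ' : DifferentiableAt ℝ (fderiv ℝ (chartRep e Z)) (e q) :=
    (hZ.fderiv_right (m := 1) (by norm_num)).differentiableAt (by simp)
  have hZnear : ∀ᶠ x in 𝓝 (e q), DifferentiableAt ℝ (chartRep e Z) x :=
    (hZ.eventually (by simp)).mono fun x hx ↦ hx.differentiableAt (by simp)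
  have hcov_eq : chartRep e (fun p ↦ cov Z p (W p)) =ᶠ[𝓝 (e q)] fun x ↦
      fderiv ℝ (chartRep e Z) x (chartRep e W x) +
        christoffel cov e x (chartRep e Z x) (chartRep e W x) := by
    filter_upwards [hZnear, e.open_target.mem_nhds (e.map_source hq)] with x hx hxt
    have h := chartDeriv_cov he cov (e.map_target hxt) (Y := Z)
      (by rwa [e.right_inv hxt]) (W (e.symm x))
    rwa [e.right_inv hxt] at h
  exact ((hZ'.hasFDerivAt.clm_apply hW.hasFDerivAt).add ((hΓ.hasFDerivAt.clm_apply
    (hZ.differentiableAt (by simp)).hasFDerivAt).clm_apply hW.hasFDerivAt)).congr_of_eventuallyEq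
      hcov_eq

theorem chartDeriv_curvatureField (he : e ∈ IsManifold.maximalAtlas 𝓘(ℝ, E) ∞ M)
    (cov : AffineConnection 𝓘(ℝ, E) M) (hq : q ∈ e.source)
    (hΓ : DifferentiableAt ℝ (christoffel cov e) (e q))
    {X Y Z : Π q : M, TangentSpace 𝓘(ℝ, E) q} (hX : DifferentiableAt ℝ (chartRep e X) (e q))
    (hY : DifferentiableAt ℝ (chartRep e Y) (e q)) (hZ : ContDiffAt ℝ 2 (chartRep e Z) (e q)) :
    chartDeriv e q (curvatureField cov X Y Z q) =
      riem (christoffel cov e) (e q) (chartDeriv e q (X q)) (chartDeriv e q (Y q))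
        (chartDeriv e q (Z q)) := by
  have hZ₁ : DifferentiableAt ℝ (chartRep e Z) (e q) := hZ.differentiableAt (by simp)
  have hcovX := hasFDerivAt_chartRep_cov he cov hq hΓ hZ hX
  have hcovY := hasFDerivAt_chartRep_cov he cov hq hΓ hZ hY
  rw [curvatureField, map_sub, map_sub,
    chartDeriv_cov he cov hq (Y := fun p ↦ cov Z p (Y p)) hcovY.differentiableAt,
    chartDeriv_cov he cov hq (Y := fun p ↦ cov Z p (X p)) hcovX.differentiableAt,
    chartDeriv_cov he cov hq hZ₁ (mlieBracket _ X Y q), hcovY.fderiv, hcovX.fderiv,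
    chartDeriv_cov he cov hq hZ₁ (Y q), chartDeriv_cov he cov hq hZ₁ (X q),
    Filter.EventuallyEq.mlieBracket_vectorField_eq (eventuallyEq_chartField_chartRep he hq X)
      (eventuallyEq_chartField_chartRep he hq Y), mlieBracket_chartField he hq hX hY]
  simp only [chartRep_apply hq, riem, add_apply, ContinuousLinearMap.comp_apply,
    ContinuousLinearMap.flip_apply, map_add, map_sub]
  rw [(hZ.isSymmSndFDerivAt (by simp)).eq (chartDeriv e q (Y q)) (chartDeriv e q (X q))]
  abel

theorem chartDeriv_curvature (he : e ∈ IsManifold.maximalAtlas 𝓘(ℝ, E) ∞ M)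
    (cov : AffineConnection 𝓘(ℝ, E) M) (hq : q ∈ e.source)
    (hΓ : DifferentiableAt ℝ (christoffel cov e) (e q)) (u v w : TangentSpace 𝓘(ℝ, E) q) :
    chartDeriv e q (curvature cov q u v w) =
      riem (christoffel cov e) (e q) (chartDeriv e q u) (chartDeriv e q v) (chartDeriv e q w) := by
  have hext (u : TangentSpace 𝓘(ℝ, E) q) :
      ContDiffAt ℝ ∞ (chartRep e (FiberBundle.extend E u)) (e q) :=
    contDiffAt_chartRep he hq (contMDiffAt_extend u)
  rw [curvature, chartDeriv_curvatureField he cov hq hΓ ((hext u).differentiableAt (by simp))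
    ((hext v).differentiableAt (by simp)) ((hext w).of_le two_le_infty)]
  simp only [FiberBundle.extend_apply_self]

theorem contMDiffAt_cov [T2Space M] (cov : AffineConnection 𝓘(ℝ, E) M)
    [hcov : CovariantDerivative.ContMDiffCovariantDerivative cov ∞]
    {Z : Π q : M, TangentSpace 𝓘(ℝ, E) q} {u : Set M} (hu : IsOpen u) (hqu : q ∈ u)
    (hZ : CMDiff[u] ∞ (T% Z)) :
    ContMDiffAt 𝓘(ℝ, E) (𝓘(ℝ, E).prod 𝓘(ℝ, E →L[ℝ] E)) ∞
      (fun y ↦ Bundle.TotalSpace.mk' (E →L[ℝ] E)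
        (E := fun y : M ↦ TangentSpace 𝓘(ℝ, E) y →L[ℝ] TangentSpace 𝓘(ℝ, E) y) y (cov Z y)) q := by
  obtain ⟨f, -, hf⟩ := (SmoothBumpFunction.nhds_basis_tsupport (I := 𝓘(ℝ, E)) q).mem_iff.1
    (hu.mem_nhds hqu)
  have hfZ : CMDiff ∞ (T% ((f : M → ℝ) • Z)) :=
    ContMDiffOn.smul_section_of_tsupport (f.contMDiff.contMDiffOn) hu hf hZ
  have hcovfZ := hcov.contMDiff.contMDiff (σ := ((f : M → ℝ) • Z)) (by simpa using hfZ.contMDiffOn)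
  refine (hcovfZ.contMDiffAt (by simp)).congr_of_eventuallyEq ?_
  filter_upwards [f.eventuallyEq_one.eventually_nhds, hu.mem_nhds hqu] with y hy hyu
  congr 1
  refine cov.isCovariantDerivativeOnUniv.congr_of_eventuallyEq
    (hZ.contMDiffAt (hu.mem_nhds hyu) |>.mdifferentiableAt (by simp))
    (hfZ.contMDiffAt.mdifferentiableAt (by simp)) Filter.univ_mem ?_
  filter_upwards [hy] with z hz
  simp [hz]

theorem christoffel_eq_chartRep (he : e ∈ IsManifold.maximalAtlas 𝓘(ℝ, E) ∞ M)
    (cov : AffineConnection 𝓘(ℝ, E) M) {x : E} (hx : x ∈ e.target) (c a : E) :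
    christoffel cov e x c a = chartRep e (fun q ↦ cov (chartField e fun _ ↦ c) q
      (chartField e (fun _ ↦ a) q)) x := by
  rw [chartRep, chartDeriv_cov_chartField he cov (e.map_target hx) (differentiableAt_const c)
    (chartField e (fun _ ↦ a) (e.symm x))]
  simp [chartDeriv_chartField he (e.map_target hx), e.right_inv hx]

theorem contDiffOn_christoffel [T2Space M] (he : e ∈ IsManifold.maximalAtlas 𝓘(ℝ, E) ∞ M)
    (cov : AffineConnection 𝓘(ℝ, E) M)
    [hcov : CovariantDerivative.ContMDiffCovariantDerivative cov ∞] :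
    ContDiffOn ℝ ∞ (christoffel cov e) e.target := by
  refine contDiffOn_clm_apply.2 fun c ↦ contDiffOn_clm_apply.2 fun a ↦ ?_
  refine ContDiffOn.congr (fun x hx ↦ ?_) fun x hx ↦ christoffel_eq_chartRep he cov hx c a
  have hxs := e.map_target hx
  have hcov_field : CMDiffAt ∞ (T% (fun q ↦ cov (chartField e fun _ ↦ c) q
      (chartField e (fun _ ↦ a) q))) (e.symm x) :=
    (contMDiffAt_cov cov e.open_source hxs (Z := chartField e fun _ ↦ c)
      fun q hq ↦ (contMDiffAt_chartField he hq contDiffAt_const).contMDiffWithinAt).clm_bundle_apply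
      (E₁ := fun y : M ↦ TangentSpace 𝓘(ℝ, E) y) (E₂ := fun y : M ↦ TangentSpace 𝓘(ℝ, E) y)
      (contMDiffAt_chartField he hxs contDiffAt_const)
  have h := contDiffAt_chartRep he hxs hcov_field
  rw [e.right_inv hx] at h
  exact h.contDiffWithinAt

theorem christoffel_symm_of_torsion_eq_zero (he : e ∈ IsManifold.maximalAtlas 𝓘(ℝ, E) ∞ M)
    {cov : AffineConnection 𝓘(ℝ, E) M} (h : cov.torsion = 0) {x : E} (hx : x ∈ e.target)
    (a b : E) : christoffel cov e x a b = christoffel cov e x b a := by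
  have hxs := e.map_target hx
  have hbracket := mlieBracket_chartField he hxs (differentiableAt_const b)
    (differentiableAt_const a)
  rw [← (CovariantDerivative.torsion_eq_zero_iff (cov := cov)).1 h
    (mdifferentiableAt_chartField he hxs (differentiableAt_const b))
    (mdifferentiableAt_chartField he hxs (differentiableAt_const a)), map_sub] at hbracket
  simp only [fderiv_fun_const, Pi.zero_apply, zero_apply, sub_zero] at hbracket
  rw [christoffel_eq_chartRep he cov hx, christoffel_eq_chartRep he cov hx]
  exact sub_eq_zero.1 hbracket

end ChartConnection

/-! ### Projective changes in coordinates -/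

section Shortcuts

variable {E F G : Type*} [NormedAddCommGroup E] [NormedSpace ℝ E] [NormedAddCommGroup F]
  [NormedSpace ℝ F] [NormedAddCommGroup G] [NormedSpace ℝ G]

-- Without these shortcuts instance search times out on Christoffel symbols.
scoped instance instNormedAddCommGroupBilin : NormedAddCommGroup (E →L[ℝ] F →L[ℝ] G) :=
  ContinuousLinearMap.toNormedAddCommGroup

scoped instance instNormedSpaceBilin : NormedSpace ℝ (E →L[ℝ] F →L[ℝ] G) :=
  ContinuousLinearMap.toNormedSpace

end Shortcuts

section ClmApply

variable {E F G H : Type*} [NormedAddCommGroup E] [NormedSpace ℝ E] [NormedAddCommGroup F]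
  [NormedSpace ℝ F] [NormedAddCommGroup G] [NormedSpace ℝ G] [NormedAddCommGroup H]
  [NormedSpace ℝ H]

theorem hasFDerivAt_clm_apply_const {T : E → F →L[ℝ] G} {T' : E →L[ℝ] F →L[ℝ] G} {x : E}
    (hT : HasFDerivAt T T' x) (b : F) : HasFDerivAt (fun y ↦ T y b) (T'.flip b) x := by
  simpa using hT.clm_apply (hasFDerivAt_const b x)

theorem hasFDerivAt_clm_apply_const₂ {T : E → F →L[ℝ] G →L[ℝ] H} {T' : E →L[ℝ] F →L[ℝ] G →L[ℝ] H}
    {x : E} (hT : HasFDerivAt T T' x) (b : F) (c : G) :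
    HasFDerivAt (fun y ↦ T y b c) ((T'.flip b).flip c) x :=
  hasFDerivAt_clm_apply_const (hasFDerivAt_clm_apply_const hT b) c

theorem fderiv_clm_apply_const₂ {T : E → F →L[ℝ] G →L[ℝ] H} {x : E} (hT : DifferentiableAt ℝ T x)
    (a : E) (b : F) (c : G) : fderiv ℝ T x a b c = fderiv ℝ (fun y ↦ T y b c) x a := by
  rw [(hasFDerivAt_clm_apply_const₂ hT.hasFDerivAt b c).fderiv]
  rfl

end ClmApply

section ProjectiveAlgebra

open Set Filter

variable {E : Type*} [NormedAddCommGroup E] [NormedSpace ℝ E]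
  {Γ : E → E →L[ℝ] E →L[ℝ] E} {h h' : E → E →L[ℝ] E →L[ℝ] ℝ} {α : E → E →L[ℝ] ℝ} {x : E} {s : Set E}

/-- The structure equations, at `x`, of a connection that is induced on a hypersurface transversal
to its position vector, with second fundamental form `h`. -/
structure IsCentroaffineAt (Γ : E → E →L[ℝ] E →L[ℝ] E) (h : E → E →L[ℝ] E →L[ℝ] ℝ) (x : E) :
    Prop where
  christoffel_symm (a b : E) : Γ x a b = Γ x b a
  symm (a b : E) : h x a b = h x b a
  riem_eq (a b c : E) : riem Γ x a b c = h x b c • a - h x a c • b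
  codazzi (a b c : E) :
    fderiv ℝ h x a b c - h x b (Γ x c a) = fderiv ℝ h x b a c - h x a (Γ x c b)

theorem IsCentroaffineAt.congr_of_eventuallyEq (hc : IsCentroaffineAt Γ h x)
    (hh : h' =ᶠ[𝓝 x] h) : IsCentroaffineAt Γ h' x where
  christoffel_symm := hc.christoffel_symm
  symm := by rw [hh.self_of_nhds]; exact hc.symm
  riem_eq := by rw [hh.self_of_nhds]; exact hc.riem_eq
  codazzi := by rw [hh.self_of_nhds, hh.fderiv_eq]; exact hc.codazzi

theorem contDiffOn_riem (hs : IsOpen s) (hΓ : ContDiffOn ℝ ∞ Γ s) (a b c : E) :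
    ContDiffOn ℝ ∞ (fun x ↦ riem Γ x a b c) s := by
  have contDiff_fderiv (a b c : E) : ContDiffOn ℝ ∞ (fun x ↦ fderiv ℝ Γ x a b c) s :=
    (((hΓ.fderiv_of_isOpen hs (by simp)).clm_apply contDiffOn_const).clm_apply
      contDiffOn_const).clm_apply contDiffOn_const
  have contDiff_sq (a b c : E) : ContDiffOn ℝ ∞ (fun x ↦ Γ x (Γ x c b) a) s :=
    (hΓ.clm_apply ((hΓ.clm_apply contDiffOn_const).clm_apply contDiffOn_const)).clm_apply
      contDiffOn_const
  exact (((contDiff_fderiv a c b).sub (contDiff_fderiv b c a)).add (contDiff_sq a b c)).sub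
    (contDiff_sq b a c)

/-- The endomorphism `a ↦ R(a, b) c`. -/
def riemEnd (Γ : E → E →L[ℝ] E →L[ℝ] E) (x b c : E) : E →ₗ[ℝ] E where
  toFun a := riem Γ x a b c
  map_add' a a' := by simp only [riem, map_add, add_apply]; abel
  map_smul' t a := by simp only [riem, map_smul, smul_apply, RingHom.id_apply]; module

/-- The change `(c, a) ↦ α a • c + α c • a` of the Christoffel symbols under the projective change
of connection with the one-form `α`. -/
def projectiveBilin : (E →L[ℝ] ℝ) →L[ℝ] E →L[ℝ] E →L[ℝ] E :=
  ContinuousLinearMap.smulRightL ℝ E E +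
    (ContinuousLinearMap.smulRightL ℝ E (E →L[ℝ] E)).flip (.id ℝ E)

theorem projectiveBilin_apply (φ : E →L[ℝ] ℝ) (c a : E) :
    projectiveBilin φ c a = φ a • c + φ c • a := by
  simp [projectiveBilin]

/-- The tensor `∇α - α ⊗ α`, which governs the change of the curvature under the projective change
with the one-form `α`. -/
def projectiveSchouten (Γ : E → E →L[ℝ] E →L[ℝ] E) (α : E → E →L[ℝ] ℝ) (x : E) :
    E →L[ℝ] E →L[ℝ] ℝ :=
  fderiv ℝ α x - (ContinuousLinearMap.compL ℝ E E ℝ (α x)).comp (Γ x).flip -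
    (α x).smulRight (α x)

theorem projectiveSchouten_apply (Γ : E → E →L[ℝ] E →L[ℝ] E) (α : E → E →L[ℝ] ℝ) (x b c : E) :
    projectiveSchouten Γ α x b c = fderiv ℝ α x b c - α x (Γ x c b) - α x b * α x c := by
  simp [projectiveSchouten]

theorem riem_add_projectiveBilin (hΓ : DifferentiableAt ℝ Γ x) (hα : DifferentiableAt ℝ α x)
    (hsymm : ∀ a b, Γ x a b = Γ x b a) (a b c : E) :
    riem (fun y ↦ Γ y + projectiveBilin (α y)) x a b c = riem Γ x a b c
      + (projectiveSchouten Γ α x a b - projectiveSchouten Γ α x b a) • c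
      + projectiveSchouten Γ α x a c • b - projectiveSchouten Γ α x b c • a := by
  have hderiv : HasFDerivAt (fun y ↦ Γ y + projectiveBilin (α y)) _ x :=
    hΓ.hasFDerivAt.add ((projectiveBilin (E := E)).hasFDerivAt.comp x hα.hasFDerivAt)
  simp only [riem, hderiv.fderiv, projectiveSchouten_apply, add_apply,
    ContinuousLinearMap.comp_apply, projectiveBilin_apply, map_add, map_smul, smul_apply,
    hsymm b a]
  module

theorem fderiv_projectiveSchouten (hΓ : DifferentiableAt ℝ Γ x) (hα : ContDiffAt ℝ 2 α x)
    (a b c : E) : fderiv ℝ (projectiveSchouten Γ α) x a b c =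
      fderiv ℝ (fderiv ℝ α) x a b c - (fderiv ℝ α x a (Γ x c b) + α x (fderiv ℝ Γ x a c b)) -
        (α x b * fderiv ℝ α x a c + fderiv ℝ α x a b * α x c) := by
  have hα₁ := hα.differentiableAt (by simp)
  have hdα : DifferentiableAt ℝ (fderiv ℝ α) x :=
    (hα.fderiv_right (m := 1) (by norm_num)).differentiableAt (by simp)
  have hP : DifferentiableAt ℝ (projectiveSchouten Γ α) x :=
    (hdα.sub (((ContinuousLinearMap.compL ℝ E E ℝ).differentiableAt.comp x hα₁).clm_comp
      ((ContinuousLinearMap.flipₗᵢ ℝ E E E).differentiableAt.comp x hΓ))).sub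
      ((ContinuousLinearMap.smulRightL ℝ E (E →L[ℝ] ℝ)).hasFDerivAt_of_bilinear hα₁.hasFDerivAt
        hα₁.hasFDerivAt).differentiableAt
  rw [fderiv_clm_apply_const₂ hP]
  simp only [projectiveSchouten_apply]
  have hderiv := ((hasFDerivAt_clm_apply_const₂ hdα.hasFDerivAt b c).sub
    (hα₁.hasFDerivAt.clm_apply (hasFDerivAt_clm_apply_const₂ hΓ.hasFDerivAt c b))).sub
    ((hasFDerivAt_clm_apply_const hα₁.hasFDerivAt b).mul
      (hasFDerivAt_clm_apply_const hα₁.hasFDerivAt c))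
  refine (congrArg (fun T ↦ T a) hderiv.fderiv).trans ?_
  simp
  ring

theorem isCentroaffineAt_projectiveSchouten (hΓ : DifferentiableAt ℝ Γ x) (hα : ContDiffAt ℝ 2 α x)
    (hΓ_symm : ∀ a b, Γ x a b = Γ x b a)
    (hP_symm : ∀ a b, projectiveSchouten Γ α x a b = projectiveSchouten Γ α x b a)
    (hflat : ∀ a b c, riem (fun y ↦ Γ y + projectiveBilin (α y)) x a b c = 0) :
    IsCentroaffineAt Γ (projectiveSchouten Γ α) x := by
  have hR (a b c : E) : riem Γ x a b c =
      projectiveSchouten Γ α x b c • a - projectiveSchouten Γ α x a c • b := by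
    have h := hflat a b c
    rw [riem_add_projectiveBilin hΓ (hα.differentiableAt (by simp)) hΓ_symm, hP_symm b a, sub_self,
      zero_smul, add_zero] at h
    rw [← sub_eq_zero, ← h]
    abel
  refine ⟨hΓ_symm, hP_symm, hR, fun a b c ↦ ?_⟩
  -- Modulo the symmetry of `D²α`, the Codazzi equation is `α` applied to the Gauss equation `hR`.
  have hαR := congrArg (α x) (hR a b c)
  rw [fderiv_projectiveSchouten hΓ hα, fderiv_projectiveSchouten hΓ hα,
    (hα.isSymmSndFDerivAt (by simp)).eq b a]
  have hP := hP_symm a b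
  simp only [riem, projectiveSchouten_apply, map_sub, map_add, map_smul, smul_eq_mul,
    hΓ_symm b a] at hαR hP ⊢
  linear_combination -hαR - α x c * hP

variable [FiniteDimensional ℝ E]

/-- The Ricci tensor in terms of Christoffel symbols. -/
def ricciForm (Γ : E → E →L[ℝ] E →L[ℝ] E) (x : E) : E →L[ℝ] E →L[ℝ] ℝ :=
  IsBilinearMap.toContinuousBilinearMap (f := fun b c ↦ LinearMap.trace ℝ E (riemEnd Γ x b c))
    { add_left := fun b b' c ↦ by
        rw [← map_add]; congr 1; ext a; simp [riemEnd, riem]; abel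
      smul_left := fun t b c ↦ by
        rw [← map_smul]; congr 1; ext a; simp [riemEnd, riem]; module
      add_right := fun b c c' ↦ by
        rw [← map_add]; congr 1; ext a; simp [riemEnd, riem]; abel
      smul_right := fun t b c ↦ by
        rw [← map_smul]; congr 1; ext a; simp [riemEnd, riem]; module }

theorem ricciForm_apply (Γ : E → E →L[ℝ] E →L[ℝ] E) (x b c : E) :
    ricciForm Γ x b c = LinearMap.trace ℝ E (riemEnd Γ x b c) := rfl

theorem contDiffOn_ricciForm (hs : IsOpen s) (hΓ : ContDiffOn ℝ ∞ Γ s) :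
    ContDiffOn ℝ ∞ (ricciForm Γ) s := by
  refine contDiffOn_clm_apply.2 fun b ↦ contDiffOn_clm_apply.2 fun c ↦ ?_
  simp only [ricciForm_apply, LinearMap.trace_eq_matrix_trace ℝ (Module.finBasis ℝ E),
    Matrix.trace, Matrix.diag_apply, LinearMap.toMatrix_apply]
  exact ContDiffOn.sum fun i _ ↦ (LinearMap.toContinuousLinearMap
    ((Module.finBasis ℝ E).coord i)).contDiff.comp_contDiffOn (contDiffOn_riem hs hΓ _ b c)

theorem ricciForm_of_riem_eq {P : E →L[ℝ] E →L[ℝ] ℝ}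
    (h : ∀ a b c, riem Γ x a b c = P b c • a - P a c • b - (P a b - P b a) • c) (b c : E) :
    ricciForm Γ x b c = Module.finrank ℝ E * P b c - P c b := by
  have hEnd : riemEnd Γ x b c = P b c • LinearMap.id
      - (P.flip c : E →ₗ[ℝ] ℝ).smulRight b
      - ((P.flip b : E →ₗ[ℝ] ℝ).smulRight c - (P b : E →ₗ[ℝ] ℝ).smulRight c) := by
    ext a
    simp [riemEnd, h, sub_smul]
  rw [ricciForm_apply, hEnd]
  simp only [map_sub, map_smul, LinearMap.trace_smulRight, LinearMap.trace_id]
  simp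
  ring

theorem symm_and_inv_smul_ricciForm_eq (hE : 2 ≤ Module.finrank ℝ E) {P : E →L[ℝ] E →L[ℝ] ℝ}
    (hR : ∀ a b c, riem Γ x a b c = P b c • a - P a c • b - (P a b - P b a) • c)
    (hsymm : ∀ b c, ricciForm Γ x b c = ricciForm Γ x c b) :
    (∀ b c, P b c = P c b) ∧ (Module.finrank ℝ E - 1 : ℝ)⁻¹ • ricciForm Γ x = P := by
  have hn : (2 : ℝ) ≤ Module.finrank ℝ E := mod_cast hE
  have hP_symm (b c : E) : P b c = P c b := by
    have h := hsymm b c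
    rw [ricciForm_of_riem_eq hR, ricciForm_of_riem_eq hR] at h
    have hmul : (Module.finrank ℝ E + 1 : ℝ) * (P b c - P c b) = 0 := by linear_combination h
    exact sub_eq_zero.1 ((mul_eq_zero.1 hmul).resolve_left (by positivity))
  refine ⟨hP_symm, ContinuousLinearMap.ext fun b ↦ ContinuousLinearMap.ext fun c ↦ ?_⟩
  have hn' : (Module.finrank ℝ E - 1 : ℝ) ≠ 0 := by linarith
  simp only [smul_apply, smul_eq_mul, ricciForm_of_riem_eq hR, hP_symm c b]
  field_simp

theorem isCentroaffineAt_of_projective (hE : 2 ≤ Module.finrank ℝ E) (hΓ : ContDiffAt ℝ ∞ Γ x)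
    (hα : ContDiffAt ℝ ∞ α x) (hΓ_symm : ∀ᶠ y in 𝓝 x, ∀ a b, Γ y a b = Γ y b a)
    (hflat : ∀ᶠ y in 𝓝 x, ∀ a b c, riem (fun y ↦ Γ y + projectiveBilin (α y)) y a b c = 0)
    (hric : ∀ᶠ y in 𝓝 x, ∀ b c, ricciForm Γ y b c = ricciForm Γ y c b) :
    IsCentroaffineAt Γ (fun y ↦ (Module.finrank ℝ E - 1 : ℝ)⁻¹ • ricciForm Γ y) x := by
  have hα₂ : ContDiffAt ℝ 2 α x := hα.of_le two_le_infty
  have hΓ₁ : ContDiffAt ℝ 1 Γ x := hΓ.of_le (by simp)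
  have hP : ∀ᶠ y in 𝓝 x,
      (∀ b c, projectiveSchouten Γ α y b c = projectiveSchouten Γ α y c b) ∧
      (Module.finrank ℝ E - 1 : ℝ)⁻¹ • ricciForm Γ y = projectiveSchouten Γ α y := by
    filter_upwards [hα₂.eventually (by simp), hΓ₁.eventually (by simp), hΓ_symm, hflat, hric]
      with y hαy hΓy hsymm hflat hric
    refine symm_and_inv_smul_ricciForm_eq hE (fun a b c ↦ ?_) hric
    have h := hflat a b c
    rw [riem_add_projectiveBilin (hΓy.differentiableAt (by simp)) (hαy.differentiableAt (by simp))
      hsymm] at h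
    rw [← sub_eq_zero, ← h]
    module
  exact (isCentroaffineAt_projectiveSchouten (hΓ₁.differentiableAt (by simp)) hα₂
    hΓ_symm.self_of_nhds hP.self_of_nhds.1 hflat.self_of_nhds).congr_of_eventuallyEq
      (hP.mono fun y hy ↦ hy.2)

end ProjectiveAlgebra

/-! ### Projectively flat connections are centroaffine -/

section Centroaffine

open Set Filter

variable {E : Type*} [NormedAddCommGroup E] [NormedSpace ℝ E]
  {M : Type*} [TopologicalSpace M] [ChartedSpace E M]
  {e : OpenPartialHomeomorph M E} {q : M} {x : E}

theorem riem_congr_of_eventuallyEq {Γ Γ' : E → E →L[ℝ] E →L[ℝ] E} (h : Γ =ᶠ[𝓝 x] Γ') :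
    riem Γ x = riem Γ' x := by
  funext a b c
  rw [riem, riem, h.fderiv_eq, h.self_of_nhds]

/-- The components of a one-form in the chart `e`. -/
def chartForm (e : OpenPartialHomeomorph M E) (φ : Π q : M, TangentSpace 𝓘(ℝ, E) q →L[ℝ] ℝ)
    (x : E) : E →L[ℝ] ℝ :=
  (φ (e.symm x)).comp (chartInv e (e.symm x))

variable [IsManifold 𝓘(ℝ, E) ∞ M]

/-- The derivative of a chart as an isomorphism. -/
def chartDerivEquiv (he : e ∈ IsManifold.maximalAtlas 𝓘(ℝ, E) ∞ M) (hq : q ∈ e.source) :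
    TangentSpace 𝓘(ℝ, E) q ≃ₗ[ℝ] E where
  __ := (chartDeriv e q).toLinearMap
  invFun := chartInv e q
  left_inv := chartInv_chartDeriv he hq
  right_inv := chartDeriv_chartInv he hq

variable [FiniteDimensional ℝ E]

/-- The connection `cov` satisfies, in each chart, the structure equations of a connection
induced on a hypersurface transversal to its position vector, with second fundamental form `H`. -/
def IsCentroaffine (cov : AffineConnection 𝓘(ℝ, E) M)
    (H : Π q : M, TangentSpace 𝓘(ℝ, E) q → TangentSpace 𝓘(ℝ, E) q → ℝ) : Prop :=
  ∀ e ∈ IsManifold.maximalAtlas 𝓘(ℝ, E) ∞ M, ∃ h : E → E →L[ℝ] E →L[ℝ] ℝ,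
    ContDiffOn ℝ ∞ (christoffel cov e) e.target ∧ ContDiffOn ℝ ∞ h e.target ∧
    (∀ q ∈ e.source, ∀ v w, h (e q) (chartDeriv e q v) (chartDeriv e q w) = H q v w) ∧
    ∀ x ∈ e.target, IsCentroaffineAt (christoffel cov e) h x

theorem riem_christoffel (he : e ∈ IsManifold.maximalAtlas 𝓘(ℝ, E) ∞ M)
    (cov : AffineConnection 𝓘(ℝ, E) M) (hx : x ∈ e.target)
    (hΓ : DifferentiableAt ℝ (christoffel cov e) x) (a b c : E) :
    riem (christoffel cov e) x a b c = chartDeriv e (e.symm x) (curvature cov (e.symm x)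
      (chartInv e (e.symm x) a) (chartInv e (e.symm x) b) (chartInv e (e.symm x) c)) := by
  have hxs := e.map_target hx
  rw [chartDeriv_curvature he cov hxs (by rwa [e.right_inv hx])]
  simp only [chartDeriv_chartInv he hxs, e.right_inv hx]

theorem differentiableAt_christoffel [T2Space M] (he : e ∈ IsManifold.maximalAtlas 𝓘(ℝ, E) ∞ M)
    (cov : AffineConnection 𝓘(ℝ, E) M)
    [CovariantDerivative.ContMDiffCovariantDerivative cov ∞] (hx : x ∈ e.target) :
    DifferentiableAt ℝ (christoffel cov e) x :=
  ((contDiffOn_christoffel he cov).contDiffAt (e.open_target.mem_nhds hx)).differentiableAt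
    (by simp)

theorem ricci_eq_ricciForm [T2Space M] (he : e ∈ IsManifold.maximalAtlas 𝓘(ℝ, E) ∞ M)
    (cov : AffineConnection 𝓘(ℝ, E) M)
    [hcov : CovariantDerivative.ContMDiffCovariantDerivative cov ∞] (hq : q ∈ e.source)
    (v w : TangentSpace 𝓘(ℝ, E) q) :
    ricci cov q v w =
      ricciForm (christoffel cov e) (e q) (chartDeriv e q v) (chartDeriv e q w) := by
  rw [ricciForm_apply, ricci, ← LinearMap.trace_conj' _ (chartDerivEquiv he hq)]
  congr 1
  ext a
  refine (chartDeriv_curvature he cov hq (differentiableAt_christoffel he cov (e.map_source hq))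
    (chartInv e q a) v w).trans ?_
  rw [chartDeriv_chartInv he hq]
  rfl

theorem ricciForm_christoffel [T2Space M] (he : e ∈ IsManifold.maximalAtlas 𝓘(ℝ, E) ∞ M)
    (cov : AffineConnection 𝓘(ℝ, E) M)
    [CovariantDerivative.ContMDiffCovariantDerivative cov ∞] (hx : x ∈ e.target) (b c : E) :
    ricciForm (christoffel cov e) x b c =
      ricci cov (e.symm x) (chartInv e (e.symm x) b) (chartInv e (e.symm x) c) := by
  have hxs := e.map_target hx
  rw [ricci_eq_ricciForm he cov hxs, chartDeriv_chartInv he hxs, chartDeriv_chartInv he hxs,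
    e.right_inv hx]

theorem contDiffOn_chartForm (he : e ∈ IsManifold.maximalAtlas 𝓘(ℝ, E) ∞ M)
    {φ : Π q : M, TangentSpace 𝓘(ℝ, E) q →L[ℝ] ℝ} {U : Set M} (hU : IsOpen U)
    (hφ : ContMDiffOn 𝓘(ℝ, E) (𝓘(ℝ, E).prod 𝓘(ℝ, E →L[ℝ] ℝ)) ∞
      (fun x ↦ Bundle.TotalSpace.mk' (E →L[ℝ] ℝ)
        (E := fun x : M ↦ TangentSpace 𝓘(ℝ, E) x →L[ℝ] Bundle.Trivial M ℝ x) x (φ x)) U) :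
    ContDiffOn ℝ ∞ (chartForm e φ) (e.target ∩ e.symm ⁻¹' U) := by
  refine contDiffOn_clm_apply.2 fun a x hx ↦ ContDiffAt.contDiffWithinAt ?_
  have hφ_field : ContMDiffAt 𝓘(ℝ, E) 𝓘(ℝ, ℝ) ∞ (fun q ↦ φ q (chartField e (fun _ ↦ a) q))
      (e.symm x) := (Bundle.contMDiffAt_section _).1 <|
    (hφ.contMDiffAt (hU.mem_nhds hx.2)).clm_bundle_apply
      (E₁ := fun y : M ↦ TangentSpace 𝓘(ℝ, E) y) (E₂ := Bundle.Trivial M ℝ)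
      (contMDiffAt_chartField he (e.map_target hx.1) contDiffAt_const)
  exact (hφ_field.comp x (contMDiffAt_symm_of_mem_maximalAtlas he hx.1)).contDiffAt

theorem christoffel_projectiveChange (he : e ∈ IsManifold.maximalAtlas 𝓘(ℝ, E) ∞ M)
    (cov : AffineConnection 𝓘(ℝ, E) M) (φ : Π q : M, TangentSpace 𝓘(ℝ, E) q →L[ℝ] ℝ)
    (hx : x ∈ e.target) : christoffel (projectiveChange cov φ) e x =
      christoffel cov e x + projectiveBilin (chartForm e φ x) := by
  ext c a
  simp only [christoffel_eq_chartRep he _ hx, chartRep, projectiveChange_apply,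
    ContinuousLinearMap.map_add, ContinuousLinearMap.map_smul,
    chartDeriv_chartField he (e.map_target hx), add_apply, projectiveBilin_apply]
  rfl

theorem riem_add_projectiveBilin_eq_zero [T2Space M]
    (he : e ∈ IsManifold.maximalAtlas 𝓘(ℝ, E) ∞ M) (cov : AffineConnection 𝓘(ℝ, E) M)
    [CovariantDerivative.ContMDiffCovariantDerivative cov ∞]
    {φ : Π q : M, TangentSpace 𝓘(ℝ, E) q →L[ℝ] ℝ} (hx : x ∈ e.target)
    (hφ : DifferentiableAt ℝ (chartForm e φ) x)
    (hflat : ∀ u v w, curvature (projectiveChange cov φ) (e.symm x) u v w = 0) (a b c : E) :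
    riem (fun y ↦ christoffel cov e y + projectiveBilin (chartForm e φ y)) x a b c = 0 := by
  have hΓ : christoffel (projectiveChange cov φ) e =ᶠ[𝓝 x]
      fun y ↦ christoffel cov e y + projectiveBilin (chartForm e φ y) :=
    Filter.mem_of_superset (e.open_target.mem_nhds hx) fun _ hy ↦
      christoffel_projectiveChange he cov φ hy
  have hdiff : DifferentiableAt ℝ
      (fun y ↦ christoffel cov e y + projectiveBilin (chartForm e φ y)) x :=
    (differentiableAt_christoffel he cov hx).add
      ((projectiveBilin (E := E)).differentiableAt.comp x hφ)
  rw [← riem_congr_of_eventuallyEq hΓ, riem_christoffel he _ hx (hdiff.congr_of_eventuallyEq hΓ),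
    hflat, map_zero]

theorem isCentroaffine_of_projectivelyFlat [T2Space M] (hE : 2 ≤ Module.finrank ℝ E)
    {cov : AffineConnection 𝓘(ℝ, E) M}
    [CovariantDerivative.ContMDiffCovariantDerivative cov ∞] (htor : cov.torsion = 0)
    (hric : RicciSymmetric cov) (hflat : ProjectivelyFlat cov) :
    IsCentroaffine cov fun q v w ↦ (Module.finrank ℝ E - 1 : ℝ)⁻¹ * ricci cov q v w := by
  intro e he
  have hΓ := contDiffOn_christoffel he cov
  refine ⟨fun x ↦ (Module.finrank ℝ E - 1 : ℝ)⁻¹ • ricciForm (christoffel cov e) x, hΓ,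
    contDiffOn_const.fun_smul (contDiffOn_ricciForm e.open_target hΓ), fun q hq v w ↦ ?_,
    fun x hx ↦ ?_⟩
  · simp only [smul_apply, smul_eq_mul, ricci_eq_ricciForm he cov hq]
  obtain ⟨U, hU, hxU, φ, hφ, hR⟩ := hflat (e.symm x)
  have htarget : ∀ᶠ y in 𝓝 x, y ∈ e.target := e.open_target.mem_nhds hx
  have hU_nhds : e.target ∩ e.symm ⁻¹' U ∈ 𝓝 x :=
    (e.symm.isOpen_inter_preimage hU).mem_nhds ⟨hx, hxU⟩
  have hα : ContDiffAt ℝ ∞ (chartForm e φ) x := (contDiffOn_chartForm he hU hφ).contDiffAt hU_nhds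
  refine isCentroaffineAt_of_projective hE (hΓ.contDiffAt htarget) hα ?_ ?_ ?_
  · exact htarget.mono fun y hy ↦ christoffel_symm_of_torsion_eq_zero he htor hy
  · filter_upwards [hU_nhds, (hα.of_le two_le_infty).eventually (by simp)] with y hy hαy
    exact riem_add_projectiveBilin_eq_zero he cov hy.1 (hαy.differentiableAt (by simp)) (hR _ hy.2)
  · filter_upwards [htarget] with y hy b c
    rw [ricciForm_christoffel he cov hy, ricciForm_christoffel he cov hy, hric]

end Centroaffine

/-! ### The moving frame of a centroaffine hypersurface -/

section Frame

open Set Filter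

variable {E : Type*} [NormedAddCommGroup E] [NormedSpace ℝ E]
  {V : Type*} [NormedAddCommGroup V] [NormedSpace ℝ V]
  {Γ : E → E →L[ℝ] E →L[ℝ] E} {h : E → E →L[ℝ] E →L[ℝ] ℝ} {F : E → V} {x : E}

/-- The matrix of the structure equations of a centroaffine hypersurface, as a one-form with values
in the endomorphisms of `E × ℝ`. -/
def frameForm (Γ : E → E →L[ℝ] E →L[ℝ] E) (h : E → E →L[ℝ] E →L[ℝ] ℝ) (x : E) :
    E →L[ℝ] (E × ℝ) →L[ℝ] (E × ℝ) :=
  ((ContinuousLinearMap.compL ℝ (E × ℝ) E (E × ℝ) (.inl ℝ E ℝ)).comp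
      ((ContinuousLinearMap.compL ℝ (E × ℝ) E E).flip (.fst ℝ E ℝ))).comp (Γ x) +
    (ContinuousLinearMap.compL ℝ (E × ℝ) E (E × ℝ) (.inl ℝ E ℝ)).comp
      (ContinuousLinearMap.smulRightL ℝ (E × ℝ) E (.snd ℝ E ℝ)) -
    ((ContinuousLinearMap.compL ℝ (E × ℝ) ℝ (E × ℝ) (.inr ℝ E ℝ)).comp
      ((ContinuousLinearMap.compL ℝ (E × ℝ) E ℝ).flip (.fst ℝ E ℝ))).comp (h x)

theorem frameForm_apply (Γ : E → E →L[ℝ] E →L[ℝ] E) (h : E → E →L[ℝ] E →L[ℝ] ℝ) (x a : E)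
    (w : E × ℝ) : frameForm Γ h x a w = (Γ x a w.1 + w.2 • a, -h x a w.1) := by
  simp [frameForm]

theorem contDiffOn_frameForm {n : WithTop ℕ∞} {s : Set E} (hΓ : ContDiffOn ℝ n Γ s)
    (hh : ContDiffOn ℝ n h s) : ContDiffOn ℝ n (frameForm Γ h) s :=
  ((contDiffOn_const.clm_comp hΓ).add contDiffOn_const).sub (contDiffOn_const.clm_comp hh)

theorem fderiv_frameForm (hΓ : DifferentiableAt ℝ Γ x) (hh : DifferentiableAt ℝ h x) (a b : E)
    (w : E × ℝ) :
    fderiv ℝ (frameForm Γ h) x a b w = (fderiv ℝ Γ x a b w.1, -fderiv ℝ h x a b w.1) := by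
  have hB : DifferentiableAt ℝ (frameForm Γ h) x :=
    (((differentiableAt_const _).clm_comp hΓ).add_const _).sub
      ((differentiableAt_const _).clm_comp hh)
  rw [fderiv_clm_apply_const₂ hB]
  simp only [frameForm_apply]
  exact congrArg (fun T ↦ T a)
    (((hasFDerivAt_clm_apply_const₂ hΓ.hasFDerivAt b w.1).add_const (w.2 • b)).prodMk
      (hasFDerivAt_clm_apply_const₂ hh.hasFDerivAt b w.1).neg).fderiv

theorem isMaurerCartan_frameForm (hΓ : Differentiable ℝ Γ) (hh : Differentiable ℝ h)
    (hc : ∀ x, IsCentroaffineAt Γ h x) : IsMaurerCartan (frameForm Γ h) := by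
  intro x a b
  have hΓ_symm := (hc x).christoffel_symm
  have fderiv_symm (a b c : E) : fderiv ℝ Γ x a b c = fderiv ℝ Γ x a c b := by
    simp only [fderiv_clm_apply_const₂ (hΓ x), fun y ↦ (hc y).christoffel_symm b c]
  refine ContinuousLinearMap.ext fun ⟨w, s⟩ ↦ ?_
  simp only [add_apply, mul_apply_eq_comp, fderiv_frameForm (hΓ x) (hh x), frameForm_apply,
    ContinuousLinearMap.map_add, ContinuousLinearMap.map_smul, Prod.mk_add_mk]
  refine Prod.ext ?_ ?_
  · have hgauss := (hc x).riem_eq a b w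
    rw [riem, fderiv_symm a w, fderiv_symm b w, hΓ_symm w b, hΓ_symm w a, hΓ_symm _ a, hΓ_symm _ b,
      ← sub_eq_zero] at hgauss
    simp only [hΓ_symm b a]
    rw [← sub_eq_zero, ← hgauss]
    module
  · have hcodazzi := (hc x).codazzi a b w
    rw [hΓ_symm w b, hΓ_symm w a] at hcodazzi
    simp only [(hc x).symm b a, smul_eq_mul]
    linear_combination -hcodazzi

/-- The frame `(w, s) ↦ DF w + s F` of a hypersurface `F`. -/
def frame (F : E → V) (x : E) : (E × ℝ) →L[ℝ] V :=
  (fderiv ℝ F x).comp (.fst ℝ E ℝ) + (ContinuousLinearMap.snd ℝ E ℝ).smulRight (F x)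

theorem frame_apply (F : E → V) (x : E) (w : E × ℝ) :
    frame F x w = fderiv ℝ F x w.1 + w.2 • F x := by
  simp [frame]

/-- The Gauss formula of a hypersurface `F` at `x`, with transversal `F`. -/
def ChartGaussFormula (Γ : E → E →L[ℝ] E →L[ℝ] E) (h : E → E →L[ℝ] E →L[ℝ] ℝ) (F : E → V)
    (x : E) : Prop :=
  ∀ a b, fderiv ℝ (fderiv ℝ F) x a b = fderiv ℝ F x (Γ x b a) - h x a b • F x

theorem hasDarbouxDerivAt_frame {F : E → E × ℝ} (hsymm : ∀ a b, Γ x a b = Γ x b a)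
    (hF : ContDiffAt ℝ 2 F x) (hH : ChartGaussFormula Γ h F x) :
    HasDarbouxDerivAt (frame F) (frameForm Γ h x) x := by
  have hdF : HasFDerivAt (fderiv ℝ F) (fderiv ℝ (fderiv ℝ F) x) x :=
    ((hF.fderiv_right (m := 1) (by norm_num)).differentiableAt (by simp)).hasFDerivAt
  have hF' : HasFDerivAt F (fderiv ℝ F x) x := (hF.differentiableAt (by simp)).hasFDerivAt
  refine HasFDerivAt.congr_fderiv ((((ContinuousLinearMap.compL ℝ (E × ℝ) E (E × ℝ)).flip
    (.fst ℝ E ℝ)).hasFDerivAt.comp x hdF).add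
    ((ContinuousLinearMap.smulRightL ℝ (E × ℝ) (E × ℝ) (.snd ℝ E ℝ)).hasFDerivAt.comp x hF')) ?_
  refine ContinuousLinearMap.ext fun a ↦ ContinuousLinearMap.ext fun w ↦ ?_
  simp only [add_apply, ContinuousLinearMap.comp_apply, ContinuousLinearMap.flip_apply,
    ContinuousLinearMap.compL_apply, ContinuousLinearMap.mul_apply', mul_apply_eq_comp,
    ContinuousLinearMap.coe_fst', frame_apply, frameForm_apply,
    hH a w.1, ContinuousLinearMap.map_add, ContinuousLinearMap.map_smul, hsymm w.1 a,
    ContinuousLinearMap.smulRightL_apply_apply]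
  simp
  module

section Solution

variable {L : E → (E × ℝ) →L[ℝ] (E × ℝ)}

theorem hasFDerivAt_apply_zero_one (hL : HasDarbouxDerivAt L (frameForm Γ h x) x) :
    HasFDerivAt (fun x ↦ L x (0, 1)) ((L x).comp (.inl ℝ E ℝ)) x := by
  refine (hasFDerivAt_clm_apply_const hL.hasFDerivAt (0, 1)).congr_fderiv
    (ContinuousLinearMap.ext fun a ↦ ?_)
  simp [frameForm_apply]

theorem frame_apply_zero_one (hL : HasDarbouxDerivAt L (frameForm Γ h x) x) :
    frame (fun x ↦ L x (0, 1)) x = L x := by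
  refine ContinuousLinearMap.ext fun w ↦ ?_
  rw [frame_apply, (hasFDerivAt_apply_zero_one hL).fderiv, ContinuousLinearMap.comp_apply,
    ← ContinuousLinearMap.map_smul, ← ContinuousLinearMap.map_add]
  simp

theorem chartGaussFormula_apply_zero_one (hsymm : ∀ a b, Γ x a b = Γ x b a)
    (hL : ∀ x, HasDarbouxDerivAt L (frameForm Γ h x) x) :
    ChartGaussFormula Γ h (fun x ↦ L x (0, 1)) x := by
  intro a b
  have hfderiv : fderiv ℝ (fun x ↦ L x (0, 1)) = fun x ↦ (L x).comp (.inl ℝ E ℝ) :=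
    funext fun x ↦ (hasFDerivAt_apply_zero_one (hL x)).fderiv
  have hfderiv₂ : HasFDerivAt (fun x ↦ (L x).comp (.inl ℝ E ℝ)) _ x :=
    ((ContinuousLinearMap.compL ℝ E (E × ℝ) (E × ℝ)).flip (.inl ℝ E ℝ)).hasFDerivAt.comp x
      (hL x).hasFDerivAt
  rw [hfderiv, hfderiv₂.fderiv]
  simp only [ContinuousLinearMap.comp_apply, ContinuousLinearMap.flip_apply,
    ContinuousLinearMap.compL_apply, ContinuousLinearMap.mul_apply', mul_apply_eq_comp,
    frameForm_apply, ContinuousLinearMap.inl_apply]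
  rw [← ContinuousLinearMap.map_smul, ← ContinuousLinearMap.map_sub, hsymm b a]
  simp

end Solution

end Frame

/-! ### Centroaffine maps -/

section CentroaffineMap

open Set Filter

variable {E : Type*} [NormedAddCommGroup E] [NormedSpace ℝ E]
  {M : Type*} [TopologicalSpace M] [ChartedSpace E M]
  {e : OpenPartialHomeomorph M E}
  {V W : Type*} [NormedAddCommGroup V] [NormedSpace ℝ V] [NormedAddCommGroup W] [NormedSpace ℝ W]
  {f g : M → V} {q : M}

theorem mvfderiv_congr_of_eventuallyEq (h : f =ᶠ[𝓝 q] g) :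
    mvfderiv 𝓘(ℝ, E) f q = mvfderiv 𝓘(ℝ, E) g q :=
  h.mfderiv_eq

theorem mvfderiv_clm_comp (T : V →L[ℝ] W) (hf : MDifferentiableAt 𝓘(ℝ, E) 𝓘(ℝ, V) f q)
    (v : TangentSpace 𝓘(ℝ, E) q) :
    mvfderiv 𝓘(ℝ, E) (fun p ↦ T (f p)) q v = T (mvfderiv 𝓘(ℝ, E) f q v) := by
  have h := mfderiv_comp q (T.differentiableAt (x := f q)).mdifferentiableAt hf
  rw [mfderiv_eq_fderiv, T.fderiv] at h
  exact congrArg (fun T ↦ T v) h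

/-- The frame `(w, s) ↦ df w + s f` of a hypersurface `f`. -/
def mframe (f : M → V) (q : M) : TangentSpace 𝓘(ℝ, E) q × ℝ →L[ℝ] V :=
  (mvfderiv 𝓘(ℝ, E) f q).coprod (ContinuousLinearMap.toSpanSingleton ℝ (f q))

theorem mframe_apply (f : M → V) (q : M) (w : TangentSpace 𝓘(ℝ, E) q × ℝ) :
    mframe f q w = mvfderiv 𝓘(ℝ, E) f q w.1 + w.2 • f q := rfl

theorem mframe_congr_of_eventuallyEq (h : f =ᶠ[𝓝 q] g) :
    (mframe f q : TangentSpace 𝓘(ℝ, E) q × ℝ →L[ℝ] V) = mframe g q := by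
  rw [mframe, mframe, mvfderiv_congr_of_eventuallyEq h, h.self_of_nhds]

theorem mframe_clm_comp (T : V →L[ℝ] W) (hf : MDifferentiableAt 𝓘(ℝ, E) 𝓘(ℝ, V) f q)
    (w : TangentSpace 𝓘(ℝ, E) q × ℝ) : mframe (fun p ↦ T (f p)) q w = T (mframe f q w) := by
  rw [mframe_apply, mframe_apply, mvfderiv_clm_comp T hf, map_add, map_smul]

theorem contDiffAt_comp_symm (he : e ∈ IsManifold.maximalAtlas 𝓘(ℝ, E) ∞ M)
    (hq : q ∈ e.source) (hf : ContMDiffAt 𝓘(ℝ, E) 𝓘(ℝ, V) ∞ f q) :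
    ContDiffAt ℝ ∞ (fun x ↦ f (e.symm x)) (e q) := by
  rw [← e.left_inv hq] at hf
  exact (ContMDiffAt.comp (e q) hf
    (contMDiffAt_symm_of_mem_maximalAtlas he (e.map_source hq))).contDiffAt

theorem mvfderiv_eq_fderiv (he : e ∈ IsManifold.maximalAtlas 𝓘(ℝ, E) ∞ M)
    (hq : q ∈ e.source) (hf : DifferentiableAt ℝ (fun x ↦ f (e.symm x)) (e q))
    (v : TangentSpace 𝓘(ℝ, E) q) :
    mvfderiv 𝓘(ℝ, E) f q v = fderiv ℝ (fun x ↦ f (e.symm x)) (e q) (chartDeriv e q v) := by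
  rw [← mvfderiv_comp_chart he hq hf]
  refine congrArg (fun T : TangentSpace 𝓘(ℝ, E) q →L[ℝ] V ↦ T v)
    (mvfderiv_congr_of_eventuallyEq ?_)
  filter_upwards [e.open_source.mem_nhds hq] with p hp
  simp [e.left_inv hp]

theorem mframe_eq_frame (he : e ∈ IsManifold.maximalAtlas 𝓘(ℝ, E) ∞ M)
    (hq : q ∈ e.source) (hf : DifferentiableAt ℝ (fun x ↦ f (e.symm x)) (e q))
    (w : TangentSpace 𝓘(ℝ, E) q × ℝ) :
    mframe f q w = frame (fun x ↦ f (e.symm x)) (e q) (chartDeriv e q w.1, w.2) := by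
  rw [mframe_apply, frame_apply, mvfderiv_eq_fderiv he hq hf, e.left_inv hq]

theorem eventuallyEq_mvfderiv_apply (he : e ∈ IsManifold.maximalAtlas 𝓘(ℝ, E) ∞ M)
    (hq : q ∈ e.source) (hf : ContMDiffAt 𝓘(ℝ, E) 𝓘(ℝ, V) ∞ f q)
    (Y : Π q : M, TangentSpace 𝓘(ℝ, E) q) :
    (fun p ↦ mvfderiv 𝓘(ℝ, E) f p (Y p)) =ᶠ[𝓝 q]
      fun p ↦ (fun x ↦ fderiv ℝ (fun x ↦ f (e.symm x)) x (chartRep e Y x)) (e p) := by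
  filter_upwards [(e.continuousAt hq).eventually
    (((contDiffAt_comp_symm he hq hf).of_le two_le_infty).eventually (by simp)),
    e.open_source.mem_nhds hq] with p hp hps
  rw [chartRep_apply hps]
  exact mvfderiv_eq_fderiv he hps (hp.differentiableAt (by simp)) (Y p)

variable [IsManifold 𝓘(ℝ, E) ∞ M]

/-- The Gauss formula at `q` of a hypersurface `f` with transversal its position vector, the induced
connection being `cov` and the second fundamental form `H`. -/
def GaussFormula (cov : AffineConnection 𝓘(ℝ, E) M)
    (H : Π q : M, TangentSpace 𝓘(ℝ, E) q → TangentSpace 𝓘(ℝ, E) q → ℝ) (f : M → V) (q : M) :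
    Prop :=
  ∀ Y : Π q : M, TangentSpace 𝓘(ℝ, E) q, CMDiffAt ∞ (T% Y) q → ∀ v,
    mvfderiv 𝓘(ℝ, E) (fun p ↦ mvfderiv 𝓘(ℝ, E) f p (Y p)) q v =
      mvfderiv 𝓘(ℝ, E) f q (cov Y q v) - H q v (Y q) • f q

/-- The map `f` is near `q` a hypersurface transversal to its position vector, inducing at `q` the
connection `cov` and the second fundamental form `H`. -/
structure IsCentroaffineMapAt (cov : AffineConnection 𝓘(ℝ, E) M)
    (H : Π q : M, TangentSpace 𝓘(ℝ, E) q → TangentSpace 𝓘(ℝ, E) q → ℝ) (f : M → V) (q : M) :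
    Prop where
  contMDiffAt : ContMDiffAt 𝓘(ℝ, E) 𝓘(ℝ, V) ∞ f q
  bijective : Function.Bijective (mframe f q : TangentSpace 𝓘(ℝ, E) q × ℝ →L[ℝ] V)
  gauss : GaussFormula cov H f q

variable {cov : AffineConnection 𝓘(ℝ, E) M}
  {H : Π q : M, TangentSpace 𝓘(ℝ, E) q → TangentSpace 𝓘(ℝ, E) q → ℝ}
  {Y : Π q : M, TangentSpace 𝓘(ℝ, E) q}

theorem IsCentroaffineMapAt.congr_of_eventuallyEq (hf : IsCentroaffineMapAt cov H f q)
    (h : g =ᶠ[𝓝 q] f) : IsCentroaffineMapAt cov H g q where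
  contMDiffAt := hf.contMDiffAt.congr_of_eventuallyEq h
  bijective := by
    rw [mframe_congr_of_eventuallyEq h]
    exact hf.bijective
  gauss Y hY v := by
    have hderiv : (fun p ↦ mvfderiv 𝓘(ℝ, E) g p (Y p)) =ᶠ[𝓝 q]
        fun p ↦ mvfderiv 𝓘(ℝ, E) f p (Y p) := by
      filter_upwards [h.eventually_nhds] with p hp
      rw [mvfderiv_congr_of_eventuallyEq hp]
    rw [mvfderiv_congr_of_eventuallyEq h, h.self_of_nhds, mvfderiv_congr_of_eventuallyEq hderiv,
      hf.gauss Y hY v]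

section Complete

variable [CompleteSpace E]

theorem hasFDerivAt_fderiv_chartRep (he : e ∈ IsManifold.maximalAtlas 𝓘(ℝ, E) ∞ M)
    (hq : q ∈ e.source) (hf : ContMDiffAt 𝓘(ℝ, E) 𝓘(ℝ, V) ∞ f q) (hY : CMDiffAt ∞ (T% Y) q) :
    HasFDerivAt (fun x ↦ fderiv ℝ (fun x ↦ f (e.symm x)) x (chartRep e Y x))
      ((fderiv ℝ (fun x ↦ f (e.symm x)) (e q)).comp (fderiv ℝ (chartRep e Y) (e q)) +
        (fderiv ℝ (fderiv ℝ fun x ↦ f (e.symm x)) (e q)).flip (chartRep e Y (e q))) (e q) := by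
  have hdf : DifferentiableAt ℝ (fderiv ℝ fun x ↦ f (e.symm x)) (e q) :=
    (((contDiffAt_comp_symm he hq hf).of_le two_le_infty).fderiv_right (m := 1)
      (by norm_num)).differentiableAt (by simp)
  exact hdf.hasFDerivAt.clm_apply
    ((contDiffAt_chartRep he hq hY).differentiableAt (by simp)).hasFDerivAt

theorem mdifferentiableAt_mvfderiv_apply (hf : ContMDiffAt 𝓘(ℝ, E) 𝓘(ℝ, V) ∞ f q)
    (hY : CMDiffAt ∞ (T% Y) q) :
    MDifferentiableAt 𝓘(ℝ, E) 𝓘(ℝ, V) (fun p ↦ mvfderiv 𝓘(ℝ, E) f p (Y p)) q := by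
  have he := IsManifold.chart_mem_maximalAtlas (I := 𝓘(ℝ, E)) (n := ∞) q
  have hq := mem_chart_source E q
  exact ((hasFDerivAt_fderiv_chartRep he hq hf hY).differentiableAt.mdifferentiableAt.comp q
    ((mdifferentiable_of_mem_maximalAtlas he).mdifferentiableAt hq)).congr_of_eventuallyEq
      (eventuallyEq_mvfderiv_apply he hq hf Y)

theorem mvfderiv_mvfderiv_apply (he : e ∈ IsManifold.maximalAtlas 𝓘(ℝ, E) ∞ M)
    (hq : q ∈ e.source) (hf : ContMDiffAt 𝓘(ℝ, E) 𝓘(ℝ, V) ∞ f q) (hY : CMDiffAt ∞ (T% Y) q)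
    (v : TangentSpace 𝓘(ℝ, E) q) :
    mvfderiv 𝓘(ℝ, E) (fun p ↦ mvfderiv 𝓘(ℝ, E) f p (Y p)) q v =
      fderiv ℝ (fderiv ℝ fun x ↦ f (e.symm x)) (e q) (chartDeriv e q v) (chartDeriv e q (Y q)) +
      fderiv ℝ (fun x ↦ f (e.symm x)) (e q)
        (fderiv ℝ (chartRep e Y) (e q) (chartDeriv e q v)) := by
  have hderiv := hasFDerivAt_fderiv_chartRep he hq hf hY
  rw [mvfderiv_congr_of_eventuallyEq (eventuallyEq_mvfderiv_apply he hq hf Y),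
    mvfderiv_comp_chart he hq hderiv.differentiableAt, hderiv.fderiv, ← chartRep_apply hq Y]
  simp only [add_apply, ContinuousLinearMap.comp_apply, ContinuousLinearMap.flip_apply]
  rw [add_comm]

theorem IsCentroaffineMapAt.clm_comp (hf : IsCentroaffineMapAt cov H f q) (T : V ≃L[ℝ] W) :
    IsCentroaffineMapAt cov H (fun p ↦ T (f p)) q where
  contMDiffAt := T.contDiff.contMDiff.contMDiffAt.comp q hf.contMDiffAt
  bijective := by
    have hT : ⇑(mframe (fun p ↦ T (f p)) q : TangentSpace 𝓘(ℝ, E) q × ℝ →L[ℝ] W) =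
        T ∘ mframe f q :=
      funext (mframe_clm_comp (T : V →L[ℝ] W) (hf.contMDiffAt.mdifferentiableAt (by simp)))
    rw [hT]
    exact T.bijective.comp hf.bijective
  gauss Y hY v := by
    have hderiv : (fun p ↦ mvfderiv 𝓘(ℝ, E) (fun p ↦ T (f p)) p (Y p)) =ᶠ[𝓝 q]
        fun p ↦ T (mvfderiv 𝓘(ℝ, E) f p (Y p)) := by
      filter_upwards [(contMDiffAt_iff_contMDiffAt_nhds (n := 1) (by simp)).1
        (hf.contMDiffAt.of_le (by simp))] with p hp
      exact mvfderiv_clm_comp (T : V →L[ℝ] W) (hp.mdifferentiableAt (by simp)) (Y p)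
    have hf' := mvfderiv_clm_comp (T : V →L[ℝ] W) (hf.contMDiffAt.mdifferentiableAt (by simp))
    have hf'' := mvfderiv_clm_comp (T : V →L[ℝ] W)
      (mdifferentiableAt_mvfderiv_apply hf.contMDiffAt hY)
    simp only [ContinuousLinearEquiv.coe_coe] at hf' hf''
    rw [mvfderiv_congr_of_eventuallyEq hderiv, hf'', hf.gauss Y hY, hf', map_sub, map_smul]

end Complete

variable [FiniteDimensional ℝ E]

theorem gaussFormula_iff (he : e ∈ IsManifold.maximalAtlas 𝓘(ℝ, E) ∞ M)
    (hq : q ∈ e.source) (hf : ContMDiffAt 𝓘(ℝ, E) 𝓘(ℝ, V) ∞ f q)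
    {h : E → E →L[ℝ] E →L[ℝ] ℝ}
    (hh : ∀ v w, h (e q) (chartDeriv e q v) (chartDeriv e q w) = H q v w) :
    GaussFormula cov H f q ↔
      ChartGaussFormula (christoffel cov e) h (fun x ↦ f (e.symm x)) (e q) := by
  have hfd : DifferentiableAt ℝ (fun x ↦ f (e.symm x)) (e q) :=
    (contDiffAt_comp_symm he hq hf).differentiableAt (by simp)
  have formula_iff {Y : Π q : M, TangentSpace 𝓘(ℝ, E) q} (hY : CMDiffAt ∞ (T% Y) q)
      (v : TangentSpace 𝓘(ℝ, E) q) :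
      mvfderiv 𝓘(ℝ, E) (fun p ↦ mvfderiv 𝓘(ℝ, E) f p (Y p)) q v =
        mvfderiv 𝓘(ℝ, E) f q (cov Y q v) - H q v (Y q) • f q ↔
      fderiv ℝ (fderiv ℝ fun x ↦ f (e.symm x)) (e q) (chartDeriv e q v) (chartDeriv e q (Y q)) =
        fderiv ℝ (fun x ↦ f (e.symm x)) (e q)
          (christoffel cov e (e q) (chartDeriv e q (Y q)) (chartDeriv e q v)) -
        h (e q) (chartDeriv e q v) (chartDeriv e q (Y q)) • f (e.symm (e q)) := by
    rw [mvfderiv_mvfderiv_apply he hq hf hY, mvfderiv_eq_fderiv he hq hfd,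
      chartDeriv_cov he cov hq ((contDiffAt_chartRep he hq hY).differentiableAt (by simp)),
      ContinuousLinearMap.map_add, hh, e.left_inv hq, add_comm, add_sub_assoc, add_right_inj]
  refine ⟨fun hY a b ↦ ?_, fun hF Y hY v ↦ (formula_iff hY v).2 (hF _ _)⟩
  have hb := contMDiffAt_chartField he hq (contDiffAt_const (c := b))
  have hab := (formula_iff hb (chartInv e q a)).1 (hY _ hb _)
  rwa [chartDeriv_chartField he hq, chartDeriv_chartInv he hq] at hab

end CentroaffineMap

/-! ### Existence of centroaffine maps -/

section CentroaffineExistence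

open Set Filter

theorem exists_continuousLinearEquiv_apply_eq {V W X : Type*} [NormedAddCommGroup V]
    [NormedSpace ℝ V] [FiniteDimensional ℝ V] [NormedAddCommGroup W] [NormedSpace ℝ W]
    [AddCommGroup X] [Module ℝ X] {A : X →ₗ[ℝ] V} {B : X →ₗ[ℝ] W}
    (hA : Function.Bijective A) (hB : Function.Bijective B) :
    ∃ T : V ≃L[ℝ] W, ∀ x, T (A x) = B x :=
  ⟨((LinearEquiv.ofBijective A hA).symm.trans (.ofBijective B hB)).toContinuousLinearEquiv,
    fun x ↦ congrArg B ((LinearEquiv.ofBijective A hA).symm_apply_apply x)⟩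

variable {E : Type*} [NormedAddCommGroup E] [NormedSpace ℝ E] [FiniteDimensional ℝ E]
  {M : Type*} [TopologicalSpace M] [ChartedSpace E M] [IsManifold 𝓘(ℝ, E) ∞ M]
  {e : OpenPartialHomeomorph M E}
  {cov : AffineConnection 𝓘(ℝ, E) M}
  {H : Π q : M, TangentSpace 𝓘(ℝ, E) q → TangentSpace 𝓘(ℝ, E) q → ℝ}

theorem exists_isCentroaffineMapAt_of_target_eq_univ (hc : IsCentroaffine cov H)
    (he : e ∈ IsManifold.maximalAtlas 𝓘(ℝ, E) ∞ M) (ht : e.target = univ) :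
    ∃ f : M → E × ℝ, ∀ q ∈ e.source, IsCentroaffineMapAt cov H f q := by
  obtain ⟨h, hΓ, hh, hH, hce⟩ := hc e he
  have hB : ContDiff ℝ ∞ (frameForm (christoffel cov e) h) := by
    rw [← contDiffOn_univ, ← ht]
    exact contDiffOn_frameForm hΓ hh
  rw [ht] at hce
  rw [ht, contDiffOn_univ] at hΓ hh
  have hmc : IsMaurerCartan (frameForm (christoffel cov e) h) :=
    isMaurerCartan_frameForm (hΓ.differentiable (by simp)) (hh.differentiable (by simp))
      fun x ↦ hce x trivial
  obtain ⟨L, hL₀, hL⟩ := hmc.exists_hasDarbouxDerivAt (hB.of_le two_le_infty) 0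
  let F : E → E × ℝ := fun x ↦ L x (0, 1)
  have hF : ContDiff ℝ ∞ F := (HasDarbouxDerivAt.contDiff hL hB).clm_apply contDiff_const
  have hF_symm : (fun x ↦ F (e (e.symm x))) = F :=
    funext fun x ↦ congrArg F (e.right_inv (ht ▸ mem_univ x))
  refine ⟨fun p ↦ F (e p), fun q hq ↦ ?_⟩
  have hf : ContMDiffAt 𝓘(ℝ, E) 𝓘(ℝ, E × ℝ) ∞ (fun p ↦ F (e p)) q :=
    hF.contDiffAt.contMDiffAt.comp q (contMDiffAt_of_mem_maximalAtlas he hq)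
  have hframe : ⇑(mframe (fun p ↦ F (e p)) q : TangentSpace 𝓘(ℝ, E) q × ℝ →L[ℝ] E × ℝ) =
      L (e q) ∘ Prod.map (chartDerivEquiv he hq) id := by
    ext1 w
    rw [mframe_eq_frame he hq (hF_symm.symm ▸ hF.differentiable (by simp) (e q)), hF_symm,
      frame_apply_zero_one (hL _)]
    rfl
  refine ⟨hf, ?_, (gaussFormula_iff he hq hf (hH q hq)).2 ?_⟩
  · rw [hframe]
    exact (ContinuousLinearMap.isUnit_iff_bijective.1
      (hmc.isUnit (hB.of_le two_le_infty) hL₀ hL _)).comp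
        ((chartDerivEquiv he hq).bijective.prodMap Function.bijective_id)
  · rw [hF_symm]
    exact chartGaussFormula_apply_zero_one (hce _ trivial).christoffel_symm hL

theorem IsCentroaffineMapAt.hasDarbouxDerivAt_frame {f : M → E × ℝ}
    {h : E → E →L[ℝ] E →L[ℝ] ℝ} {q : M} (hf : IsCentroaffineMapAt cov H f q)
    (he : e ∈ IsManifold.maximalAtlas 𝓘(ℝ, E) ∞ M) (hq : q ∈ e.source)
    (hsymm : ∀ a b, christoffel cov e (e q) a b = christoffel cov e (e q) b a)
    (hh : ∀ v w, h (e q) (chartDeriv e q v) (chartDeriv e q w) = H q v w) :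
    HasDarbouxDerivAt (frame fun x ↦ f (e.symm x)) (frameForm (christoffel cov e) h (e q))
      (e q) :=
  StatGeom.hasDarbouxDerivAt_frame hsymm
    ((contDiffAt_comp_symm he hq hf.contMDiffAt).of_le two_le_infty)
    ((gaussFormula_iff he hq hf.contMDiffAt hh).1 hf.gauss)

theorem eqOn_of_mframe_eq (hc : IsCentroaffine cov H)
    (he : e ∈ IsManifold.maximalAtlas 𝓘(ℝ, E) ∞ M) {f g : M → E × ℝ} {U : Set M}
    (hU : IsOpen U) (hU' : IsPreconnected U) (hUe : U ⊆ e.source)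
    (hf : ∀ q ∈ U, IsCentroaffineMapAt cov H f q) (hg : ∀ q ∈ U, IsCentroaffineMapAt cov H g q)
    {q₀ : M} (hq₀ : q₀ ∈ U)
    (h₀ : (mframe f q₀ : TangentSpace 𝓘(ℝ, E) q₀ × ℝ →L[ℝ] E × ℝ) = mframe g q₀) :
    EqOn f g U := by
  obtain ⟨h, hΓ, hh, hH, hce⟩ := hc e he
  have darboux {f : M → E × ℝ} (hf : ∀ q ∈ U, IsCentroaffineMapAt cov H f q) :
      ∀ x ∈ e '' U, HasDarbouxDerivAt (frame fun x ↦ f (e.symm x))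
        (frameForm (christoffel cov e) h x) x := by
    rintro _ ⟨q, hq, rfl⟩
    exact (hf q hq).hasDarbouxDerivAt_frame he (hUe hq)
      (hce _ (e.map_source (hUe hq))).christoffel_symm (hH q (hUe hq))
  have frame_chartDeriv {f : M → E × ℝ} (hf : ∀ q ∈ U, IsCentroaffineMapAt cov H f q)
      (w : E × ℝ) :
      frame (fun x ↦ f (e.symm x)) (e q₀) w = mframe f q₀ (chartInv e q₀ w.1, w.2) := by
    rw [mframe_eq_frame he (hUe hq₀) ((contDiffAt_comp_symm he (hUe hq₀)
      (hf q₀ hq₀).contMDiffAt).differentiableAt (by simp)), chartDeriv_chartInv he (hUe hq₀)]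
  have hframe : EqOn (frame fun x ↦ f (e.symm x)) (frame fun x ↦ g (e.symm x)) (e '' U) := by
    refine HasDarbouxDerivAt.eqOn (e.isOpen_image_of_subset_source hU hUe)
      (hU'.image e (e.continuousOn.mono hUe))
      ((contDiffOn_frameForm hΓ hh).continuousOn.mono ?_) (darboux hf) (darboux hg)
      (mem_image_of_mem e hq₀) (ContinuousLinearMap.ext fun w ↦ ?_)
    · exact (image_mono hUe).trans e.image_source_eq_target.subset
    · rw [frame_chartDeriv hf, frame_chartDeriv hg, h₀]
  intro q hq
  have hq' := congrArg (fun T ↦ T ((0 : E), (1 : ℝ))) (hframe (mem_image_of_mem e hq))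
  simpa [frame_apply, e.left_inv (hUe hq)] using hq'

theorem exists_isCentroaffineMapAt (hc : IsCentroaffine cov H) {e₁ e₂ : OpenPartialHomeomorph M E}
    (he₁ : e₁ ∈ IsManifold.maximalAtlas 𝓘(ℝ, E) ∞ M) (ht₁ : e₁.target = univ)
    (he₂ : e₂ ∈ IsManifold.maximalAtlas 𝓘(ℝ, E) ∞ M) (ht₂ : e₂.target = univ)
    (hcover : e₁.source ∪ e₂.source = univ) (hconn : IsConnected (e₁.source ∩ e₂.source)) :
    ∃ f : M → E × ℝ, ∀ q, IsCentroaffineMapAt cov H f q := by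
  classical
  obtain ⟨f, hf⟩ := exists_isCentroaffineMapAt_of_target_eq_univ hc he₁ ht₁
  obtain ⟨g, hg⟩ := exists_isCentroaffineMapAt_of_target_eq_univ hc he₂ ht₂
  obtain ⟨q, hq₁, hq₂⟩ := hconn.nonempty
  obtain ⟨T, hT⟩ := exists_continuousLinearEquiv_apply_eq (hg q hq₂).bijective
    (hf q hq₁).bijective
  have hTg (p) (hp : p ∈ e₂.source) : IsCentroaffineMapAt cov H (fun p ↦ T (g p)) p :=
    (hg p hp).clm_comp T
  have hfg : EqOn f (fun p ↦ T (g p)) (e₁.source ∩ e₂.source) := by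
    refine eqOn_of_mframe_eq hc he₁ (e₁.open_source.inter e₂.open_source) hconn.isPreconnected
      inter_subset_left (fun p hp ↦ hf p hp.1) (fun p hp ↦ hTg p hp.2) ⟨hq₁, hq₂⟩
      (ContinuousLinearMap.ext fun w ↦ ?_)
    exact (hT w).symm.trans (mframe_clm_comp (T : E × ℝ →L[ℝ] E × ℝ)
      ((hg q hq₂).contMDiffAt.mdifferentiableAt (by simp)) w).symm
  refine ⟨e₁.source.piecewise f fun p ↦ T (g p), fun p ↦ ?_⟩
  by_cases hp : p ∈ e₁.source
  · exact (hf p hp).congr_of_eventuallyEq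
      ((piecewise_eqOn _ _ _).eventuallyEq_of_mem (e₁.open_source.mem_nhds hp))
  · have hp₂ : p ∈ e₂.source := (hcover.symm.subset (mem_univ p)).resolve_left hp
    refine (hTg p hp₂).congr_of_eventuallyEq ?_
    filter_upwards [e₂.open_source.mem_nhds hp₂] with r hr
    by_cases hr₁ : r ∈ e₁.source
    · rw [piecewise_eq_of_mem _ _ _ hr₁, hfg ⟨hr₁, hr⟩]
    · rw [piecewise_eq_of_notMem _ _ _ hr₁]

end CentroaffineExistence

/-! ### Twisted spheres -/

section TwoCells

open Set

/-- `M` is the union of two open cells (charts onto the model space) with connected intersection.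
Spheres and, more generally, twisted spheres of dimension at least two have this property. -/
def IsCoveredByTwoCells (E : Type*) [NormedAddCommGroup E] [NormedSpace ℝ E] (M : Type*)
    [TopologicalSpace M] [ChartedSpace E M] : Prop :=
  ∃ e₁ ∈ IsManifold.maximalAtlas 𝓘(ℝ, E) ∞ M, ∃ e₂ ∈ IsManifold.maximalAtlas 𝓘(ℝ, E) ∞ M,
    e₁.target = univ ∧ e₂.target = univ ∧ e₁.source ∪ e₂.source = univ ∧
      IsConnected (e₁.source ∩ e₂.source)

theorem isConnected_source_sdiff_singleton {X E : Type*} [TopologicalSpace X]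
    [AddCommGroup E] [TopologicalSpace E] [Module ℝ E] [ContinuousAdd E] [ContinuousSMul ℝ E]
    (hE : 1 < Module.rank ℝ E) {e : OpenPartialHomeomorph X E} (ht : e.target = univ) {p : X}
    (hp : p ∈ e.source) : IsConnected (e.source \ {p}) := by
  have himage : e.symm '' {e p}ᶜ = e.source \ {p} := by
    ext q
    refine ⟨?_, fun hq ↦ ⟨e q, mt (e.injOn hq.1 hp) hq.2, e.left_inv hq.1⟩⟩
    rintro ⟨x, hx, rfl⟩
    have hx' : x ∈ e.target := ht ▸ mem_univ x
    refine ⟨e.map_target hx', fun h ↦ hx ?_⟩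
    rw [← mem_singleton_iff.1 h, e.right_inv hx']
    rfl
  rw [← himage]
  exact (isConnected_compl_singleton_of_one_lt_rank hE _).image _
    (e.continuousOn_symm.mono (by simp [ht]))

theorem isCoveredByTwoCells_of_diffeomorph_sphere {n : ℕ} (hn : 2 ≤ n) {M : Type*}
    [TopologicalSpace M] [ChartedSpace (EuclideanSpace ℝ (Fin n)) M] [IsManifold (𝓡 n) ∞ M]
    (Φ : M ≃ₘ⟮𝓡 n, 𝓡 n⟯ Metric.sphere (0 : EuclideanSpace ℝ (Fin (n + 1))) 1) :
    IsCoveredByTwoCells (EuclideanSpace ℝ (Fin n)) M := by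
  have : Fact (Module.finrank ℝ (EuclideanSpace ℝ (Fin (n + 1))) = n + 1) :=
    ⟨finrank_euclideanSpace_fin⟩
  let e (v : Metric.sphere (0 : EuclideanSpace ℝ (Fin (n + 1))) 1) :=
    Φ.toHomeomorph.toOpenPartialHomeomorph ≫ₕ stereographic' n v
  have source_e (v) : (e v).source = {Φ.symm v}ᶜ := by
    ext q
    simpa [e] using not_congr Φ.toEquiv.eq_symm_apply.symm
  have target_e (v) : (e v).target = univ := by simp [e]
  have e_mem_maximalAtlas (v) : e v ∈ IsManifold.maximalAtlas (𝓡 n) ∞ M := by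
    have hv : stereographic' n v ∈ IsManifold.maximalAtlas (𝓡 n) ∞ _ :=
      IsManifold.subset_maximalAtlas ⟨v, rfl⟩
    refine OpenPartialHomeomorph.mem_maximalAtlas_of_contMDiffOn _ ?_ ?_
    · exact (contMDiffOn_of_mem_maximalAtlas hv).comp Φ.contMDiff.contMDiffOn
        fun q hq ↦ by simpa [e] using hq
    · exact Φ.symm.contMDiff.comp_contMDiffOn
        ((contMDiffOn_symm_of_mem_maximalAtlas hv).mono (by simp))
  obtain ⟨v⟩ : Nonempty (Metric.sphere (0 : EuclideanSpace ℝ (Fin (n + 1))) 1) :=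
    (NormedSpace.sphere_nonempty.2 zero_le_one).to_subtype
  have hv : Φ.symm (-v) ≠ Φ.symm v := Φ.symm.injective.ne (ne_neg_of_mem_unit_sphere ℝ v).symm
  refine ⟨e v, e_mem_maximalAtlas v, e (-v), e_mem_maximalAtlas (-v), target_e v, target_e (-v),
    ?_, ?_⟩
  · rw [source_e, source_e, ← compl_inter, singleton_inter_eq_empty.2 (by simpa using hv.symm),
      compl_empty]
  · rw [source_e (-v), ← sdiff_eq]
    refine isConnected_source_sdiff_singleton ?_ (target_e v) (by simp [source_e, hv])
    rw [← Module.finrank_eq_rank, finrank_euclideanSpace_fin]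
    exact_mod_cast hn

end TwoCells

/-! ### Vector fields on compact manifolds -/

section Flow

open Set Filter

theorem exists_eventually_exists_hasDerivAt {E : Type*} [NormedAddCommGroup E] [NormedSpace ℝ E]
    [CompleteSpace E] {X : E → E} {x₀ : E} (hX : ContDiffAt ℝ 1 X x₀) {U : Set E} (hU : U ∈ 𝓝 x₀) :
    ∃ ε > 0, ∀ᶠ x in 𝓝 x₀, ∃ y : ℝ → E, y 0 = x ∧
      ∀ t ∈ Ioo (-ε) ε, y t ∈ U ∧ HasDerivAt y (X (y t)) t := by
  obtain ⟨ε, hε, _, r, _, _, hr, hpl⟩ := IsPicardLindelof.of_contDiffAt_one hX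
  obtain ⟨α, hα, hαc⟩ := (hpl 0).exists_forall_mem_closedBall_eq_hasDerivWithinAt_continuousOn
  simp only [zero_sub, zero_add] at hα hαc
  have hball : Metric.closedBall x₀ r ∈ 𝓝 x₀ := Metric.closedBall_mem_nhds x₀ hr
  have hcont : ContinuousAt α (x₀, 0) :=
    hαc.continuousAt (prod_mem_nhds hball (Icc_mem_nhds (neg_lt_zero.2 hε) hε))
  have hmem : ∀ᶠ z in 𝓝 x₀ ×ˢ 𝓝 (0 : ℝ), α z ∈ U := by
    rw [← nhds_prod_eq]
    exact hcont ((hα x₀ (Metric.mem_closedBall_self r.2)).1.symm ▸ hU)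
  obtain ⟨A, hA, B, hB, hAB⟩ := eventually_prod_iff.1 hmem
  obtain ⟨δ, hδ, hδB⟩ := Metric.eventually_nhds_iff.1 hB
  refine ⟨min δ ε, lt_min hδ hε, ?_⟩
  filter_upwards [hA, hball] with x hxA hx
  refine ⟨fun t ↦ α (x, t), (hα x hx).1, fun t ht ↦ ⟨hAB hxA (hδB ?_), ?_⟩⟩
  · rw [Real.dist_0_eq_abs, abs_lt]
    exact ⟨(neg_le_neg (min_le_left _ _)).trans_lt ht.1, ht.2.trans_le (min_le_left _ _)⟩
  · have ht' : -ε < t ∧ t < ε :=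
      ⟨(neg_le_neg (min_le_right _ _)).trans_lt ht.1, ht.2.trans_le (min_le_right _ _)⟩
    exact ((hα x hx).2 t ⟨ht'.1.le, ht'.2.le⟩).hasDerivAt (Icc_mem_nhds ht'.1 ht'.2)

variable {E : Type*} [NormedAddCommGroup E] [NormedSpace ℝ E]
  {M : Type*} [TopologicalSpace M] [ChartedSpace E M]
  {e : OpenPartialHomeomorph M E} {W : Π q : M, TangentSpace 𝓘(ℝ, E) q}

theorem hasDerivAt_comp_of_hasMFDerivAt {V : Type*} [NormedAddCommGroup V] [NormedSpace ℝ V]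
    {f : M → V} {γ : ℝ → M} {t : ℝ} {v : TangentSpace 𝓘(ℝ, E) (γ t)}
    (hf : MDifferentiableAt 𝓘(ℝ, E) 𝓘(ℝ, V) f (γ t))
    (hγ : HasMFDerivAt 𝓘(ℝ, ℝ) 𝓘(ℝ, E) γ t ((1 : ℝ →L[ℝ] ℝ).smulRight v)) :
    HasDerivAt (fun s ↦ f (γ s)) (mvfderiv 𝓘(ℝ, E) f (γ t) v) t := by
  have hcomp : HasFDerivAt (fun s ↦ f (γ s))
      ((mvfderiv 𝓘(ℝ, E) f (γ t)).comp ((1 : ℝ →L[ℝ] ℝ).smulRight v)) t :=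
    hasMFDerivAt_iff_hasFDerivAt.1 (hf.hasMFDerivAt.comp t hγ)
  simpa using hcomp.hasDerivAt

theorem hasDerivAt_chart_comp (he : e ∈ IsManifold.maximalAtlas 𝓘(ℝ, E) ∞ M) {γ : ℝ → M} {t : ℝ}
    (ht : γ t ∈ e.source) {v : TangentSpace 𝓘(ℝ, E) (γ t)}
    (hγ : HasMFDerivAt 𝓘(ℝ, ℝ) 𝓘(ℝ, E) γ t ((1 : ℝ →L[ℝ] ℝ).smulRight v)) :
    HasDerivAt (fun s ↦ e (γ s)) (chartDeriv e (γ t) v) t :=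
  hasDerivAt_comp_of_hasMFDerivAt ((mdifferentiable_of_mem_maximalAtlas he).mdifferentiableAt ht)
    hγ

theorem hasMFDerivAt_symm_comp (he : e ∈ IsManifold.maximalAtlas 𝓘(ℝ, E) ∞ M) {y : ℝ → E} {t : ℝ}
    (ht : y t ∈ e.target) (hy : HasDerivAt y (chartRep e W (y t)) t) :
    HasMFDerivAt 𝓘(ℝ, ℝ) 𝓘(ℝ, E) (fun s ↦ e.symm (y s)) t
      ((1 : ℝ →L[ℝ] ℝ).smulRight (W (e.symm (y t)))) := by
  have hd := mdifferentiable_of_mem_maximalAtlas he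
  refine ((hd.mdifferentiableAt_symm ht).hasMFDerivAt.comp t
    hy.hasFDerivAt.hasMFDerivAt).congr_mfderiv (ContinuousLinearMap.ext fun (r : ℝ) ↦ ?_)
  have hinv := hd.symm_comp_deriv (e.map_target ht)
  rw [e.right_inv ht] at hinv
  exact (ContinuousLinearMap.map_smul (mfderiv 𝓘(ℝ, E) 𝓘(ℝ, E) e.symm (y t)) r
    (chartRep (E := E) e W (y t))).trans
    (congrArg (fun T ↦ r • T (W (e.symm (y t)))) hinv)

variable [IsManifold 𝓘(ℝ, E) ∞ M] [CompleteSpace E]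

theorem exists_eventually_exists_isMIntegralCurveOn {q : M} (hW : CMDiffAt ∞ (T% W) q) :
    ∃ ε > 0, ∀ᶠ p in 𝓝 q, ∃ γ : ℝ → M, γ 0 = p ∧ IsMIntegralCurveOn γ W (Ioo (-ε) ε) := by
  set e := chartAt E q
  have he : e ∈ IsManifold.maximalAtlas 𝓘(ℝ, E) ∞ M := IsManifold.chart_mem_maximalAtlas q
  have hq : q ∈ e.source := mem_chart_source E q
  obtain ⟨ε, hε, h⟩ := exists_eventually_exists_hasDerivAt
    ((contDiffAt_chartRep he hq hW).of_le (by simp)) (e.open_target.mem_nhds (e.map_source hq))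
  refine ⟨ε, hε, ?_⟩
  filter_upwards [e.open_source.mem_nhds hq, (e.continuousAt hq).eventually h]
  rintro p hp ⟨y, hy₀, hy⟩
  exact ⟨fun s ↦ e.symm (y s), by simp [hy₀, e.left_inv hp], fun t ht ↦
    (hasMFDerivAt_symm_comp he (hy t ht).1 (hy t ht).2).hasMFDerivWithinAt⟩

theorem exists_isMIntegralCurve_of_compactSpace [T2Space M] [CompactSpace M]
    (hW : CMDiff ∞ (T% W)) (p : M) : ∃ γ : ℝ → M, γ 0 = p ∧ IsMIntegralCurve γ W := by
  have : IsManifold 𝓘(ℝ, E) 1 M := IsManifold.of_le (n := ∞) (by simp)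
  obtain ⟨ε, hε, h⟩ : ∃ ε > 0, ∀ p ∈ (univ : Set M), ∃ γ : ℝ → M, γ 0 = p ∧
      IsMIntegralCurveOn γ W (Ioo (-ε) ε) := by
    refine isCompact_univ.induction_on ⟨1, one_pos, by simp⟩
      (fun s t hst ⟨ε, hε, h⟩ ↦ ⟨ε, hε, fun p hp ↦ h p (hst hp)⟩) ?_ fun q _ ↦ ?_
    · rintro s t ⟨ε, hε, hs⟩ ⟨δ, hδ, ht⟩
      refine ⟨min ε δ, lt_min hε hδ, fun p hp ↦ ?_⟩
      have shrink {η : ℝ} (hη : min ε δ ≤ η) : (∃ γ : ℝ → M, γ 0 = p ∧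
          IsMIntegralCurveOn γ W (Ioo (-η) η)) → ∃ γ : ℝ → M, γ 0 = p ∧
          IsMIntegralCurveOn γ W (Ioo (-min ε δ) (min ε δ)) :=
        fun ⟨γ, hγ₀, hγ⟩ ↦ ⟨γ, hγ₀, hγ.mono (Ioo_subset_Ioo (neg_le_neg hη) hη)⟩
      exact hp.elim (fun hp ↦ shrink (min_le_left _ _) (hs p hp))
        fun hp ↦ shrink (min_le_right _ _) (ht p hp)
    · obtain ⟨ε, hε, h⟩ := exists_eventually_exists_isMIntegralCurveOn (hW q)
      exact ⟨_, mem_nhdsWithin_of_mem_nhds h, ε, hε, fun p hp ↦ hp⟩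
  exact exists_isMIntegralCurve_of_isMIntegralCurveOn (hW.of_le (by simp)) hε
    (fun x ↦ h x (mem_univ x)) p

theorem contMDiff_of_isMIntegralCurve (hW : CMDiff ∞ (T% W)) {γ : ℝ → M}
    (hγ : IsMIntegralCurve γ W) : ContMDiff 𝓘(ℝ, ℝ) 𝓘(ℝ, E) ∞ γ := by
  intro t₀
  set e := chartAt E (γ t₀)
  have he : e ∈ IsManifold.maximalAtlas 𝓘(ℝ, E) ∞ M := IsManifold.chart_mem_maximalAtlas _
  have hsource : γ ⁻¹' e.source ∈ 𝓝 t₀ :=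
    hγ.continuous.continuousAt.preimage_mem_nhds (chart_source_mem_nhds E (γ t₀))
  obtain ⟨ε, hε, hball⟩ := Metric.nhds_basis_closedBall.mem_iff.1 hsource
  rw [Real.closedBall_eq_Icc] at hball
  have hderiv : ∀ t ∈ Icc (t₀ - ε) (t₀ + ε), HasDerivWithinAt (fun s ↦ e (γ s))
      (chartRep e W (e (γ t))) (Icc (t₀ - ε) (t₀ + ε)) t := fun t ht ↦ by
    rw [chartRep_apply (hball ht)]
    exact (hasDerivAt_chart_comp he (hball ht) (hγ t)).hasDerivWithinAt
  have hrep : ContDiffOn ℝ ∞ (chartRep e W) e.target := fun x hx ↦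
    (e.right_inv hx ▸ contDiffAt_chartRep he (e.map_target hx) (hW _)).contDiffWithinAt
  have hsmooth : ContDiffOn ℝ ∞ (fun s ↦ e (γ s)) (Icc (t₀ - ε) (t₀ + ε)) :=
    ODE.contDiffOn_enat_Icc_of_hasDerivWithinAt (f := fun _ ↦ chartRep e W)
      (hrep.comp contDiffOn_snd fun z hz ↦ hz.2) hderiv fun t ht ↦ e.map_source (hball ht)
  have hsmoothAt : ContDiffAt ℝ ∞ (fun s ↦ e (γ s)) t₀ :=
    hsmooth.contDiffAt (Icc_mem_nhds (by linarith) (by linarith))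
  refine ((contMDiffAt_symm_of_mem_maximalAtlas he (e.map_source (mem_chart_source E _))).comp t₀
    hsmoothAt.contMDiffAt).congr_of_eventuallyEq ?_
  filter_upwards [hsource] with t ht
  exact (e.left_inv ht).symm

end Flow

/-! ### Geodesics of a centroaffine connection -/

section Geodesic

open Filter

theorem deriv_deriv_comp {E V : Type*} [NormedAddCommGroup E] [NormedSpace ℝ E]
    [NormedAddCommGroup V] [NormedSpace ℝ V] {F : E → V} {y : ℝ → E} {t : ℝ}
    (hF : ContDiffAt ℝ 2 F (y t)) (hy : ContDiffAt ℝ 2 y t) :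
    deriv (deriv fun s ↦ F (y s)) t = fderiv ℝ (fderiv ℝ F) (y t) (deriv y t) (deriv y t) +
      fderiv ℝ F (y t) (deriv (deriv y) t) := by
  have hcomp : deriv (fun s ↦ F (y s)) =ᶠ[𝓝 t] fun s ↦ fderiv ℝ F (y s) (deriv y s) := by
    filter_upwards [hy.eventually (by simp),
      hy.continuousAt.eventually (hF.eventually (by simp))] with s hys hFs
    exact ((hFs.differentiableAt (by simp)).hasFDerivAt.comp_hasDerivAt s
      (hys.differentiableAt (by simp)).hasDerivAt).deriv
  have hfderiv : HasDerivAt (fun s ↦ fderiv ℝ F (y s))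
      (fderiv ℝ (fderiv ℝ F) (y t) (deriv y t)) t :=
    ((hF.fderiv_right (m := 1) (by norm_num)).differentiableAt
      (by simp)).hasFDerivAt.comp_hasDerivAt t (hy.differentiableAt (by simp)).hasDerivAt
  have hderiv : DifferentiableAt ℝ (deriv y) t := by
    have := (hy.fderiv_right (m := 1) (by norm_num)).differentiableAt (by simp)
    exact (this.clm_apply (differentiableAt_const (1 : ℝ))).congr_of_eventuallyEq (by simp)
  rw [hcomp.deriv_eq]
  exact (hfderiv.clm_apply hderiv.hasDerivAt).deriv

variable {E : Type*} [NormedAddCommGroup E] [NormedSpace ℝ E]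
  {M : Type*} [TopologicalSpace M] [ChartedSpace E M] {γ : ℝ → M} {t : ℝ}

theorem velocity_eq_of_hasMFDerivAt {v : TangentSpace 𝓘(ℝ, E) (γ t)}
    (hγ : HasMFDerivAt 𝓘(ℝ, ℝ) 𝓘(ℝ, E) γ t ((1 : ℝ →L[ℝ] ℝ).smulRight v)) :
    velocity 𝓘(ℝ, E) γ t = v := by
  rw [velocity, hγ.mfderiv]
  exact one_smul ℝ v

theorem hasMFDerivAt_velocity (hγ : MDifferentiableAt 𝓘(ℝ, ℝ) 𝓘(ℝ, E) γ t) :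
    HasMFDerivAt 𝓘(ℝ, ℝ) 𝓘(ℝ, E) γ t ((1 : ℝ →L[ℝ] ℝ).smulRight (velocity 𝓘(ℝ, E) γ t)) := by
  refine hγ.hasMFDerivAt.congr_mfderiv (ContinuousLinearMap.ext fun (r : ℝ) ↦ ?_)
  exact (congrArg (mfderiv 𝓘(ℝ, ℝ) 𝓘(ℝ, E) γ t) (mul_one r).symm).trans
    (ContinuousLinearMap.map_smul (mfderiv 𝓘(ℝ, ℝ) 𝓘(ℝ, E) γ t) r (1 : ℝ))

theorem deriv_chart_comp {e : OpenPartialHomeomorph M E}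
    (he : e ∈ IsManifold.maximalAtlas 𝓘(ℝ, E) ∞ M) (ht : γ t ∈ e.source)
    (hγ : MDifferentiableAt 𝓘(ℝ, ℝ) 𝓘(ℝ, E) γ t) :
    deriv (fun s ↦ e (γ s)) t = chartDeriv e (γ t) (velocity 𝓘(ℝ, E) γ t) :=
  (hasDerivAt_chart_comp he ht (hasMFDerivAt_velocity hγ)).deriv

variable [IsManifold 𝓘(ℝ, E) ∞ M]

theorem trivializationAt_eq_chartDeriv {q₀ q : M} (hq : q ∈ (chartAt E q₀).source)
    (v : TangentSpace 𝓘(ℝ, E) q) :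
    (trivializationAt E (fun x : M ↦ TangentSpace 𝓘(ℝ, E) x) q₀ ⟨q, v⟩).2 =
      chartDeriv (chartAt E q₀) q v := by
  have : IsManifold 𝓘(ℝ, E) 1 M := IsManifold.of_le (n := ∞) (by simp)
  refine Eq.trans ?_ (congrArg (fun T ↦ T v)
    (TangentBundle.continuousLinearMapAt_trivializationAt (I := 𝓘(ℝ, E)) (x₀ := q₀) hq))
  rw [Bundle.Trivialization.continuousLinearMapAt_apply, Bundle.Trivialization.linearMapAt_apply,
    if_pos (by simpa using hq)]

theorem chartDeriv_trivializationAt_symm {q₀ q : M} (hq : q ∈ (chartAt E q₀).source) (a : E) :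
    chartDeriv (chartAt E q₀) q
      ((trivializationAt E (fun x : M ↦ TangentSpace 𝓘(ℝ, E) x) q₀).symm q a) = a := by
  rw [← trivializationAt_eq_chartDeriv hq,
    Bundle.Trivialization.apply_mk_symm _ (by simpa using hq)]

variable [FiniteDimensional ℝ E] {V : Type*} [NormedAddCommGroup V] [NormedSpace ℝ V]
  {cov : AffineConnection 𝓘(ℝ, E) M}
  {H : Π q : M, TangentSpace 𝓘(ℝ, E) q → TangentSpace 𝓘(ℝ, E) q → ℝ}

theorem chartDeriv_cov_extend (cov : AffineConnection 𝓘(ℝ, E) M) {q : M}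
    (u v : TangentSpace 𝓘(ℝ, E) q) :
    chartDeriv (chartAt E q) q (cov (FiberBundle.extend E u) q v) =
      christoffel cov (chartAt E q) (chartAt E q q) (chartDeriv (chartAt E q) q u)
        (chartDeriv (chartAt E q) q v) := by
  set e := chartAt E q
  have he : e ∈ IsManifold.maximalAtlas 𝓘(ℝ, E) ∞ M := IsManifold.chart_mem_maximalAtlas q
  have hq : q ∈ e.source := mem_chart_source E q
  have hconst : chartRep e (FiberBundle.extend E u) =ᶠ[𝓝 (e q)] fun _ ↦ chartDeriv e q u := by
    filter_upwards [e.open_target.mem_nhds (e.map_source hq)] with x hx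
    exact (chartDeriv_trivializationAt_symm (e.map_target hx) _).trans
      (trivializationAt_eq_chartDeriv hq u)
  rw [chartDeriv_cov he cov hq (hconst.differentiableAt_iff.2 (differentiableAt_const _)),
    hconst.fderiv_eq, FiberBundle.extend_apply_self]
  simp

theorem chartDeriv_covAlong_velocity (cov : AffineConnection 𝓘(ℝ, E) M)
    (hγ : ContMDiff 𝓘(ℝ, ℝ) 𝓘(ℝ, E) ∞ γ) (t : ℝ) :
    chartDeriv (chartAt E (γ t)) (γ t) (covAlong cov γ (velocity 𝓘(ℝ, E) γ) t) =
      deriv (deriv fun s ↦ chartAt E (γ t) (γ s)) t +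
      christoffel cov (chartAt E (γ t)) (chartAt E (γ t) (γ t))
        (chartDeriv (chartAt E (γ t)) (γ t) (velocity 𝓘(ℝ, E) γ t))
        (chartDeriv (chartAt E (γ t)) (γ t) (velocity 𝓘(ℝ, E) γ t)) := by
  have hq : γ t ∈ (chartAt E (γ t)).source := mem_chart_source E (γ t)
  have htriv : (fun s ↦ (trivializationAt E (fun x : M ↦ TangentSpace 𝓘(ℝ, E) x) (γ t)
      ⟨γ s, velocity 𝓘(ℝ, E) γ s⟩).2) =ᶠ[𝓝 t] deriv fun s ↦ chartAt E (γ t) (γ s) := by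
    filter_upwards [hγ.continuous.continuousAt.preimage_mem_nhds
      (chart_source_mem_nhds E (γ t))] with s hs
    rw [deriv_chart_comp (IsManifold.chart_mem_maximalAtlas _) hs
      ((hγ s).mdifferentiableAt (by simp))]
    exact trivializationAt_eq_chartDeriv hs _
  rw [covAlong, ContinuousLinearMap.map_add, htriv.deriv_eq]
  exact congrArg₂ (· + ·) (chartDeriv_trivializationAt_symm hq _) (chartDeriv_cov_extend cov _ _)

theorem deriv_deriv_comp_of_isCentroaffineMapAt (hc : IsCentroaffine cov H) {f : M → V}
    (hf : IsCentroaffineMapAt cov H f (γ t)) (hγ : ContMDiff 𝓘(ℝ, ℝ) 𝓘(ℝ, E) ∞ γ) :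
    deriv (deriv fun s ↦ f (γ s)) t =
      mvfderiv 𝓘(ℝ, E) f (γ t) (covAlong cov γ (velocity 𝓘(ℝ, E) γ) t) -
      H (γ t) (velocity 𝓘(ℝ, E) γ t) (velocity 𝓘(ℝ, E) γ t) • f (γ t) := by
  set e := chartAt E (γ t) with he_def
  have he : e ∈ IsManifold.maximalAtlas 𝓘(ℝ, E) ∞ M := IsManifold.chart_mem_maximalAtlas _
  have hq : γ t ∈ e.source := mem_chart_source E (γ t)
  obtain ⟨h, -, -, hH, -⟩ := hc e he
  have hF : ContDiffAt ℝ ∞ (fun x ↦ f (e.symm x)) (e (γ t)) :=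
    contDiffAt_comp_symm he hq hf.contMDiffAt
  have hy : ContDiffAt ℝ ∞ (fun s ↦ e (γ s)) t :=
    ((contMDiffAt_of_mem_maximalAtlas he hq).comp t (hγ t)).contDiffAt
  have hcomp : (fun s ↦ f (γ s)) =ᶠ[𝓝 t] fun s ↦ f (e.symm (e (γ s))) := by
    filter_upwards [hγ.continuous.continuousAt.preimage_mem_nhds (e.open_source.mem_nhds hq)]
      with s hs
    rw [e.left_inv hs]
  have hFq : (fun x ↦ f (e.symm x)) (e (γ t)) = f (γ t) := congrArg f (e.left_inv hq)
  rw [hcomp.deriv.deriv_eq, deriv_deriv_comp (F := fun x ↦ f (e.symm x))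
    (hF.of_le two_le_infty) (hy.of_le two_le_infty), mvfderiv_eq_fderiv he hq
    (hF.differentiableAt (by simp)), chartDeriv_covAlong_velocity cov hγ, ← he_def,
    deriv_chart_comp he hq ((hγ t).mdifferentiableAt (by simp)),
    (gaussFormula_iff he hq hf.contMDiffAt (hH _ hq)).1 hf.gauss, hH _ hq, hFq, map_add]
  abel

theorem isGeodesic_of_deriv_deriv_eq (hc : IsCentroaffine cov H) {f : M → V}
    (hf : ∀ q, IsCentroaffineMapAt cov H f q) (hγ : ContMDiff 𝓘(ℝ, ℝ) 𝓘(ℝ, E) ∞ γ)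
    (h : ∀ t, ∃ μ : ℝ, deriv (deriv fun s ↦ f (γ s)) t = μ • f (γ t)) : IsGeodesic cov γ := by
  refine ⟨hγ, fun t ↦ ?_⟩
  obtain ⟨μ, hμ⟩ := h t
  rw [deriv_deriv_comp_of_isCentroaffineMapAt hc (hf _) hγ, sub_eq_iff_eq_add, ← add_smul] at hμ
  refine congrArg Prod.fst ((hf (γ t)).bijective.1
    (a₁ := (covAlong cov γ (velocity 𝓘(ℝ, E) γ) t, 0))
    (a₂ := (0, μ + H (γ t) (velocity 𝓘(ℝ, E) γ t) (velocity 𝓘(ℝ, E) γ t))) ?_)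
  rw [mframe_apply, mframe_apply]
  simpa using hμ

end Geodesic

/-! ### Completeness -/

section Completeness

open Set Filter Complex ComplexConjugate

theorem eq_zero_of_hasDerivAt_smul {V : Type*} [NormedAddCommGroup V] [NormedSpace ℝ V] {y : ℝ → V}
    {k : ℝ → ℝ} (hk : Continuous k) (hy : ∀ t, HasDerivAt y (k t • y t) t) {t₀ : ℝ}
    (h₀ : y t₀ = 0) (t : ℝ) : y t = 0 :=
  eqOn_zero_of_norm_fderiv_le_continuousOn_mul isOpen_univ isPreconnected_univ
    (fun t _ ↦ (hy t).hasFDerivAt) hk.norm.continuousOn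
    (fun t _ ↦ by rw [ContinuousLinearMap.norm_toSpanSingleton, norm_smul]) (mem_univ t₀) h₀
    (mem_univ t)

/-- Kepler's second law: a plane motion of constant nonzero areal velocity is driven by a central
force. -/
theorem exists_deriv_deriv_eq_smul {z : ℝ → ℂ} (hz : ContDiff ℝ 2 z)
    (harea : ∀ t, (conj (z t) * deriv z t).im = 1) (t : ℝ) :
    ∃ μ : ℝ, deriv (deriv z) t = μ • z t := by
  have hz' : HasDerivAt z (deriv z t) t := (hz.differentiable (by simp) t).hasDerivAt
  have hz'' : HasDerivAt (deriv z) (deriv (deriv z) t) t :=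
    ((contDiff_succ_iff_deriv (n := 1).1 hz).2.2.differentiable (by simp) t).hasDerivAt
  have hderiv : HasDerivAt (fun s ↦ (conj (z s) * deriv z s).im)
      (conj (deriv z t) * deriv z t + conj (z t) * deriv (deriv z) t).im t :=
    imCLM.hasFDerivAt.comp_hasDerivAt t
      ((conjCLE.toContinuousLinearMap.hasFDerivAt.comp_hasDerivAt t hz').mul hz'')
  have him : (conj (z t) * deriv (deriv z) t).im = 0 := by
    have h := hderiv.unique ((hasDerivAt_const t (1 : ℝ)).congr_of_eventuallyEq (.of_forall harea))
    rwa [add_im, conj_mul', ← ofReal_pow, ofReal_im, zero_add] at h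
  have hne : z t ≠ 0 := fun h ↦ by simpa [h] using harea t
  refine ⟨(deriv (deriv z) t / z t).re, ?_⟩
  have him' : (deriv (deriv z) t / z t).im = 0 := by
    simp only [mul_im, conj_re, conj_im] at him
    rw [div_im, ← sub_div, div_eq_zero_iff]
    left
    linarith
  rw [real_smul, ← div_eq_iff hne]
  exact Complex.ext rfl him'

section CentralForce

variable {V : Type*} [NormedAddCommGroup V] [NormedSpace ℝ V] [FiniteDimensional ℝ V]

theorem exists_complex_plane {u w : V} (h : LinearIndependent ℝ ![u, w]) :
    ∃ (ι : ℂ →L[ℝ] V) (ζ : V →L[ℝ] ℂ), ι 1 = u ∧ ι I = w ∧ ∀ z, ζ (ι z) = z := by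
  let ι : ℂ →L[ℝ] V := reCLM.smulRight u + imCLM.smulRight w
  have hι (z : ℂ) : ι z = z.re • u + z.im • w := rfl
  have hinj : LinearMap.ker ι.toLinearMap = ⊥ := LinearMap.ker_eq_bot'.2 fun z hz ↦
    Complex.ext_iff.2 (LinearIndependent.pair_iff.1 h _ _ hz)
  obtain ⟨ζ, hζ⟩ := ι.toLinearMap.exists_leftInverse_of_injective hinj
  exact ⟨ι, LinearMap.toContinuousLinearMap ζ, by simp [hι], by simp [hι],
    fun z ↦ LinearMap.congr_fun hζ z⟩

variable {ι : ℂ →L[ℝ] V} {ζ : V →L[ℝ] ℂ}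

/-- For a plane `ι : ℂ → V` and a projection `ζ` onto it, the field `u ↦ ι (i ζ(u)) / N(u)` where
`N` is a positive definite quadratic form which on the plane equals `‖ζ u‖²`. On the plane it is the
rotation field `i z / |z|²`, whose areal velocity is constant. -/
def arealField (ι : ℂ →L[ℝ] V) (ζ : V →L[ℝ] ℂ) (u : V) : V :=
  (‖ζ u‖ ^ 2 + ‖toEuclidean (u - ι (ζ u))‖ ^ 2)⁻¹ • ι (I * ζ u)

theorem contDiffAt_arealField {u : V} (hu : u ≠ 0) : ContDiffAt ℝ ∞ (arealField ι ζ) u := by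
  have hN : ContDiff ℝ ∞ fun u ↦ ‖ζ u‖ ^ 2 + ‖toEuclidean (u - ι (ζ u))‖ ^ 2 :=
    (ζ.contDiff.norm_sq ℝ).add (((toEuclidean (E := V)).contDiff.comp
      (contDiff_id.sub (ι.contDiff.comp ζ.contDiff))).norm_sq ℝ)
  refine (hN.contDiffAt.inv fun h ↦ hu ?_).smul
    (ι.contDiff.comp (contDiff_const.mul ζ.contDiff)).contDiffAt
  obtain ⟨hζ, hr⟩ := (add_eq_zero_iff_of_nonneg (by positivity) (by positivity)).1 h
  have hζ : ζ u = 0 := by simpa using hζ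
  simpa [hζ] using hr

theorem arealField_of_apply_eq {u : V} (hu : ι (ζ u) = u) :
    arealField ι ζ u = (‖ζ u‖ ^ 2)⁻¹ • ι (I * ζ u) := by
  simp [arealField, hu]

theorem exists_deriv_deriv_eq_smul_of_hasDerivAt_arealField (hι : ∀ z, ζ (ι z) = z) {c : ℝ → V}
    (hc : ContDiff ℝ 2 c) (hne : ∀ t, c t ≠ 0) {s : ℝ → ℝ} (hs : Continuous s)
    (hderiv : ∀ t, HasDerivAt c (arealField ι ζ (c t) - s t • c t) t) (h₀ : ι (ζ (c 0)) = c 0)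
    (t : ℝ) : ∃ μ : ℝ, deriv (deriv c) t = μ • c t := by
  let r : V →L[ℝ] V := .id ℝ V - ι.comp ζ
  have hr_field (u : V) : r (arealField ι ζ u) = 0 := by
    rw [arealField, map_smul, show r (ι (I * ζ u)) = 0 by simp [r, hι], smul_zero]
  have hplane (t : ℝ) : ι (ζ (c t)) = c t := by
    have hr (t : ℝ) : HasDerivAt (fun t ↦ r (c t)) (-s t • r (c t)) t := by
      refine (r.hasFDerivAt.comp_hasDerivAt t (hderiv t)).congr_deriv ?_
      rw [map_sub, map_smul, hr_field, zero_sub, neg_smul]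
    exact (sub_eq_zero.1 (eq_zero_of_hasDerivAt_smul hs.neg hr (sub_eq_zero.2 h₀.symm) t)).symm
  have hζ (t : ℝ) : HasDerivAt (fun t ↦ ζ (c t))
      ((‖ζ (c t)‖ ^ 2)⁻¹ • (I * ζ (c t)) - s t • ζ (c t)) t := by
    refine (ζ.hasFDerivAt.comp_hasDerivAt t (hderiv t)).congr_deriv ?_
    rw [arealField_of_apply_eq (hplane t), map_sub, map_smul, map_smul, hι]
  have harea (t : ℝ) : (conj (ζ (c t)) * deriv (fun t ↦ ζ (c t)) t).im = 1 := by
    have hpos : ‖ζ (c t)‖ ^ 2 ≠ 0 := by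
      simpa using fun h : ζ (c t) = 0 ↦ hne t (by rw [← hplane, h, map_zero])
    rw [(hζ t).deriv, mul_sub, mul_smul_comm, mul_smul_comm, mul_left_comm, conj_mul', sub_im,
      smul_im, smul_im, ← ofReal_pow, ofReal_im, I_mul_im, ofReal_re]
    simp [hpos]
  have hz : ContDiff ℝ 2 fun t ↦ ζ (c t) := ζ.contDiff.comp hc
  have hderiv_ι {z : ℝ → ℂ} (hz : Differentiable ℝ z) :
      deriv (fun t ↦ ι (z t)) = fun t ↦ ι (deriv z t) :=
    funext fun t ↦ (ι.hasFDerivAt.comp_hasDerivAt t (hz t).hasDerivAt).deriv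
  obtain ⟨μ, hμ⟩ := exists_deriv_deriv_eq_smul hz harea t
  refine ⟨μ, ?_⟩
  rw [show c = fun t ↦ ι (ζ (c t)) from funext fun t ↦ (hplane t).symm,
    hderiv_ι (hz.differentiable (by simp)),
    hderiv_ι ((contDiff_succ_iff_deriv (n := 1).1 hz).2.2.differentiable (by simp))]
  exact (congrArg ι hμ).trans (map_smul ι μ _)

end CentralForce

section TangentialPart

variable {E V : Type*} [NormedAddCommGroup E] [NormedSpace ℝ E] [NormedAddCommGroup V]
  [NormedSpace ℝ V] {M : Type*} [TopologicalSpace M] [ChartedSpace E M] [IsManifold 𝓘(ℝ, E) ∞ M]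
  {cov : AffineConnection 𝓘(ℝ, E) M}
  {H : Π q : M, TangentSpace 𝓘(ℝ, E) q → TangentSpace 𝓘(ℝ, E) q → ℝ} {f : M → V}

theorem contDiffAt_frame {F : E → V} {x : E} (hF : ContDiffAt ℝ ∞ F x) :
    ContDiffAt ℝ ∞ (frame F) x :=
  ((hF.fderiv_right (by simp)).clm_comp contDiffAt_const).add (contDiffAt_const.smulRight hF)

theorem IsCentroaffineMapAt.isInvertible_frame [FiniteDimensional ℝ E]
    {e : OpenPartialHomeomorph M E} (he : e ∈ IsManifold.maximalAtlas 𝓘(ℝ, E) ∞ M) {q : M}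
    (hq : q ∈ e.source) (hf : IsCentroaffineMapAt cov H f q) :
    (frame (fun x ↦ f (e.symm x)) (e q)).IsInvertible := by
  have hdiff := (contDiffAt_comp_symm he hq hf.contMDiffAt).differentiableAt (by simp)
  have hbij : Function.Bijective (frame (fun x ↦ f (e.symm x)) (e q)) := by
    refine (Function.Bijective.of_comp_iff _
      ((chartDerivEquiv he hq).bijective.prodMap Function.bijective_id)).1 ?_
    exact (congrArg Function.Bijective (funext fun u ↦ mframe_eq_frame he hq hdiff u)).mp
      hf.bijective
  exact ⟨(LinearEquiv.ofBijective _ hbij).toContinuousLinearEquiv, rfl⟩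

theorem IsCentroaffineMapAt.ne_zero {q : M} (hf : IsCentroaffineMapAt cov H f q) : f q ≠ 0 := by
  intro h
  have := congrArg Prod.snd (hf.bijective.1 (a₁ := (0, 0)) (a₂ := (0, 1))
    (by simp [mframe_apply, h]))
  simp at this

theorem IsCentroaffineMapAt.linearIndependent {p : M} (hf : IsCentroaffineMapAt cov H f p)
    {v : TangentSpace 𝓘(ℝ, E) p} (hv : v ≠ 0) :
    LinearIndependent ℝ ![f p, mvfderiv 𝓘(ℝ, E) f p v] := by
  refine LinearIndependent.pair_iff.2 fun s t hst ↦ ?_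
  have h := hf.bijective.1 (a₁ := (t • v, s)) (a₂ := (0, 0))
    (by simpa [mframe_apply, add_comm] using hst)
  exact ⟨congrArg Prod.snd h, (smul_eq_zero.1 (congrArg Prod.fst h)).resolve_right hv⟩

theorem exists_mframe_eq [FiniteDimensional ℝ E] (hf : ∀ q, IsCentroaffineMapAt cov H f q)
    {X : V → V} (hX : ∀ q, ContDiffAt ℝ ∞ X (f q)) :
    ∃ (W : Π q : M, TangentSpace 𝓘(ℝ, E) q) (s : M → ℝ), CMDiff ∞ (T% W) ∧ Continuous s ∧
      ∀ q, mframe f q (W q, s q) = X (f q) := by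
  choose w hw using fun q ↦ (hf q).bijective.2 (X (f q))
  suffices hsmooth : ∀ q,
      CMDiffAt ∞ (T% (fun q ↦ (w q).1)) q ∧ ContinuousAt (fun q ↦ (w q).2) q from
    ⟨fun q ↦ (w q).1, fun q ↦ (w q).2, fun q ↦ (hsmooth q).1,
      continuous_iff_continuousAt.2 fun q ↦ (hsmooth q).2, hw⟩
  intro q
  set e := chartAt E q
  have he : e ∈ IsManifold.maximalAtlas 𝓘(ℝ, E) ∞ M := IsManifold.chart_mem_maximalAtlas _
  have hq : q ∈ e.source := mem_chart_source E q
  have hF {p : M} (hp : p ∈ e.source) : ContDiffAt ℝ ∞ (fun x ↦ f (e.symm x)) (e p) :=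
    contDiffAt_comp_symm he hp (hf p).contMDiffAt
  let g (x : E) : E × ℝ := (frame (fun x ↦ f (e.symm x)) x).inverse (X (f (e.symm x)))
  have hg : ContDiffAt ℝ ∞ g (e q) :=
    (((hf q).isInvertible_frame he hq).contDiffAt_map_inverse.comp (e q)
      (contDiffAt_frame (hF hq))).clm_apply
        (ContDiffAt.comp (e q) (by simpa only [e.left_inv hq] using hX q) (hF hq))
  have hgw : ∀ᶠ p in 𝓝 q, (chartInv e p (g (e p)).1, (g (e p)).2) = w p := by
    filter_upwards [e.open_source.mem_nhds hq] with p hp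
    refine (hf p).bijective.1
      ((mframe_eq_frame he hp ((hF hp).differentiableAt (by simp)) _).trans ?_)
    rw [chartDeriv_chartInv he hp, ((hf p).isInvertible_frame he hp).self_apply_inverse,
      e.left_inv hp]
    exact (hw p).symm
  refine ⟨(contMDiffAt_chartField he hq hg.fst).congr_of_eventuallyEq ?_,
    ((hg.continuousAt.comp (e.continuousAt hq)).snd).congr ?_⟩
  · filter_upwards [hgw] with p hp
    rw [← hp]
    rfl
  · filter_upwards [hgw] with p hp using by
      rw [← hp]
      rfl

end TangentialPart

variable {E V : Type*} [NormedAddCommGroup E] [NormedSpace ℝ E] [FiniteDimensional ℝ E]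
  [NormedAddCommGroup V] [NormedSpace ℝ V] [FiniteDimensional ℝ V]
  {M : Type*} [TopologicalSpace M] [T2Space M] [CompactSpace M] [ChartedSpace E M]
  [IsManifold 𝓘(ℝ, E) ∞ M] {cov : AffineConnection 𝓘(ℝ, E) M}
  {H : Π q : M, TangentSpace 𝓘(ℝ, E) q → TangentSpace 𝓘(ℝ, E) q → ℝ} {f : M → V}

theorem exists_isGeodesic_of_ne_zero (hc : IsCentroaffine cov H)
    (hf : ∀ q, IsCentroaffineMapAt cov H f q) {p : M} {v : TangentSpace 𝓘(ℝ, E) p} (hv : v ≠ 0) :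
    ∃ γ : ℝ → M, IsGeodesic cov γ ∧
      (⟨γ 0, velocity 𝓘(ℝ, E) γ 0⟩ : TangentBundle 𝓘(ℝ, E) M) = ⟨p, v⟩ := by
  obtain ⟨ι, ζ, hι₁, hιI, hι⟩ := exists_complex_plane ((hf p).linearIndependent hv)
  obtain ⟨W, s, hW, hs, hWs⟩ := exists_mframe_eq hf (X := arealField ι ζ)
    fun q ↦ contDiffAt_arealField (hf q).ne_zero
  have hfp : ζ (f p) = 1 := by rw [← hι₁, hι]
  have hWp : W p = v := by
    refine congrArg Prod.fst ((hf p).bijective.1 (a₁ := (W p, s p)) (a₂ := (v, 0)) ?_)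
    rw [hWs, arealField_of_apply_eq (by rw [hfp, hι₁]), hfp]
    simp [mframe_apply, hιI]
  obtain ⟨γ, hγ₀, hγ⟩ := exists_isMIntegralCurve_of_compactSpace hW p
  have hγ_smooth := contMDiff_of_isMIntegralCurve hW hγ
  have hfγ : ContDiff ℝ ∞ fun t ↦ f (γ t) :=
    ContMDiff.contDiff fun t ↦ (hf (γ t)).contMDiffAt.comp t (hγ_smooth t)
  have hderiv (t : ℝ) :
      HasDerivAt (fun t ↦ f (γ t)) (arealField ι ζ (f (γ t)) - s (γ t) • f (γ t)) t := by
    rw [← hWs, mframe_apply, add_sub_cancel_right]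
    exact hasDerivAt_comp_of_hasMFDerivAt ((hf _).contMDiffAt.mdifferentiableAt (by simp)) (hγ t)
  refine ⟨γ, isGeodesic_of_deriv_deriv_eq hc hf hγ_smooth
    (exists_deriv_deriv_eq_smul_of_hasDerivAt_arealField hι (hfγ.of_le two_le_infty)
      (fun t ↦ (hf _).ne_zero) (hs.comp hγ.continuous) hderiv (by rw [hγ₀, hfp, hι₁])), ?_⟩
  rw [velocity_eq_of_hasMFDerivAt (hγ 0), hγ₀, hWp]

theorem geodesicallyComplete_of_isCentroaffineMapAt (hc : IsCentroaffine cov H)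
    (hf : ∀ q, IsCentroaffineMapAt cov H f q) : GeodesicallyComplete cov := by
  rintro ⟨p, v⟩
  by_cases hv : v = 0
  · refine ⟨fun _ ↦ p, isGeodesic_of_deriv_deriv_eq hc hf contMDiff_const fun t ↦ ⟨0, by simp⟩, ?_⟩
    rw [hv, velocity, mfderiv_const]
    rfl
  · exact exists_isGeodesic_of_ne_zero hc hf hv

theorem IsCentroaffine.geodesicallyComplete (hM : IsCoveredByTwoCells E M)
    (hc : IsCentroaffine cov H) : GeodesicallyComplete cov := by
  obtain ⟨e₁, he₁, e₂, he₂, ht₁, ht₂, hcover, hconn⟩ := hM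
  obtain ⟨f, hf⟩ := exists_isCentroaffineMapAt hc he₁ ht₁ he₂ ht₂ hcover hconn
  exact geodesicallyComplete_of_isCentroaffineMapAt hc hf

end Completeness

/-! ### Dual connections in coordinates -/

section BilinForm

variable {K V : Type*} [Field K] [AddCommGroup V] [Module K V] {B B' : LinearMap.BilinForm K V}

theorem trace_eq_zero_of_skew [NeZero (2 : K)] [FiniteDimensional K V] (hB : B.Nondegenerate)
    {T : V →ₗ[K] V} (hT : ∀ c d, B (T c) d = -B c (T d)) : LinearMap.trace K V T = 0 := by
  have hconj : (B.toDual hB).conj (-T) = Module.Dual.transpose (R := K) T := by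
    refine LinearMap.ext fun φ ↦ LinearMap.ext fun w ↦ ?_
    obtain ⟨v, rfl⟩ := (B.toDual hB).surjective φ
    rw [LinearEquiv.conj_apply_apply, LinearEquiv.symm_apply_apply, LinearMap.BilinForm.toDual_def,
      LinearMap.neg_apply, map_neg, LinearMap.neg_apply, hT, neg_neg]
    rfl
  have htrace : -LinearMap.trace K V T = LinearMap.trace K V T := by
    rw [← map_neg, ← LinearMap.trace_conj' (-T) (B.toDual hB), hconj, LinearMap.trace_transpose']
  have hmul : 2 * LinearMap.trace K V T = 0 := by linear_combination -htrace
  exact (mul_eq_zero.1 hmul).resolve_left two_ne_zero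

theorem eq_div_mul_of_skew (hB : ∀ a b, B a b = B b a) (hB' : ∀ a b, B' a b = B' b a)
    (hskew : ∀ a b c, B' b c * B a c = B' a c * B b c) {c₀ : V} (hc₀ : B c₀ c₀ ≠ 0) (a b : V) :
    B' a b = B' c₀ c₀ / B c₀ c₀ * B a b := by
  have hskew₀ (a : V) : B' a c₀ * B c₀ c₀ = B' c₀ c₀ * B a c₀ := hskew c₀ a c₀
  have hadd := hskew c₀ a (b + c₀)
  simp only [map_add] at hadd
  have hb := hskew₀ b
  rw [hB' b, hB b] at hb
  field_simp
  refine mul_right_cancel₀ hc₀ ?_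
  linear_combination B c₀ c₀ * (hadd - hskew c₀ a b - hskew₀ a) - B c₀ b * hskew₀ a + B a c₀ * hb

end BilinForm

section DualAlgebra

open Set Filter

variable {E : Type*} [NormedAddCommGroup E] [NormedSpace ℝ E] {G : E → E →L[ℝ] E →L[ℝ] ℝ}
  {Γ Γ' : E → E →L[ℝ] E →L[ℝ] E} {x : E}

theorem fderiv_bilin_apply {u w : E → E} (hG : DifferentiableAt ℝ G x)
    (hu : DifferentiableAt ℝ u x) (hw : DifferentiableAt ℝ w x) (a : E) :
    fderiv ℝ (fun y ↦ G y (u y) (w y)) x a =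
      fderiv ℝ G x a (u x) (w x) + G x (fderiv ℝ u x a) (w x) + G x (u x) (fderiv ℝ w x a) := by
  rw [((hG.hasFDerivAt.clm_apply hu.hasFDerivAt).clm_apply hw.hasFDerivAt).fderiv]
  simp only [add_apply, ContinuousLinearMap.comp_apply, ContinuousLinearMap.flip_apply]
  ring

theorem fderiv_fderiv_bilin_apply_of_dual (hG : ContDiffAt ℝ 2 G x) (hΓ : DifferentiableAt ℝ Γ x)
    (hΓ' : DifferentiableAt ℝ Γ' x)
    (hmet : ∀ᶠ y in 𝓝 x, ∀ c a b, fderiv ℝ G y c a b = G y (Γ y a c) b + G y a (Γ' y b c))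
    (a b c d : E) :
    fderiv ℝ (fderiv ℝ fun y ↦ G y c d) x a b =
      (G x (Γ x (Γ x c b) a) d + G x (Γ x c b) (Γ' x d a) + G x (fderiv ℝ Γ x a c b) d) +
      (G x (Γ x c a) (Γ' x d b) + G x c (Γ' x (Γ' x d b) a) + G x c (fderiv ℝ Γ' x a d b)) := by
  have hGd : DifferentiableAt ℝ G x := hG.differentiableAt (by simp)
  have hdiff {T : E → E →L[ℝ] E →L[ℝ] E} (hT : DifferentiableAt ℝ T x) (u v : E) :
      DifferentiableAt ℝ (fun y ↦ T y u v) x :=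
    (hasFDerivAt_clm_apply_const₂ hT.hasFDerivAt u v).differentiableAt
  have hsnd : DifferentiableAt ℝ (fderiv ℝ fun y ↦ G y c d) x :=
    (((hG.clm_apply contDiffAt_const).clm_apply contDiffAt_const).fderiv_right (m := 1)
      (by norm_num)).differentiableAt (by simp)
  have hfst : (fun y ↦ fderiv ℝ (fun y ↦ G y c d) y b) =ᶠ[𝓝 x]
      fun y ↦ G y (Γ y c b) d + G y c (Γ' y d b) := by
    filter_upwards [hmet, hG.eventually (by simp)] with y hy hGy
    rw [← fderiv_clm_apply_const₂ (hGy.differentiableAt (by simp)), hy]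
  have hΓc := (hGd.clm_apply (hdiff hΓ c b)).clm_apply (differentiableAt_const d)
  have hΓ'd := (hGd.clm_apply (differentiableAt_const c)).clm_apply (hdiff hΓ' d b)
  calc fderiv ℝ (fderiv ℝ fun y ↦ G y c d) x a b
      = fderiv ℝ (fun y ↦ fderiv ℝ (fun y ↦ G y c d) y b) x a := by
        rw [(hasFDerivAt_clm_apply_const hsnd.hasFDerivAt b).fderiv]
        rfl
    _ = _ := by
        rw [hfst.fderiv_eq, (hΓc.hasFDerivAt.fun_add hΓ'd.hasFDerivAt).fderiv, add_apply,
          fderiv_bilin_apply hGd (hdiff hΓ c b) (differentiableAt_const d),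
          fderiv_bilin_apply hGd (differentiableAt_const c) (hdiff hΓ' d b),
          hmet.self_of_nhds, hmet.self_of_nhds, fderiv_clm_apply_const₂ hΓ,
          fderiv_clm_apply_const₂ hΓ']
        simp

theorem bilin_riem_add_eq_zero_of_dual (hG : ContDiffAt ℝ 2 G x) (hΓ : DifferentiableAt ℝ Γ x)
    (hΓ' : DifferentiableAt ℝ Γ' x)
    (hmet : ∀ᶠ y in 𝓝 x, ∀ c a b, fderiv ℝ G y c a b = G y (Γ y a c) b + G y a (Γ' y b c))
    (a b c d : E) : G x (riem Γ x a b c) d + G x c (riem Γ' x a b d) = 0 := by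
  have hsymm : fderiv ℝ (fderiv ℝ fun y ↦ G y c d) x a b =
      fderiv ℝ (fderiv ℝ fun y ↦ G y c d) x b a :=
    (((hG.clm_apply contDiffAt_const).clm_apply contDiffAt_const).isSymmSndFDerivAt (by simp)).eq
      a b
  rw [fderiv_fderiv_bilin_apply_of_dual hG hΓ hΓ' hmet,
    fderiv_fderiv_bilin_apply_of_dual hG hΓ hΓ' hmet] at hsymm
  simp only [riem, map_add, map_sub, add_apply, sub_apply]
  linear_combination hsymm

theorem riem_swap (Γ : E → E →L[ℝ] E →L[ℝ] E) (x a b c : E) :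
    riem Γ x a b c = -riem Γ x b a c := by
  simp only [riem]
  abel

theorem riem_bianchi (hΓ : DifferentiableAt ℝ Γ x)
    (hsymm : ∀ᶠ y in 𝓝 x, ∀ a b, Γ y a b = Γ y b a) (a b c : E) :
    riem Γ x a b c + riem Γ x b c a + riem Γ x c a b = 0 := by
  have fderiv_symm (a b c : E) : fderiv ℝ Γ x a b c = fderiv ℝ Γ x a c b := by
    rw [fderiv_clm_apply_const₂ hΓ, fderiv_clm_apply_const₂ hΓ,
      (show (fun y ↦ Γ y b c) =ᶠ[𝓝 x] fun y ↦ Γ y c b from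
        hsymm.mono fun y hy ↦ hy b c).fderiv_eq]
  have hsymm₀ := hsymm.self_of_nhds
  simp only [riem]
  rw [fderiv_symm a c b, fderiv_symm b a c, fderiv_symm c b a, hsymm₀ c b, hsymm₀ a c,
    hsymm₀ b a]
  abel

theorem ricciForm_symm_of_skew [FiniteDimensional ℝ E] {B : LinearMap.BilinForm ℝ E}
    (hB : B.Nondegenerate) (hΓ : DifferentiableAt ℝ Γ x)
    (hsymm : ∀ᶠ y in 𝓝 x, ∀ a b, Γ y a b = Γ y b a)
    (hskew : ∀ a b c d, B (riem Γ x a b c) d = -B c (riem Γ x a b d)) (b c : E) :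
    ricciForm Γ x b c = ricciForm Γ x c b := by
  let T : E →ₗ[ℝ] E :=
    { toFun a := riem Γ x b c a
      map_add' a a' := by simp only [riem, map_add, add_apply]; abel
      map_smul' t a := by
        simp only [riem, map_smul, smul_apply, RingHom.id_apply]
        module }
  have hsub : riemEnd Γ x b c - riemEnd Γ x c b = -T := by
    ext a
    have hbianchi := riem_bianchi hΓ hsymm a b c
    rw [riem_swap Γ x c a b] at hbianchi
    change riem Γ x a b c - riem Γ x a c b = -riem Γ x b c a
    rw [← sub_eq_zero, ← hbianchi]
    abel
  have htrace := congrArg (LinearMap.trace ℝ E) hsub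
  rw [map_sub, map_neg, trace_eq_zero_of_skew hB (T := T) fun a d ↦ hskew b c a d, neg_zero,
    sub_eq_zero] at htrace
  exact htrace

theorem IsCentroaffineAt.dual {h : E → E →L[ℝ] E →L[ℝ] ℝ} (hc : IsCentroaffineAt Γ h x)
    {G : E →L[ℝ] E →L[ℝ] ℝ} (hG : ∀ a b, G a b = G b a) (hpos : ∀ a, a ≠ 0 → 0 < G a a)
    (hR : ∀ a b c, riem Γ x a b c = riem Γ' x a b c)
    (hskew : ∀ a b c d, G (riem Γ x a b c) d = -G c (riem Γ x a b d))
    (hΓ' : ∀ a b, Γ' x a b = Γ' x b a)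
    (hcubic : ∀ a b c, G (Γ' x a b - Γ x a b) c = G (Γ' x a c - Γ x a c) b) :
    IsCentroaffineAt Γ' h x where
  christoffel_symm := hΓ'
  symm := hc.symm
  riem_eq a b c := by rw [← hR, hc.riem_eq]
  codazzi a b c := by
    rcases eq_or_ne a 0 with rfl | ha
    · simp
    have hhG (a b c : E) : h x b c * G a c = h x a c * G b c := by
      have hzero : G (riem Γ x a b c) c = 0 := by
        linarith [hskew a b c c, hG c (riem Γ x a b c)]
      rw [hc.riem_eq] at hzero
      simpa [sub_eq_zero] using hzero
    have hmul (v w : E) : h x v w = h x a a / G a a * G v w :=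
      eq_div_mul_of_skew (B := G.toLinearMap₁₂) (B' := (h x).toLinearMap₁₂) hG hc.symm hhG
        (hpos a ha).ne' v w
    have hdiff : h x b (Γ' x c a - Γ x c a) = h x a (Γ' x c b - Γ x c b) := by
      rw [hmul b, hmul a (_ - _), hG b, hG a (_ - _), hcubic]
    rw [map_sub, map_sub] at hdiff
    linear_combination hc.codazzi a b c - hdiff

end DualAlgebra

/-! ### The dual connection in a chart -/

section DualConnection

open Set Filter

variable {E : Type*} [NormedAddCommGroup E] [NormedSpace ℝ E] [FiniteDimensional ℝ E]
  {M : Type*} [TopologicalSpace M] [ChartedSpace E M]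
  [Bundle.RiemannianBundle (fun x : M ↦ TangentSpace 𝓘(ℝ, E) x)]
  {e : OpenPartialHomeomorph M E} {x : E}

/-- The coefficients of the Riemannian metric in the chart `e`, as a function on its target. -/
def chartMetric (e : OpenPartialHomeomorph M E) (x : E) : E →L[ℝ] E →L[ℝ] ℝ :=
  have h : IsBilinearMap ℝ (fun a b : E ↦
      inner ℝ (chartInv e (e.symm x) a) (chartInv e (e.symm x) b)) :=
    { add_left := fun a a' b ↦ by rw [map_add, inner_add_left]
      smul_left := fun t a b ↦ by rw [map_smul, real_inner_smul_left, smul_eq_mul]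
      add_right := fun a b b' ↦ by rw [map_add, inner_add_right]
      smul_right := fun t a b ↦ by rw [map_smul, real_inner_smul_right, smul_eq_mul] }
  h.toContinuousBilinearMap

theorem chartMetric_apply (e : OpenPartialHomeomorph M E) (x a b : E) :
    chartMetric e x a b = inner ℝ (chartInv e (e.symm x) a) (chartInv e (e.symm x) b) := rfl

theorem chartMetric_comm (e : OpenPartialHomeomorph M E) (x a b : E) :
    chartMetric e x a b = chartMetric e x b a := by
  rw [chartMetric_apply, chartMetric_apply, real_inner_comm]

theorem chartMetric_map {q : M} (hq : q ∈ e.source) (a b : E) :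
    chartMetric e (e q) a b =
      inner ℝ (chartField e (fun _ ↦ a) q) (chartField e (fun _ ↦ b) q) := by
  have h : ∀ q', q' = q → inner ℝ (chartInv e q' a) (chartInv e q' b) =
      inner ℝ (chartField e (fun _ ↦ a) q) (chartField e (fun _ ↦ b) q) := by
    rintro _ rfl
    rfl
  exact h _ (e.left_inv hq)

theorem chartMetric_pos (he : e ∈ IsManifold.maximalAtlas 𝓘(ℝ, E) ∞ M) (hx : x ∈ e.target) {a : E}
    (ha : a ≠ 0) : 0 < chartMetric e x a a := by
  rw [chartMetric_apply]
  refine real_inner_self_pos.2 fun h ↦ ha ?_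
  rw [← chartDeriv_chartInv he (e.map_target hx) a, h, map_zero]

theorem eq_zero_of_chartMetric_eq_zero (he : e ∈ IsManifold.maximalAtlas 𝓘(ℝ, E) ∞ M)
    (hx : x ∈ e.target) {a : E} (h : ∀ b, chartMetric e x a b = 0) : a = 0 := by
  by_contra ha
  exact (chartMetric_pos he hx ha).ne' (h a)

theorem nondegenerate_chartMetric (he : e ∈ IsManifold.maximalAtlas 𝓘(ℝ, E) ∞ M)
    (hx : x ∈ e.target) : (chartMetric e x).toLinearMap₁₂.Nondegenerate :=
  ⟨fun _ ↦ eq_zero_of_chartMetric_eq_zero he hx, fun b h ↦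
    eq_zero_of_chartMetric_eq_zero he hx fun a ↦ (chartMetric_comm e x b a).trans (h a)⟩

theorem isInvertible_chartMetric (he : e ∈ IsManifold.maximalAtlas 𝓘(ℝ, E) ∞ M)
    (hx : x ∈ e.target) : (chartMetric e x).IsInvertible :=
  ⟨((LinearMap.BilinForm.toDual _ (nondegenerate_chartMetric he hx)).trans
    LinearMap.toContinuousLinearMap).toContinuousLinearEquiv, rfl⟩

theorem inner_eq_chartMetric (he : e ∈ IsManifold.maximalAtlas 𝓘(ℝ, E) ∞ M) (hx : x ∈ e.target)
    (v w : TangentSpace 𝓘(ℝ, E) (e.symm x)) :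
    inner ℝ v w = chartMetric e x (chartDeriv e (e.symm x) v) (chartDeriv e (e.symm x) w) := by
  rw [chartMetric_apply, chartInv_chartDeriv he (e.map_target hx),
    chartInv_chartDeriv he (e.map_target hx)]

variable [IsManifold 𝓘(ℝ, E) ∞ M]
  [IsContMDiffRiemannianBundle 𝓘(ℝ, E) ∞ E (fun x : M ↦ TangentSpace 𝓘(ℝ, E) x)]

theorem contDiffOn_chartMetric (he : e ∈ IsManifold.maximalAtlas 𝓘(ℝ, E) ∞ M) :
    ContDiffOn ℝ ∞ (chartMetric e) e.target := by
  refine contDiffOn_clm_apply.2 fun a ↦ contDiffOn_clm_apply.2 fun b ↦ fun x hx ↦ ?_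
  have hinner : ContMDiffAt 𝓘(ℝ, E) 𝓘(ℝ, ℝ) ∞ (fun q : M ↦
      inner ℝ (chartField e (fun _ ↦ a) q) (chartField e (fun _ ↦ b) q)) (e.symm x) :=
    ContMDiffAt.inner_bundle (contMDiffAt_chartField he (e.map_target hx) contDiffAt_const)
      (contMDiffAt_chartField he (e.map_target hx) contDiffAt_const)
  have hcomp := hinner.comp x (contMDiffAt_symm_of_mem_maximalAtlas he hx)
  refine (contMDiffAt_iff_contDiffAt.1 hcomp).contDiffWithinAt.congr_of_mem (fun y hy ↦ ?_) hx
  have hmap := chartMetric_map (e.map_target hy) a b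
  rwa [e.right_inv hy] at hmap

theorem contDiffAt_chartMetric (he : e ∈ IsManifold.maximalAtlas 𝓘(ℝ, E) ∞ M)
    (hx : x ∈ e.target) : ContDiffAt ℝ ∞ (chartMetric e) x :=
  (contDiffOn_chartMetric he).contDiffAt (e.open_target.mem_nhds hx)

theorem fderiv_chartMetric (he : e ∈ IsManifold.maximalAtlas 𝓘(ℝ, E) ∞ M)
    (cov : AffineConnection 𝓘(ℝ, E) M) (hx : x ∈ e.target) (c a b : E) :
    fderiv ℝ (chartMetric e) x c a b = chartMetric e x (christoffel cov e x a c) b +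
      chartMetric e x a (christoffel (dual cov) e x b c) := by
  have hxs := e.map_target hx
  have hd : DifferentiableAt ℝ (chartMetric e) x :=
    (contDiffAt_chartMetric he hx).differentiableAt (by simp)
  have hd' : DifferentiableAt ℝ (fun y ↦ chartMetric e y a b) (e (e.symm x)) := by
    rw [e.right_inv hx]
    exact (hasFDerivAt_clm_apply_const₂ hd.hasFDerivAt a b).differentiableAt
  have hmetric : (fun q : M ↦ inner ℝ (chartField e (fun _ ↦ a) q) (chartField e (fun _ ↦ b) q))
      =ᶠ[𝓝 (e.symm x)] fun q ↦ chartMetric e (e q) a b := by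
    filter_upwards [e.open_source.mem_nhds hxs] with q hq
    exact (chartMetric_map hq a b).symm
  have hderiv := mvfderiv_comp_chart he hxs hd' (chartInv e (e.symm x) c)
  rw [e.right_inv hx, chartDeriv_chartInv he hxs] at hderiv
  calc fderiv ℝ (chartMetric e) x c a b
      = mvfderiv 𝓘(ℝ, E) (fun q ↦ chartMetric e (e q) a b) (e.symm x)
          (chartInv e (e.symm x) c) := by rw [fderiv_clm_apply_const₂ hd, ← hderiv]
    _ = mvfderiv 𝓘(ℝ, E) (fun q : M ↦ inner ℝ (chartField e (fun _ ↦ a) q)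
          (chartField e (fun _ ↦ b) q)) (e.symm x) (chartInv e (e.symm x) c) :=
        congrArg (fun T : TangentSpace 𝓘(ℝ, E) (e.symm x) →L[ℝ] ℝ ↦ T (chartInv e (e.symm x) c))
          hmetric.symm.mfderiv_eq
    _ = _ := dual_spec cov (chartInv e (e.symm x) c)
        (mdifferentiableAt_chartField he hxs (differentiableAt_const a))
        (mdifferentiableAt_chartField he hxs (differentiableAt_const b))
    _ = _ := by
        rw [inner_eq_chartMetric he hx, inner_eq_chartMetric he hx, chartDeriv_chartField he hxs,
          chartDeriv_chartField he hxs, christoffel_eq_chartRep he cov hx,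
          christoffel_eq_chartRep he (dual cov) hx]
        rfl

theorem chartMetric_christoffel_dual_sub (he : e ∈ IsManifold.maximalAtlas 𝓘(ℝ, E) ∞ M)
    (cov : AffineConnection 𝓘(ℝ, E) M) (hx : x ∈ e.target) (c a b : E) :
    chartMetric e x (christoffel (dual cov) e x c a - christoffel cov e x c a) b =
      cubicForm cov (e.symm x) (chartInv e (e.symm x) a) (chartInv e (e.symm x) c)
        (chartInv e (e.symm x) b) := by
  have hsub : christoffel (dual cov) e x c a - christoffel cov e x c a =
      chartDeriv e (e.symm x) (dualTerm cov (e.symm x) (chartInv e (e.symm x) c)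
        (chartInv e (e.symm x) a)) := by
    rw [christoffel_eq_chartRep he cov hx, christoffel_eq_chartRep he (dual cov) hx,
      sub_eq_iff_eq_add']
    exact (chartDeriv e (e.symm x)).map_add _ _
  rw [hsub, chartMetric_apply, chartInv_chartDeriv he (e.map_target hx), inner_dualTerm]
  rfl

section Smooth

variable [T2Space M] {cov : AffineConnection 𝓘(ℝ, E) M}
  [CovariantDerivative.ContMDiffCovariantDerivative cov ∞]

theorem contDiffOn_christoffel_dual (he : e ∈ IsManifold.maximalAtlas 𝓘(ℝ, E) ∞ M)
    (cov : AffineConnection 𝓘(ℝ, E) M) [CovariantDerivative.ContMDiffCovariantDerivative cov ∞] :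
    ContDiffOn ℝ ∞ (christoffel (dual cov) e) e.target := by
  have hG := contDiffOn_chartMetric he
  have hΓ := contDiffOn_christoffel he cov
  have hdG : ContDiffOn ℝ ∞ (fderiv ℝ (chartMetric e)) e.target :=
    hG.fderiv_of_isOpen e.open_target (by simp)
  have hinv : ContDiffOn ℝ ∞ (fun x ↦ (chartMetric e x).inverse) e.target := fun x hx ↦
    ((isInvertible_chartMetric he hx).contDiffAt_map_inverse.comp x
      (contDiffAt_chartMetric he hx)).contDiffWithinAt
  refine contDiffOn_clm_apply.2 fun c ↦ contDiffOn_clm_apply.2 fun a ↦ ?_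
  have hlower : ContDiffOn ℝ ∞ (fun x ↦ chartMetric e x (christoffel (dual cov) e x c a))
      e.target := by
    refine contDiffOn_clm_apply.2 fun b ↦ ContDiffOn.congr
      (f := fun x ↦ fderiv ℝ (chartMetric e) x a b c -
        chartMetric e x (christoffel cov e x b a) c) ?_ fun x hx ↦ ?_
    · exact (((hdG.clm_apply contDiffOn_const).clm_apply contDiffOn_const).clm_apply
        contDiffOn_const).sub ((hG.clm_apply ((hΓ.clm_apply contDiffOn_const).clm_apply
          contDiffOn_const)).clm_apply contDiffOn_const)
    · rw [fderiv_chartMetric he cov hx, add_sub_cancel_left, chartMetric_comm]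
  exact (hinv.clm_apply hlower).congr fun x hx ↦
    ((isInvertible_chartMetric he hx).inverse_apply_self _).symm

theorem riem_christoffel_dual (he : e ∈ IsManifold.maximalAtlas 𝓘(ℝ, E) ∞ M)
    (hconj : ConjugateSymmetric cov) (hx : x ∈ e.target) (a b c : E) :
    riem (christoffel cov e) x a b c = riem (christoffel (dual cov) e) x a b c := by
  have hΓ' := ((contDiffOn_christoffel_dual he cov).contDiffAt
    (e.open_target.mem_nhds hx)).differentiableAt (by simp)
  rw [riem_christoffel he cov hx (differentiableAt_christoffel he cov hx),
    riem_christoffel he (dual cov) hx hΓ', hconj]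

theorem chartMetric_riem_skew (he : e ∈ IsManifold.maximalAtlas 𝓘(ℝ, E) ∞ M)
    (hconj : ConjugateSymmetric cov) (hx : x ∈ e.target) (a b c d : E) :
    chartMetric e x (riem (christoffel cov e) x a b c) d =
      -chartMetric e x c (riem (christoffel cov e) x a b d) := by
  have hxn := e.open_target.mem_nhds hx
  rw [riem_christoffel_dual he hconj hx a b d]
  exact eq_neg_of_add_eq_zero_left <| bilin_riem_add_eq_zero_of_dual
    ((contDiffAt_chartMetric he hx).of_le two_le_infty) (differentiableAt_christoffel he cov hx)
    (((contDiffOn_christoffel_dual he cov).contDiffAt hxn).differentiableAt (by simp))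
    (by filter_upwards [hxn] with y hy using fderiv_chartMetric he cov hy) a b c d

theorem ConjugateSymmetric.ricciSymmetric (hconj : ConjugateSymmetric cov)
    (htor : cov.torsion = 0) : RicciSymmetric cov := by
  intro q v w
  have he := IsManifold.chart_mem_maximalAtlas (I := 𝓘(ℝ, E)) (n := ∞) q
  have hq := mem_chart_source E q
  have hx := (chartAt E q).map_source hq
  rw [ricci_eq_ricciForm he cov hq, ricci_eq_ricciForm he cov hq]
  refine ricciForm_symm_of_skew (nondegenerate_chartMetric he hx)
    (differentiableAt_christoffel he cov hx) ?_ (chartMetric_riem_skew he hconj hx) _ _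
  filter_upwards [(chartAt E q).open_target.mem_nhds hx] with y hy using
    christoffel_symm_of_torsion_eq_zero he htor hy

theorem IsCentroaffine.dual {H : Π q : M, TangentSpace 𝓘(ℝ, E) q → TangentSpace 𝓘(ℝ, E) q → ℝ}
    (hc : IsCentroaffine cov H) (hstat : IsStatistical cov) (hconj : ConjugateSymmetric cov) :
    IsCentroaffine (dual cov) H := by
  intro e he
  obtain ⟨h, -, hh, hH, hcent⟩ := hc e he
  refine ⟨h, contDiffOn_christoffel_dual he cov, hh, hH, fun x hx ↦ ?_⟩
  have hsub := chartMetric_christoffel_dual_sub he cov hx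
  refine (hcent x hx).dual (chartMetric_comm e x) (fun a ↦ chartMetric_pos he hx)
    (riem_christoffel_dual he hconj hx) (chartMetric_riem_skew he hconj hx) (fun a b ↦ ?_)
    fun a b c ↦ ?_
  · have hdiff : christoffel (StatGeom.dual cov) e x a b - christoffel cov e x a b =
        christoffel (StatGeom.dual cov) e x b a - christoffel cov e x b a :=
      sub_eq_zero.1 <| eq_zero_of_chartMetric_eq_zero he hx fun c ↦ by
        rw [map_sub, sub_apply, hsub, hsub, hstat.symm_left, sub_self]
    rwa [(hcent x hx).christoffel_symm a b, sub_left_inj] at hdiff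
  · rw [hsub, hsub, hstat.symm_left, hstat.symm_right, hstat.symm_left]

end Smooth

end DualConnection

end StatGeom

end

theorem theorem5p7_general {E : Type*} [NormedAddCommGroup E] [NormedSpace ℝ E]
    [FiniteDimensional ℝ E] (hE : 2 ≤ Module.finrank ℝ E)
    {M : Type*} [TopologicalSpace M] [T2Space M] [CompactSpace M] [ChartedSpace E M]
    [IsManifold 𝓘(ℝ, E) ∞ M] (hM : StatGeom.IsCoveredByTwoCells E M)
    (cov : StatGeom.AffineConnection 𝓘(ℝ, E) M)
    [CovariantDerivative.ContMDiffCovariantDerivative cov ∞]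
    (hflat : StatGeom.ProjectivelyFlat cov) :
    (cov.torsion = 0 → StatGeom.RicciSymmetric cov → StatGeom.GeodesicallyComplete cov) ∧
      ∀ [Bundle.RiemannianBundle (fun x : M ↦ TangentSpace 𝓘(ℝ, E) x)]
        [IsContMDiffRiemannianBundle 𝓘(ℝ, E) ∞ E (fun x : M ↦ TangentSpace 𝓘(ℝ, E) x)],
        StatGeom.IsStatistical cov → StatGeom.ConjugateSymmetric cov →
          StatGeom.GeodesicallyComplete cov ∧
            StatGeom.GeodesicallyComplete (StatGeom.dual cov) := by
  refine ⟨fun htor hric ↦ ?_, fun hstat hconj ↦ ?_⟩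
  · exact (StatGeom.isCentroaffine_of_projectivelyFlat hE htor hric hflat).geodesicallyComplete hM
  · have hric := hconj.ricciSymmetric hstat.torsion_eq_zero
    have hcent := StatGeom.isCentroaffine_of_projectivelyFlat hE hstat.torsion_eq_zero hric hflat
    exact ⟨hcent.geodesicallyComplete hM, (hcent.dual hstat hconj).geodesicallyComplete hM⟩

theorem theorem5p7 (n : ℕ) (hn : 2 ≤ n)
    {M : Type*} [TopologicalSpace M] [T2Space M] [ChartedSpace (EuclideanSpace ℝ (Fin n)) M]
    [IsManifold (𝓡 n) ∞ M]
    (hM : Nonempty (M ≃ₘ⟮𝓡 n, 𝓡 n⟯ Metric.sphere (0 : EuclideanSpace ℝ (Fin (n + 1))) 1))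
    [Bundle.RiemannianBundle (fun x : M ↦ TangentSpace (𝓡 n) x)]
    [IsContMDiffRiemannianBundle (𝓡 n) ∞ (EuclideanSpace ℝ (Fin n))
      (fun x : M ↦ TangentSpace (𝓡 n) x)]
    (cov : StatGeom.AffineConnection (𝓡 n) M)
    [CovariantDerivative.ContMDiffCovariantDerivative cov ∞]
    (hstat : StatGeom.IsStatistical cov) :
    (StatGeom.RicciSymmetric cov → StatGeom.RicciNondegenerate cov →
        StatGeom.ProjectivelyFlat cov → StatGeom.GeodesicallyComplete cov) ∧
      (StatGeom.ConjugateSymmetric cov → StatGeom.ProjectivelyFlat cov →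
        StatGeom.GeodesicallyComplete cov ∧
          StatGeom.GeodesicallyComplete (StatGeom.dual cov)) := by
  obtain ⟨Φ⟩ := hM
  have : CompactSpace M := Φ.toHomeomorph.symm.compactSpace
  have general := theorem5p7_general (by rwa [finrank_euclideanSpace_fin])
    (StatGeom.isCoveredByTwoCells_of_diffeomorph_sphere hn Φ) cov
  exact ⟨fun hric _ hflat ↦ (general hflat).1 hstat.torsion_eq_zero hric,
    fun hconj hflat ↦ (general hflat).2 hstat hconj⟩
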